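/- **Notation.** Let $n\ge 2$. A *rhombus* is a quadruple $(A,B,C,D)$ of points of $\mathbb Z^2$ of one of the forms $((i,j),(i+1,j),(i+2,j+1),(i+1,j+1))$, $((i,j),(i+1,j+1),(i+1,j+2),(i,j+1))$, $((i,j),(i,j-1),(i+1,j-1),(i+1,j))$ with $i,j\in\mathbb Z$. Let $T=\{(i,j)\in\mathbb Z^2:0\le i\le j\le n\}$. A *hive* is a function $h:T\to\mathbb R$ with $h(A)+h(C)\le h(B)+h(D)$ for all rhombi $ABCD$ in $T$. Let $\mathtt{Spec}$ be the set of $x\in\mathbb R^n$ with $x_1\ge\dots\ge x_n$, let $\mathtt{Spec}^\circ$ be the set of $x$ with $x_1>\dots>x_n$, and write $\sum x=\sum_{m=1}^n x_m$. For $\lambda,\mu,\nu\in\mathtt{Spec}$, $\mathtt{HIVE}_{\lambda\boxplus\mu\to\nu}$ is the set of hives with $h(0,i)=\sum_{m\le i}\lambda_m$, $h(i,n)=\sum\lambda+\sum_{m\le i}\mu_m$, $h(i,i)=\sum_{m\le i}\nu_m$ for $0\le i\le n$. For $\lambda,\mu,\gamma,\pi\in\mathtt{Spec}^\circ$ put $$\mathcal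 S=\bigcup_{\sigma\in\mathtt{Spec}}\mathtt{HIVE}_{\sigma\boxplus\mu\to\pi}\times\mathtt{HIVE}_{\gamma\boxplus\lambda\to\sigma},\qquad \mathcal T=\bigcup_{\nu\in\mathtt{Spec}}\mathtt{HIVE}_{\lambda\boxplus\mu\to\nu}\times\mathtt{HIVE}_{\gamma\boxplus\nu\to\pi}.$$ Identify $(k,k')\in\mathcal S$ with the function $\tilde k$ on $\{0,\dots,n\}^2$ given by $\tilde k(i,j)=k(i+j-n,j)-\sum\gamma$ on $U=\{i,j\le n\le i+j\}$ and $\tilde k(i,j)=k'(j,n-i)-\sum\gamma$ on $U'=\{i,j\ge 0,\ i+j\le n\}$, and identify $(h,h')\in\mathcal T$ with the function $\tilde h$ on $\{0,\dots,n\}^2$ given by $\tilde h(i,j)=h(i,j)$ for $i\le j$ and $\tilde h(i,j)=h'(j,n-i+j)-\sum\gamma$ for $i\ge j$. **Lozenge-tiling construction.** A *lozenge* is a quadruple $ABCD$, contained in $U$ or in $U'$, of the form $((i,j),(i+1,j-1),(i+2,j-1),(i+1,j))$, $((i,j),(i,j+1),(i-1,j+2),(i-1,j+1))$ or $((i,j),(i+1,j),(i+1,j+1),(i,j+1))$;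 its weight is $\frac13(\tilde k(A)+\tilde k(C)-\tilde k(B)-\tilde k(D))$. For $0\le i<n$ the *border edge* from $A=(i,n-i)$ to $C=(i+1,n-i-1)$ has two *border triangles* $ABC$, with $B=(i+1,n-i)$ or $B=(i,n-i-1)$; the weight of a border triangle is $\frac13(\tilde k(B)-\tilde k(A))$. For $v=(i,j)$ with $0<i,j<n$ let the hexagon $\hexagon_v=ABCDEF$ have the corners $(0,n),(0,j),(i,j-i),(n+i-j,j-i),(n+i-j,j),(i,n)$ if $i\le j$, and $(i-j,n+j-i),(i-j,j),(i,0),(n,0),(n,j),(i,n+j-i)$ if $i\ge j$; its weight is $\frac13(\tilde k(B)+\tilde k(C)-\tilde k(D)+\tilde k(E)+\tilde k(F))$. A *tiling* $\Xi$ of $\hexagon_v$ is a partition of the solid hexagon into solid lozenges and solid border triangles in which each border edge on $AD$ is adjacent to exactly one border triangle of $\Xi$; $w_\Xi(\tilde k)$ is the sum of the weights of its tiles and of the weight of $\hexagon_v$. Given any $\tilde k:\{0,\dots,n\}^2\to\mathbb R$, define $\tilde h(v)=\max_{\Xi\text{ tiles }\hexagon_v}w_\Xi(\tilde k)$ for $v$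 with $0<i,j<n$, and $\tilde h(v)=\tilde k(v)$ for the other $v\in\{0,\dots,n\}^2$. **Octahedron recurrence.** Functions $\tilde k,\tilde h:\{0,\dots,n\}^2\to\mathbb R$ are related by the octahedron recurrence if there is a function $o$ on $\{[x,y,z,w]\in\mathbb Z_{\ge0}^4:x+y+z+w=n\}$ with $$o[x,y,z{+}1,w{+}1]=\max\bigl(o[x{+}1,y,z{+}1,w]+o[x,y{+}1,z,w{+}1],\ o[x{+}1,y,z,w{+}1]+o[x,y{+}1,z{+}1,w]\bigr)-o[x{+}1,y{+}1,z,w]$$ for all integers $x,y,z,w\ge0$ with $x+y+z+w=n-2$, such that $o[n-j,n-i,0,i+j-n]=\tilde k(i,j)$ on $U$, $o[i,j,n-i-j,0]=\tilde k(i,j)$ on $U'$, $o[0,j-i,n-j,i]=\tilde h(i,j)$ for $i\le j$, and $o[i-j,0,n-i,j]=\tilde h(i,j)$ for $i\ge j$. **Theorem.** The lozenge-tiling construction agrees with the octahedron recurrence: every hexagon $\hexagon_v$ has a tiling and the maximum is attained, and $\tilde k,\tilde h:\{0,\dots,n\}^2\to\mathbb R$ are related by the octahedron recurrence if and only if $\tilde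 h$ is obtained from $\tilde k$ by the lozenge-tiling construction. Consequently, for all $\lambda,\mu,\gamma,\pi\in\mathtt{Spec}^\circ$, the map $\mathbf{oct}:(k,k')\mapsto(h,h')$ that it induces is a piecewise-linear bijection from $\mathcal S$ to $\mathcal T$, and it preserves volume, that is, $(n-1)^2$-dimensional Lebesgue measure in the coordinates $\tilde k(v)$ on $\mathcal S$ and $\tilde h(v)$ on $\mathcal T$, where $v$ runs over $\{1,\dots,n-1\}^2$. -/

import Mathlib

namespace HiveOct

/-! ### Hives -/

/-- The triangle `T = {(i, j) : 0 ≤ i ≤ j ≤ n}` in `ℤ²`. -/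
def Tri (n : ℕ) : Set (ℤ × ℤ) := {p | 0 ≤ p.1 ∧ p.1 ≤ p.2 ∧ p.2 ≤ (n : ℤ)}

/-- The square `{0, …, n}²`. -/
def Square (n : ℕ) : Set (ℤ × ℤ) :=
  {p | 0 ≤ p.1 ∧ p.1 ≤ (n : ℤ) ∧ 0 ≤ p.2 ∧ p.2 ≤ (n : ℤ)}

/-- The interior vertices `{1, …, n - 1}²` of the square. -/
noncomputable def Interior (n : ℕ) : Finset (ℤ × ℤ) := Finset.Ioo (0 : ℤ) n ×ˢ Finset.Ioo (0 : ℤ) n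

/-- `ABCD` is a rhombus (with long diagonal `AC` and short diagonal `BD`). -/
def IsRhombus (A B C D : ℤ × ℤ) : Prop :=
  ∃ i j : ℤ,
    (A = (i, j) ∧ B = (i + 1, j) ∧ C = (i + 2, j + 1) ∧ D = (i + 1, j + 1)) ∨
    (A = (i, j) ∧ B = (i + 1, j + 1) ∧ C = (i + 1, j + 2) ∧ D = (i, j + 1)) ∨
    (A = (i, j) ∧ B = (i, j - 1) ∧ C = (i + 1, j - 1) ∧ D = (i + 1, j))

/-- A hive is a rhombus-concave function on the triangle. -/
def IsHive (n : ℕ) (h : Tri n → ℝ) : Prop :=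
  ∀ A B C D : Tri n, IsRhombus A B C D → h A + h C ≤ h B + h D

/-- The partial sum `x₁ + ⋯ + xᵢ` (the entries of `x` are indexed from `0` here). -/
def psum {n : ℕ} (x : Fin n → ℝ) (i : ℤ) : ℝ :=
  ∑ m : Fin n, if ((m : ℕ) : ℤ) < i then x m else 0

/-- The set `HIVE_{lam ⊞ mu → nu}` of hives with boundary condition `lam ⊞ mu → nu`. -/
def HIVE {n : ℕ} (lam mu nu : Fin n → ℝ) : Set (Tri n → ℝ) :=
  {h | IsHive n h ∧
    ∀ p : Tri n,
      (p.1.1 = 0 → h p = psum lam p.1.2) ∧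
      (p.1.2 = n → h p = ∑ m, lam m + psum mu p.1.1) ∧
      (p.1.1 = p.1.2 → h p = psum nu p.1.1)}

/-- `⋃_σ HIVE_{σ ⊞ mu → pi} × HIVE_{gam ⊞ lam → σ}`, over non-increasing tuples `σ`. -/
def SourcePairs {n : ℕ} (lam mu gam pi : Fin n → ℝ) : Set ((Tri n → ℝ) × (Tri n → ℝ)) :=
  ⋃ σ ∈ {σ : Fin n → ℝ | Antitone σ}, HIVE σ mu pi ×ˢ HIVE gam lam σ

/-- `⋃_ν HIVE_{lam ⊞ mu → ν} × HIVE_{gam ⊞ ν → pi}`, over non-increasing tuples `ν`. -/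
def TargetPairs {n : ℕ} (lam mu gam pi : Fin n → ℝ) : Set ((Tri n → ℝ) × (Tri n → ℝ)) :=
  ⋃ ν ∈ {ν : Fin n → ℝ | Antitone ν}, HIVE lam mu ν ×ˢ HIVE gam ν pi

/-! ### Pairs of hives as functions on the square

Functions on the square are functions on `ℤ × ℤ` of which only the values on `Square n`
matter. -/

open Classical in
/-- Extension by zero of a function on the triangle. -/
noncomputable def triExt {n : ℕ} (h : Tri n → ℝ) (p : ℤ × ℤ) : ℝ :=
  if hp : p ∈ Tri n then h ⟨p, hp⟩ else 0

/-- The function `k̃` on the square that encodes a pair `(k, k')`: it is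
`k (i + j - n, j) - ∑ gam` on the triangle `i + j ≥ n`, and `k' (j, n - i) - ∑ gam` on the
triangle `i + j ≤ n`. -/
noncomputable def kTilde {n : ℕ} (gam : Fin n → ℝ) (x : (Tri n → ℝ) × (Tri n → ℝ))
    (p : ℤ × ℤ) : ℝ :=
  if (n : ℤ) ≤ p.1 + p.2 then triExt x.1 (p.1 + p.2 - n, p.2) - ∑ m, gam m
  else triExt x.2 (p.2, n - p.1) - ∑ m, gam m

/-- The function `h̃` on the square that encodes a pair `(h, h')`: it is `h (i, j)` on the
triangle `i ≤ j`, and `h' (j, n - i + j) - ∑ gam` on the triangle `j ≤ i`. -/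
noncomputable def hTilde {n : ℕ} (gam : Fin n → ℝ) (x : (Tri n → ℝ) × (Tri n → ℝ))
    (p : ℤ × ℤ) : ℝ :=
  if p.1 ≤ p.2 then triExt x.1 p
  else triExt x.2 (p.2, n - p.1 + p.2) - ∑ m, gam m

/-! ### The octahedron recurrence on the tetrahedron -/

/-- The octahedron recurrence, as a relation between the functions `κ` (playing the role of
`k̃`) and `η` (playing the role of `h̃`) on the square: there is a function `o` on
`{[x, y, z, w] : x, y, z, w ≥ 0, x + y + z + w = n}` that obeys the tropical octahedron rule
on every octahedron, restricts to `κ` on the two faces `z = 0` and `w = 0`, and restricts to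
`η` on the two faces `x = 0` and `y = 0`. (Values of `o` elsewhere do not matter.) -/
def OctRecurrence (n : ℕ) (κ η : ℤ × ℤ → ℝ) : Prop :=
  ∃ o : ℤ → ℤ → ℤ → ℤ → ℝ,
    (∀ x y z w : ℤ, 0 ≤ x → 0 ≤ y → 0 ≤ z → 0 ≤ w → x + y + z + w + 2 = n →
      o x y (z + 1) (w + 1) =
        max (o (x + 1) y (z + 1) w + o x (y + 1) z (w + 1))
          (o (x + 1) y z (w + 1) + o x (y + 1) (z + 1) w) - o (x + 1) (y + 1) z w) ∧
    (∀ i j : ℤ, i ≤ n → j ≤ n → n ≤ i + j → o (n - j) (n - i) 0 (i + j - n) = κ (i, j)) ∧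
    (∀ i j : ℤ, 0 ≤ i → 0 ≤ j → i + j ≤ n → o i j (n - i - j) 0 = κ (i, j)) ∧
    (∀ i j : ℤ, 0 ≤ i → i ≤ j → j ≤ n → o 0 (j - i) (n - j) i = η (i, j)) ∧
    (∀ i j : ℤ, 0 ≤ j → j ≤ i → i ≤ n → o (i - j) 0 (n - i) j = η (i, j))

/-! ### Lozenge tilings -/

/-- Lozenges of the three types, and upward and downward border triangles. -/
inductive Tile : Type
  | lozI (i j : ℤ)
  | lozII (i j : ℤ)
  | lozIII (i j : ℤ)
  | borderUp (i : ℤ)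
  | borderDown (i : ℤ)

/-- The vertices of a tile. -/
def Tile.verts (n : ℕ) : Tile → Finset (ℤ × ℤ)
  | .lozI i j => {(i, j), (i + 1, j - 1), (i + 2, j - 1), (i + 1, j)}
  | .lozII i j => {(i, j), (i, j + 1), (i - 1, j + 2), (i - 1, j + 1)}
  | .lozIII i j => {(i, j), (i + 1, j), (i + 1, j + 1), (i, j + 1)}
  | .borderUp i => {(i, n - i), (i + 1, n - i), (i + 1, n - i - 1)}
  | .borderDown i => {(i, n - i), (i, n - i - 1), (i + 1, n - i - 1)}

/-- The tile lies in the square `{0, …, n}²`, and does not cross its antidiagonal: it lies in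
`U = {i, j ≤ n ≤ i + j}` or in `U' = {i, j ≥ 0, i + j ≤ n}`. -/
def Tile.Valid (n : ℕ) (t : Tile) : Prop :=
  (∀ p ∈ t.verts n, p.1 ≤ n ∧ p.2 ≤ n ∧ n ≤ p.1 + p.2) ∨
    (∀ p ∈ t.verts n, 0 ≤ p.1 ∧ 0 ≤ p.2 ∧ p.1 + p.2 ≤ n)

/-- The weight of a tile: `(κ A + κ C - κ B - κ D) / 3` for a lozenge `ABCD`, and
`(κ B - κ A) / 3` for a border triangle `ABC`. -/
noncomputable def Tile.weight (n : ℕ) (κ : ℤ × ℤ → ℝ) : Tile → ℝ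
  | .lozI i j => (κ (i, j) + κ (i + 2, j - 1) - κ (i + 1, j - 1) - κ (i + 1, j)) / 3
  | .lozII i j => (κ (i, j) + κ (i - 1, j + 2) - κ (i, j + 1) - κ (i - 1, j + 1)) / 3
  | .lozIII i j => (κ (i, j) + κ (i + 1, j + 1) - κ (i + 1, j) - κ (i, j + 1)) / 3
  | .borderUp i => (κ (i + 1, n - i) - κ (i, n - i)) / 3
  | .borderDown i => (κ (i, n - i - 1) - κ (i, n - i)) / 3

/-- The six corners of a hexagon `ABCDEF`. -/
structure Hexagon where
  A : ℤ × ℤ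
  B : ℤ × ℤ
  C : ℤ × ℤ
  D : ℤ × ℤ
  E : ℤ × ℤ
  F : ℤ × ℤ

/-- The excavation hexagon centred at `v`. -/
def excavationHexagon (n : ℕ) (v : ℤ × ℤ) : Hexagon :=
  let i := v.1
  let j := v.2
  if i ≤ j then
    ⟨(0, n), (0, j), (i, j - i), (n + i - j, j - i), (n + i - j, j), (i, n)⟩
  else
    ⟨(i - j, n + j - i), (i - j, j), (i, 0), (n, 0), (n, j), (i, n + j - i)⟩

/-- The lattice points of the solid hexagon. Its sides `AB`, `DE` are parallel to `(0, 1)`, the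
sides `CD`, `FA` to `(1, 0)`, and the sides `BC`, `EF` to `(1, -1)`. -/
def Hexagon.points (H : Hexagon) : Set (ℤ × ℤ) :=
  {p | H.A.1 ≤ p.1 ∧ p.1 ≤ H.D.1 ∧ H.D.2 ≤ p.2 ∧ p.2 ≤ H.A.2 ∧
    H.B.1 + H.B.2 ≤ p.1 + p.2 ∧ p.1 + p.2 ≤ H.E.1 + H.E.2}

/-- The weight of the hexagon. -/
noncomputable def Hexagon.weight (H : Hexagon) (κ : ℤ × ℤ → ℝ) : ℝ :=
  (κ H.B + κ H.C - κ H.D + κ H.E + κ H.F) / 3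

/-- The unit triangles of the triangular lattice with edge directions `(1, 0)`, `(0, 1)`,
`(1, -1)`, given by their vertices; each lozenge consists of two of them. -/
def IsUnitTriangle (s : Finset (ℤ × ℤ)) : Prop :=
  ∃ i j : ℤ, s = {(i, j), (i + 1, j), (i + 1, j - 1)} ∨ s = {(i, j), (i, j - 1), (i + 1, j - 1)}

/-- `Ξ` is a tiling of the excavation hexagon at `v` by lozenges and border triangles: the tiles
lie in the hexagon, each unit triangle of the hexagon lies in exactly one tile, and each border
edge of the hexagon belongs to exactly one border triangle of the tiling. -/
def IsTiling (n : ℕ) (v : ℤ × ℤ) (Ξ : Finset Tile) : Prop :=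
  (∀ t ∈ Ξ, t.Valid n ∧ ∀ p ∈ t.verts n, p ∈ (excavationHexagon n v).points) ∧
  (∀ s : Finset (ℤ × ℤ), IsUnitTriangle s → (∀ p ∈ s, p ∈ (excavationHexagon n v).points) →
    ∃! t : Tile, t ∈ Ξ ∧ s ⊆ t.verts n) ∧
  (∀ i : ℤ, (i, n - i) ∈ (excavationHexagon n v).points →
    (i + 1, n - i - 1) ∈ (excavationHexagon n v).points →
    (Tile.borderUp i ∈ Ξ ∧ Tile.borderDown i ∉ Ξ) ∨
      (Tile.borderDown i ∈ Ξ ∧ Tile.borderUp i ∉ Ξ))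

/-- The weight `w_Ξ` of a tiling of the excavation hexagon at `v`. -/
noncomputable def tilingWeight (n : ℕ) (κ : ℤ × ℤ → ℝ) (v : ℤ × ℤ) (Ξ : Finset Tile) : ℝ :=
  ∑ t ∈ Ξ, t.weight n κ + (excavationHexagon n v).weight κ

/-- The weights of all the tilings of the excavation hexagon at `v`. -/
def tilingWeights (n : ℕ) (κ : ℤ × ℤ → ℝ) (v : ℤ × ℤ) : Set ℝ :=
  {w | ∃ Ξ : Finset Tile, IsTiling n v Ξ ∧ w = tilingWeight n κ v Ξ}

/-- The lozenge-tiling construction of `h̃` from `k̃ = κ`: the largest weight of a tiling at an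
interior vertex of the square, and `κ` itself at a boundary vertex. -/
noncomputable def lozengeMax (n : ℕ) (κ : ℤ × ℤ → ℝ) (v : ℤ × ℤ) : ℝ :=
  if v ∈ Interior n then sSup (tilingWeights n κ v) else κ v

/-- The map `oct` on pairs of functions on the triangle: `(k, k')` is encoded as `k̃`, the
lozenge-tiling construction gives `h̃`, which is decoded as `(h, h')` by `h (i, j) = h̃ (i, j)`
and `h' (a, b) = h̃ (n + a - b, a) + ∑ gam`. -/
noncomputable def oct {n : ℕ} (gam : Fin n → ℝ) (x : (Tri n → ℝ) × (Tri n → ℝ)) :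
    (Tri n → ℝ) × (Tri n → ℝ) :=
  (fun p => lozengeMax n (kTilde gam x) p.1,
   fun p => lozengeMax n (kTilde gam x) (n + p.1.1 - p.1.2, p.1.1) + ∑ m, gam m)

/-! ### Piecewise linearity and volume -/

/-- A closed convex polyhedron: a finite intersection of closed half-spaces. -/
def IsPolyhedron {V : Type*} [AddCommGroup V] [Module ℝ V] (P : Set V) : Prop :=
  ∃ (m : ℕ) (ℓ : Fin m → V →ₗ[ℝ] ℝ) (c : Fin m → ℝ), P = {x | ∀ r, ℓ r x ≤ c r}

/-- `f` is piecewise linear on `S`: finitely many closed polyhedra cover `S`, and on the part of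
`S` in each of them `f` is given by an affine-linear map. -/
def IsPiecewiseLinearOn {V W : Type*} [AddCommGroup V] [Module ℝ V] [AddCommGroup W] [Module ℝ W]
    (f : V → W) (S : Set V) : Prop :=
  ∃ (m : ℕ) (P : Fin m → Set V) (g : Fin m → V →ᵃ[ℝ] W),
    (∀ r, IsPolyhedron (P r)) ∧ S ⊆ ⋃ r, P r ∧ ∀ r, ∀ x ∈ S ∩ P r, f x = g r x

/-- The `(n - 1)²` coordinates of a pair `(k, k')` with given outer boundary values: the values
of `k̃` at the interior vertices of the square. -/
noncomputable def kCoord {n : ℕ} (gam : Fin n → ℝ) (x : (Tri n → ℝ) × (Tri n → ℝ)) :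
    Interior n → ℝ := fun v => kTilde gam x v

/-- The `(n - 1)²` coordinates of a pair `(h, h')` with given outer boundary values: the values
of `h̃` at the interior vertices of the square. -/
noncomputable def hCoord {n : ℕ} (gam : Fin n → ℝ) (x : (Tri n → ℝ) × (Tri n → ℝ)) :
    Interior n → ℝ := fun v => hTilde gam x v

end HiveOct

/-! The tiling formula is proved by pushing a tiled surface through the tetrahedron. Fix a vertex
with value `o X Y Z W` on a final face. The points below it form rows `ρ a c` parallel to the
border, of `a + c` edges each, and the excavation hexagon is the staircase of rows from `(0, W)` to
`(Z, W)` to `(Z, 0)`. A tiling is encoded by how many edges of each row its tiles cross up to each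
position. The condition that every unit triangle is covered once says that the counts of consecutive
rows interlace, provided that crossed edges are counted below the border and uncrossed ones above
it. The weight splits over unit triangles, hence over strips between consecutive rows.

Replacing a corner `(a, c+1), (a+1, c+1), (a+1, c)` of the staircase by `(a, c+1), (a, c), (a+1, c)`
changes one row. By `exchange_identity` the weight changes by a sum of terms, one for each
octahedron between the rows. With the two outer rows fixed, each octahedron leaves at most one
binary choice, on one side of the exchange only; its best value is the maximum in the octahedron
rule. Hence `exists_upper` and `exists_lower` exchange corners without loss of weight. After all
exchanges the staircase is `(0, W)` to `(0, 0)` to `(Z, 0)`, where the counts are forced and the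
weight is `ρ 0 0 0 = o X Y Z W`. One direction bounds every tiling (`RowCounts.weight_le`), the
other builds an optimal one (`exists_rowCounts`).

The recurrence itself is run as a time evolution of functions on the square (`octState`), which
gives existence and uniqueness of `o`. Exchanging the pairs `x, y` and `z, w` preserves the
octahedron rule and reverses time; on the square this is a reflection, so the evolution is
invertible. Rhombus concavity passes from the initial faces to the final ones by induction
(`IsOctahedral.triConcave`), and back by the same symmetry. Since pairs of hives are exactly the
functions on the square with prescribed boundary that are concave on both triangles
(`mem_sourcePairs_iff`, `mem_targetPairs_iff`), the bijection follows.

Piecewise linearity holds because each value is a maximum of finitely many linear functions. Volume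
is preserved because a time step replaces each active value `c` by `F - c`, where `F` depends only
on inactive values. -/

namespace HiveOct

open Finset

/-! ### Interlacing rows and the weights of strips of unit triangles -/

/-- The weight of the unit triangles between a row of points with values `p 0, …, p N` and a row of
points with values `q 0, …, q (N + 1)`, where `α` and `μ` count the edges of the two rows that are
crossed by a tile. Each triangle contributes a third of the sum of its values minus half of the
values at the ends of its crossed edge. -/
noncomputable def stripWeight (N : ℕ) (p : ℕ → ℝ) (α : ℕ → ℤ) (q : ℕ → ℝ) (μ : ℕ → ℤ) : ℝ :=
  ∑ k ∈ range (N + 1), ((p k + q k + q (k + 1)) / 3 -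
    (((μ (k + 1) : ℝ) - μ k) * (q k + q (k + 1)) + ((μ k : ℝ) - α k) * (p k + q k) +
      (1 - (μ (k + 1) : ℝ) + α k) * (p k + q (k + 1))) / 2) +
  ∑ k ∈ range N, ((p k + p (k + 1) + q (k + 1)) / 3 -
    (((α (k + 1) : ℝ) - α k) * (p k + p (k + 1)) +
      (1 - (μ (k + 1) : ℝ) + α k) * (p k + q (k + 1)) +
      ((μ (k + 1) : ℝ) - α (k + 1)) * (p (k + 1) + q (k + 1))) / 2)

/-- Counting the edges that are not counted by `α`. -/
def compl (α : ℕ → ℤ) (k : ℕ) : ℤ := k - α k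

lemma compl_compl (α : ℕ → ℤ) : compl (compl α) = α := by
  funext k; simp [compl]

/-- The weight of a strip in which the rows get longer. -/
noncomputable def growWeight (N : ℕ) (p : ℕ → ℝ) (α : ℕ → ℤ) (q : ℕ → ℝ) (μ : ℕ → ℤ) : ℝ :=
  stripWeight N p α q μ + (q 0 + q (N + 1) - p 0 - p N) / 6

/-- The weight of a strip in which the rows get shorter. -/
noncomputable def shrinkWeight (N : ℕ) (q : ℕ → ℝ) (μ : ℕ → ℤ) (r : ℕ → ℝ) (β : ℕ → ℤ) : ℝ :=
  stripWeight N r (compl β) q (compl μ) + (r 0 + r N - q 0 - q (N + 1)) / 3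

/-- The counting functions `α`, of a row of `N` edges, and `μ`, of the next row of `N + 1` edges,
interlace. -/
structure Interlace (N : ℕ) (α μ : ℕ → ℤ) : Prop where
  zero : μ 0 = α 0
  last : μ (N + 1) = α N + 1
  mono : ∀ k < N, α k ≤ α (k + 1)
  le : ∀ k ≤ N, α k ≤ μ k
  mono' : ∀ k ≤ N, μ k ≤ μ (k + 1)
  le_add_one : ∀ k ≤ N, μ (k + 1) ≤ α k + 1

/-- The local contribution of the `k`-th octahedron to the effect of an exchange of strips. -/
noncomputable def octTerm (p q r s : ℕ → ℝ) (α β μ ν : ℕ → ℤ) (k : ℕ) : ℝ :=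
  ((μ (k + 1) : ℝ) + ν k) * ((p k - r k) - (p (k + 1) - r (k + 1))) +
    ((α (k + 1) : ℝ) - α k) * (q (k + 1) + s k - p k - p (k + 1)) -
    ((β (k + 1) : ℝ) - β k) * (q (k + 1) + s k - r k - r (k + 1)) -
    ((α k : ℝ) + β k) * (p k - r k) + ((α (k + 1) : ℝ) + β (k + 1)) * (p (k + 1) - r (k + 1))

/-- Both sides are polynomial in arbitrary counts and values, and lengthening the rows by one edge
adds the term of one octahedron and moves the right end. No interlacing is needed, so induction on
the length reduces everything to `ring`. -/
lemma exchange_identity (m : ℕ) (p q r s : ℕ → ℝ) (α β μ ν : ℕ → ℤ) :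
    growWeight (m + 1) p α q μ + shrinkWeight (m + 1) q μ r β -
      (shrinkWeight m p α s ν + growWeight m s ν r β) =
    ∑ k ∈ range (m + 1), octTerm p q r s α β μ ν k +
      ((α 0 : ℝ) * (q 0 / 2 - r 0 + s 0 / 2) + β 0 * (p 0 - q 0 / 2 - s 0 / 2) -
        ((μ 0 : ℝ) + ν 0) * (p 0 - r 0) / 2) +
      ((α (m + 1) : ℝ) * (r (m + 1) - q (m + 2) / 2 - s m / 2) +
        β (m + 1) * (q (m + 2) / 2 + s m / 2 - p (m + 1)) +
        ((μ (m + 2) : ℝ) + ν m) * (p (m + 1) - r (m + 1)) / 2 +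
        (p (m + 1) - q (m + 2) + r (m + 1) - s m) / 2) := by
  induction m with
  | zero =>
    simp only [growWeight, shrinkWeight, stripWeight, sum_range_succ, sum_range_zero, octTerm,
      compl]
    push_cast
    ring
  | succ m ih =>
    simp only [growWeight, shrinkWeight, stripWeight, octTerm, compl] at ih ⊢
    simp only [sum_range_succ _ (m + 2)]
    simp only [sum_range_succ _ (m + 1)] at ih ⊢
    simp only [sum_range_succ _ m] at ih ⊢
    push_cast at ih ⊢
    linear_combination ih

/-- The end terms cancel once the counts agree at the left end and have the right totals. The
multiples 1/6 and 1/3 in `growWeight` and `shrinkWeight` make this happen. -/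
lemma exchange_identity_of_interlace {m : ℕ} {p q r s : ℕ → ℝ} {α β μ ν : ℕ → ℤ}
    (h0 : α 0 = μ 0 ∧ β 0 = μ 0 ∧ ν 0 = μ 0)
    (h1 : β (m + 1) = α (m + 1) + 1 ∧ μ (m + 2) = α (m + 1) + 1 ∧ ν m = α (m + 1)) :
    growWeight (m + 1) p α q μ + shrinkWeight (m + 1) q μ r β -
      (shrinkWeight m p α s ν + growWeight m s ν r β) =
    ∑ k ∈ range (m + 1), octTerm p q r s α β μ ν k := by
  rw [exchange_identity, h0.1, h0.2.1, h0.2.2, h1.1, h1.2.1, h1.2.2]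
  push_cast
  ring

/-- The counting functions of two rows that bound an exchange of strips. -/
structure Adjacent (m : ℕ) (α β : ℕ → ℤ) : Prop where
  zero : β 0 = α 0
  last : β (m + 1) = α (m + 1) + 1
  mono_left : ∀ k ≤ m, α k ≤ α (k + 1) ∧ α (k + 1) ≤ α k + 1
  mono_right : ∀ k ≤ m, β k ≤ β (k + 1) ∧ β (k + 1) ≤ β k + 1
  le : ∀ k ≤ m + 1, α k ≤ β k ∧ β k ≤ α k + 1

/-- Both rows interlace with the same longer row `μ`, which pins their counts to within one of each
other. `Adjacent.of_upper` does the same with a common shorter row. -/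
lemma Adjacent.of_lower {m : ℕ} {α β μ : ℕ → ℤ} (h : Interlace (m + 1) α μ)
    (h' : Interlace (m + 1) (compl β) (compl μ)) : Adjacent m α β := by
  have e0 := h.zero
  have e1 := h.last
  have e0' := h'.zero
  have e1' := h'.last
  simp only [compl] at e0' e1'
  refine ⟨by push_cast at *; omega, by push_cast at *; omega, fun k hk => ?_, fun k hk => ?_,
    fun k hk => ?_⟩
  · have a1 := h.mono k (by omega)
    have a2 := h.le (k + 1) (by omega)
    have a3 := h.le_add_one k (by omega)
    omega
  · have a1 := h'.mono k (by omega)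
    have a2 := h'.le (k + 1) (by omega)
    have a3 := h'.le_add_one k (by omega)
    simp only [compl] at a1 a2 a3
    push_cast at *
    omega
  · have a1 := h.le k (by omega)
    have a3 := h.le_add_one k (by omega)
    have a2 := h'.le k (by omega)
    have a4 := h'.le_add_one k (by omega)
    simp only [compl] at a2 a4
    push_cast at *
    omega

lemma Adjacent.of_upper {m : ℕ} {α β ν : ℕ → ℤ} (h : Interlace m (compl ν) (compl α))
    (h' : Interlace m ν β) : Adjacent m α β := by
  have e0 := h.zero
  have e1 := h.last
  have e0' := h'.zero
  have e1' := h'.last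
  simp only [compl] at e0 e1
  refine ⟨by push_cast at *; omega, by push_cast at *; omega, fun k hk => ?_, fun k hk => ?_,
    fun k hk => ?_⟩
  · have a1 := h.mono' k (by omega)
    have a2 := h.le k (by omega)
    have a3 := h.le_add_one k (by omega)
    simp only [compl] at a1 a2 a3
    push_cast at *
    omega
  · have a1 := h'.mono' k (by omega)
    have a2 := h'.le k (by omega)
    have a3 := h'.le_add_one k (by omega)
    omega
  · rcases k with _ | k
    · push_cast at *
      omega
    · have a1 := h'.le_add_one k (by omega)
      have a2 := h.le_add_one k (by omega)
      have a3 := h'.mono' k (by omega)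
      have a4 := h'.le k (by omega)
      simp only [compl] at a2
      rcases Nat.lt_or_ge m (k + 1) with hk' | hk'
      · obtain rfl : k = m := by omega
        push_cast at *
        omega
      · have a5 := h.le (k + 1) (by omega)
        have a6 := h'.le (k + 1) (by omega)
        simp only [compl] at a5
        push_cast at *
        omega

/-- These are the local pictures at one octahedron. In the first two, `μ (k + 1)` and `ν k` are both
forced by interlacing; in the third only `ν k` is free, in the fourth only `μ (k + 1)`, each with
two possible values. -/
lemma Adjacent.cases {m : ℕ} {α β : ℕ → ℤ} (h : Adjacent m α β) {k : ℕ} (hk : k ≤ m) :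
    (α (k + 1) = α k ∧ β (k + 1) = β k) ∨ (α (k + 1) = α k + 1 ∧ β (k + 1) = β k + 1) ∨
      (α (k + 1) = α k + 1 ∧ β k = α k + 1 ∧ β (k + 1) = α k + 1) ∨
      (α (k + 1) = α k ∧ β k = α k ∧ β (k + 1) = α k + 1) := by
  have a1 := h.mono_left k hk
  have a2 := h.mono_right k hk
  have a3 := h.le k (by omega)
  have a4 := h.le (k + 1) (by omega)
  omega

/-- Two strips, of which the first one grows, may be exchanged for two strips, of which the first
one shrinks, without a loss of weight. -/
lemma exists_upper {m : ℕ} {p q r s : ℕ → ℝ} {α β μ : ℕ → ℤ}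
    (hrule : ∀ k ≤ m, s k + q (k + 1) = max (p (k + 1) + r k) (p k + r (k + 1)))
    (h : Interlace (m + 1) α μ) (h' : Interlace (m + 1) (compl β) (compl μ)) :
    ∃ ν : ℕ → ℤ, Interlace m (compl ν) (compl α) ∧ Interlace m ν β ∧
      growWeight (m + 1) p α q μ + shrinkWeight (m + 1) q μ r β ≤
        shrinkWeight m p α s ν + growWeight m s ν r β := by
  have adj := Adjacent.of_lower h h'
  -- Interlacing confines `ν k` to the interval from `max (α k) (β (k + 1) - 1)` to `min (α (k + 1))
  -- (β k)`. The end to take is decided by which branch attains the maximum in the octahedron rule.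
  set ν : ℕ → ℤ := fun k => if p k + r (k + 1) ≤ p (k + 1) + r k then min (α (k + 1)) (β k)
    else max (α k) (β (k + 1) - 1) with hν
  have hcond : ∀ k ≤ m, α k ≤ ν k ∧ ν k ≤ α (k + 1) ∧ ν k ≤ β k ∧ β (k + 1) ≤ ν k + 1 := by
    intro k hk
    have := adj.cases hk
    have a3 := adj.le k (by omega)
    simp only [hν]
    split_ifs <;> omega
  have hν0 : ν 0 = α 0 := by
    have := hcond 0 (by omega)
    have := adj.zero
    omega
  have hνm : ν m = α (m + 1) := by
    have := hcond m le_rfl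
    have := adj.last
    omega
  refine ⟨ν, ⟨?_, ?_, ?_, ?_, ?_, ?_⟩, ⟨?_, ?_, ?_, ?_, ?_, ?_⟩, ?_⟩
  · simp [compl, hν0]
  · simp only [compl, hνm]; push_cast; ring
  · intro k hk
    have := hcond k (by omega)
    have := hcond (k + 1) (by omega)
    simp only [compl]; push_cast; omega
  · intro k hk
    have := hcond k (by omega)
    simp only [compl]; omega
  · intro k hk
    have := adj.mono_left k (by omega)
    simp only [compl]; push_cast; omega
  · intro k hk
    have := hcond k (by omega)
    simp only [compl]; push_cast; omega
  · rw [adj.zero, hν0]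
  · rw [adj.last, hνm]
  · intro k hk
    have := hcond k (by omega)
    have := hcond (k + 1) (by omega)
    omega
  · exact fun k hk => (hcond k hk).2.2.1
  · exact fun k hk => (adj.mono_right k hk).1
  · exact fun k hk => (hcond k hk).2.2.2
  · rw [← sub_nonpos, exchange_identity_of_interlace ⟨h.zero.symm, by rw [h.zero, adj.zero],
      by rw [h.zero, hν0]⟩ ⟨adj.last, h.last, hνm⟩]
    refine Finset.sum_nonpos fun k hk => ?_
    have hk : k ≤ m := by simpa [Nat.lt_succ_iff] using hk
    have hX := hrule k hk
    have b1 := h.le k (by omega)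
    have b2 := h.le (k + 1) (by omega)
    have b3 := h.le_add_one k (by omega)
    have b4 := h'.le (k + 1) (by omega)
    have b5 := h'.le_add_one k (by omega)
    have b6 := adj.le k (by omega)
    simp only [compl] at b4 b5
    push_cast at b5
    have hνk : ν k = if p k + r (k + 1) ≤ p (k + 1) + r k then min (α (k + 1)) (β k)
      else max (α k) (β (k + 1) - 1) := rfl
    unfold octTerm
    -- The term vanishes in the two forced cases, and in the third by the choice of `ν k`. In the
    -- fourth, where `μ (k + 1)` is arbitrary, it is a branch of the maximum minus the maximum.
    rcases adj.cases hk with ⟨h1, h2⟩ | ⟨h1, h2⟩ | ⟨h1, h2, h3⟩ | ⟨h1, h2, h3⟩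
    · have e1 : μ (k + 1) = β k := by omega
      have e2 : ν k = α k := by have := hcond k hk; omega
      rw [e1, e2, h1, h2]
      linarith
    · have e1 : μ (k + 1) = α k + 1 := by omega
      have e2 : ν k = β k := by have := hcond k hk; omega
      rw [e1, e2, h1, h2]
      push_cast
      linarith
    · have e1 : μ (k + 1) = α k + 1 := by omega
      split_ifs at hνk with hc
      · have e2 : ν k = α k + 1 := by omega
        rw [max_eq_left hc] at hX
        rw [e1, e2, h1, h2, h3]
        push_cast
        linarith
      · have e2 : ν k = α k := by omega
        rw [max_eq_right (not_le.1 hc).le] at hX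
        rw [e1, e2, h1, h2, h3]
        push_cast
        linarith
    · have e2 : ν k = α k := by have := hcond k hk; omega
      have l1 := le_max_left (p (k + 1) + r k) (p k + r (k + 1))
      have l2 := le_max_right (p (k + 1) + r k) (p k + r (k + 1))
      rw [← hX] at l1 l2
      obtain e1 | e1 : μ (k + 1) = α k ∨ μ (k + 1) = α k + 1 := by omega
      all_goals
        rw [e1, e2, h1, h2, h3]
        push_cast
        linarith

/-- Two strips, of which the first one shrinks, may be exchanged for two strips, of which the first
one grows, without a loss of weight. -/
lemma exists_lower {m : ℕ} {p q r s : ℕ → ℝ} {α β ν : ℕ → ℤ}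
    (hrule : ∀ k ≤ m, s k + q (k + 1) = max (p (k + 1) + r k) (p k + r (k + 1)))
    (h : Interlace m (compl ν) (compl α)) (h' : Interlace m ν β) :
    ∃ μ : ℕ → ℤ, Interlace (m + 1) α μ ∧ Interlace (m + 1) (compl β) (compl μ) ∧
      shrinkWeight m p α s ν + growWeight m s ν r β ≤
        growWeight (m + 1) p α q μ + shrinkWeight (m + 1) q μ r β := by
  have adj := Adjacent.of_upper h h'
  have hν0 : ν 0 = α 0 := by
    have := h.zero
    simp only [compl] at this
    omega
  have hνm : ν m = α (m + 1) := by
    have := h.last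
    simp only [compl] at this
    push_cast at this
    omega
  -- The inner values mirror the choice of `ν` in `exists_upper`; the two end values are forced by
  -- interlacing.
  set μ : ℕ → ℤ := fun k => Nat.casesOn k (α 0) fun k => if k ≤ m then
    (if p k + r (k + 1) ≤ p (k + 1) + r k then max (α (k + 1)) (β k)
      else min (α k + 1) (β (k + 1))) else α (m + 1) + 1 with hμ
  have hμ0 : μ 0 = α 0 := rfl
  have hμm : μ (m + 2) = α (m + 1) + 1 := by simp [hμ]
  have hμk : ∀ k ≤ m, μ (k + 1) = if p k + r (k + 1) ≤ p (k + 1) + r k then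
      max (α (k + 1)) (β k) else min (α k + 1) (β (k + 1)) := fun k hk => by simp [hμ, hk]
  have hcond : ∀ k ≤ m, α (k + 1) ≤ μ (k + 1) ∧ μ (k + 1) ≤ α k + 1 ∧ β k ≤ μ (k + 1) ∧
      μ (k + 1) ≤ β (k + 1) := by
    intro k hk
    have := adj.cases hk
    have a3 := adj.le k (by omega)
    rw [hμk k hk]
    split_ifs <;> omega
  have hle : ∀ k ≤ m + 1, α k ≤ μ k ∧ μ k ≤ β k := by
    rintro (_ | k) hk
    · have := adj.zero
      omega
    · have := hcond k (by omega)
      omega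
  have hge : ∀ k ≤ m + 1, μ (k + 1) ≤ α k + 1 ∧ β k ≤ μ (k + 1) := by
    intro k hk
    rcases Nat.lt_or_ge m k with hk' | hk'
    · obtain rfl : k = m + 1 := by omega
      have := adj.last
      have : μ (m + 1 + 1) = α (m + 1) + 1 := hμm
      omega
    · have := hcond k hk'
      omega
  refine ⟨μ, ⟨hμ0, hμm, ?_, ?_, ?_, ?_⟩, ⟨?_, ?_, ?_, ?_, ?_, ?_⟩, ?_⟩
  · exact fun k hk => (adj.mono_left k (by omega)).1
  · exact fun k hk => (hle k hk).1
  · intro k hk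
    have := hle k hk
    have := hge k hk
    omega
  · exact fun k hk => (hge k hk).1
  · simp [compl, hμ0, adj.zero]
  · have := adj.last
    have : μ (m + 1 + 1) = α (m + 1) + 1 := hμm
    simp only [compl]; push_cast; omega
  · intro k hk
    have := adj.mono_right k (by omega)
    simp only [compl]; push_cast; omega
  · intro k hk
    have := hle k hk
    simp only [compl]; omega
  · intro k hk
    have := hle k hk
    have := hge k hk
    have := adj.le k hk
    simp only [compl]; push_cast; omega
  · intro k hk
    have := hge k hk
    simp only [compl]; push_cast; omega
  · rw [← sub_nonneg, exchange_identity_of_interlace ⟨hμ0.symm, adj.zero, hν0⟩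
      ⟨adj.last, hμm, hνm⟩]
    refine Finset.sum_nonneg fun k hk => ?_
    have hk : k ≤ m := by simpa [Nat.lt_succ_iff] using hk
    have hX := hrule k hk
    have b1 := h'.le k (by omega)
    have b2 := h'.le_add_one k (by omega)
    have b3 := h.le k (by omega)
    have b4 := h.le_add_one k (by omega)
    have b6 := adj.le k (by omega)
    simp only [compl] at b3 b4
    push_cast at b4
    have hμk := hμk k hk
    unfold octTerm
    -- Now the third case is the inequality, with `ν k` given and arbitrary, and the fourth is an
    -- equality by the choice of `μ (k + 1)`.
    rcases adj.cases hk with ⟨h1, h2⟩ | ⟨h1, h2⟩ | ⟨h1, h2, h3⟩ | ⟨h1, h2, h3⟩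
    · have e1 : μ (k + 1) = β k := by have := hcond k hk; omega
      have e2 : ν k = α k := by omega
      rw [e1, e2, h1, h2]
      linarith
    · have e1 : μ (k + 1) = α k + 1 := by have := hcond k hk; omega
      have e2 : ν k = β k := by omega
      rw [e1, e2, h1, h2]
      push_cast
      linarith
    · have e1 : μ (k + 1) = α k + 1 := by have := hcond k hk; omega
      have l1 := le_max_left (p (k + 1) + r k) (p k + r (k + 1))
      have l2 := le_max_right (p (k + 1) + r k) (p k + r (k + 1))
      rw [← hX] at l1 l2
      obtain e2 | e2 : ν k = α k ∨ ν k = α k + 1 := by omega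
      all_goals
        rw [e1, e2, h1, h2, h3]
        push_cast
        linarith
    · have e2 : ν k = α k := by omega
      split_ifs at hμk with hc
      · have e1 : μ (k + 1) = α k := by omega
        rw [max_eq_left hc] at hX
        rw [e1, e2, h1, h2, h3]
        push_cast
        linarith
      · have e1 : μ (k + 1) = α k + 1 := by omega
        rw [max_eq_right (not_le.1 hc).le] at hX
        rw [e1, e2, h1, h2, h3]
        push_cast
        linarith

end HiveOct

namespace HiveOct

open Finset

/-! ### Chains of interlacing rows -/

/-- If every edge is counted, the inner values cancel. The end values left over are exactly offset
by the correction in `growWeight`, so such a growing strip weighs nothing. -/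
lemma stripWeight_id (N : ℕ) (p q : ℕ → ℝ) :
    stripWeight N p (fun k => k) q (fun k => k) = (p 0 + p N - q 0 - q (N + 1)) / 6 := by
  induction N with
  | zero => simp only [stripWeight, sum_range_succ, sum_range_zero]; push_cast; ring
  | succ N ih =>
    simp only [stripWeight] at ih ⊢
    simp only [sum_range_succ _ (N + 1)]
    simp only [sum_range_succ _ N] at ih ⊢
    push_cast at ih ⊢
    linear_combination ih

lemma stripWeight_congr {N : ℕ} {p q p' q' : ℕ → ℝ} {α μ α' μ' : ℕ → ℤ}
    (hp : ∀ k ≤ N, p k = p' k) (hα : ∀ k ≤ N, α k = α' k)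
    (hq : ∀ k ≤ N + 1, q k = q' k) (hμ : ∀ k ≤ N + 1, μ k = μ' k) :
    stripWeight N p α q μ = stripWeight N p' α' q' μ' := by
  unfold stripWeight
  congr 1 <;> refine sum_congr rfl fun k hk => ?_ <;> rw [mem_range] at hk
  · rw [hp k (by omega), hα k (by omega), hq k (by omega), hq (k + 1) (by omega),
      hμ k (by omega), hμ (k + 1) (by omega)]
  · rw [hp k (by omega), hα k (by omega), hp (k + 1) (by omega), hα (k + 1) (by omega),
      hq (k + 1) (by omega), hμ (k + 1) (by omega)]

/-- `Chain ρ c a μ s` says that `μ` is the last row, and `s` the weight, of a chain of `a` growing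
strips that starts with `0` on the row of values `ρ 0 c`. -/
def Chain (ρ : ℕ → ℕ → ℕ → ℝ) (c : ℕ) : ℕ → (ℕ → ℤ) → ℝ → Prop
  | 0, μ, s => (∀ k ≤ c, μ k = 0) ∧ s = (ρ 0 c 0 + ρ 0 c c) / 2
  | a + 1, μ, s => ∃ α s', Chain ρ c a α s' ∧ Interlace (a + c) α μ ∧
      s = s' + growWeight (a + c) (ρ a c) α (ρ (a + 1) c) μ

/-- The octahedron rule for the rows `ρ a c`, with `a ≤ Z` and `c ≤ W`. -/
def RowRule (Z W : ℕ) (ρ : ℕ → ℕ → ℕ → ℝ) : Prop :=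
  ∀ a c k, a < Z → c < W → k ≤ a + c → ρ a c k + ρ (a + 1) (c + 1) (k + 1) =
    max (ρ a (c + 1) (k + 1) + ρ (a + 1) c k) (ρ a (c + 1) k + ρ (a + 1) c (k + 1))

lemma shrinkWeight_zero {c : ℕ} {q r : ℕ → ℝ} {μ β : ℕ → ℤ} (hμ : ∀ k ≤ c + 1, μ k = 0)
    (hβ : ∀ k ≤ c, β k = 0) :
    shrinkWeight c q μ r β = (r 0 + r c - q 0 - q (c + 1)) / 2 := by
  rw [shrinkWeight, stripWeight_congr (α' := fun k => k) (μ' := fun k => k) (fun _ _ => rfl)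
    (fun k hk => by simp [compl, hβ k hk]) (fun _ _ => rfl)
    (fun k hk => by simp [compl, hμ k hk]), stripWeight_id]
  ring

/-- The shrinking strip at the end of the chain is moved to its beginning, past one growing strip at
a time, by `exists_upper`. At the beginning all counts are zero, and the strip only turns the
starting weight of level `c + 1` into that of level `c`. -/
lemma Chain.exists_shrink {Z W : ℕ} {ρ : ℕ → ℕ → ℕ → ℝ} (hρ : RowRule Z W ρ) {c : ℕ}
    (hc : c < W) {a : ℕ} (ha : a ≤ Z) {μ β : ℕ → ℤ} {s : ℝ} (h : Chain ρ (c + 1) a μ s)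
    (hi : Interlace (a + c) (compl β) (compl μ)) :
    ∃ s', Chain ρ c a β s' ∧ s + shrinkWeight (a + c) (ρ a (c + 1)) μ (ρ a c) β ≤ s' := by
  induction a generalizing μ β s with
  | zero =>
    obtain ⟨h0, rfl⟩ := h
    rw [Nat.zero_add] at *
    -- A row interlacing with a row in which every edge is counted (here after taking complements)
    -- has every edge counted too.
    have hβ : ∀ k ≤ c, β k = 0 := by
      intro k hk
      have h1 := hi.le k hk
      have h2 := hi.le_add_one k hk
      simp only [compl, h0 k (by omega), h0 (k + 1) (by omega)] at h1 h2
      have h3 := hi.zero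
      simp only [compl, h0 0 (by omega)] at h3
      push_cast at *
      omega
    refine ⟨_, ⟨hβ, rfl⟩, ?_⟩
    rw [shrinkWeight_zero h0 hβ]
    linarith
  | succ a ih =>
    obtain ⟨α, s₀, hα, hαμ, rfl⟩ := h
    have e : a + 1 + c = a + c + 1 := by omega
    rw [e] at hi ⊢
    obtain ⟨ν, h1, h2, h3⟩ := exists_upper (p := ρ a (c + 1)) (q := ρ (a + 1) (c + 1))
      (r := ρ (a + 1) c) (s := ρ a c) (fun k hk => hρ a c k (by omega) hc hk) hαμ hi
    obtain ⟨s₁, h4, h5⟩ := ih (by omega) hα h1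
    refine ⟨_, ⟨ν, s₁, h4, h2, rfl⟩, ?_⟩
    rw [← add_assoc a c 1]
    linarith

/-- The same journey backwards: a trivial shrinking strip is inserted at the beginning of the chain
and moved to its end by `exists_lower`. -/
lemma Chain.exists_grow {Z W : ℕ} {ρ : ℕ → ℕ → ℕ → ℝ} (hρ : RowRule Z W ρ) {c : ℕ}
    (hc : c < W) {a : ℕ} (ha : a ≤ Z) {β : ℕ → ℤ} {s' : ℝ} (h : Chain ρ c a β s') :
    ∃ μ s, Chain ρ (c + 1) a μ s ∧ Interlace (a + c) (compl β) (compl μ) ∧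
      s' ≤ s + shrinkWeight (a + c) (ρ a (c + 1)) μ (ρ a c) β := by
  induction a generalizing β s' with
  | zero =>
    obtain ⟨h0, rfl⟩ := h
    rw [Nat.zero_add]
    refine ⟨fun _ => 0, _, ⟨fun _ _ => rfl, rfl⟩, ?_, ?_⟩
    · refine ⟨?_, ?_, fun k hk => ?_, fun k hk => ?_, fun k hk => ?_, fun k hk => ?_⟩
      · simp [compl, h0 0 (by omega)]
      · simp [compl, h0 c le_rfl]
      · simp [compl, h0 k (by omega), h0 (k + 1) (by omega)]
      all_goals simp [compl, h0 k (by omega)]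
    · rw [shrinkWeight_zero (fun _ _ => rfl) h0]
      linarith
  | succ a ih =>
    obtain ⟨ν, s₀, hν, hνβ, rfl⟩ := h
    have e : a + 1 + c = a + c + 1 := by omega
    rw [e] at *
    obtain ⟨α, s₁, h4, h5, h6⟩ := ih (by omega) hν
    obtain ⟨μ, h1, h2, h3⟩ := exists_lower (p := ρ a (c + 1)) (q := ρ (a + 1) (c + 1))
      (r := ρ (a + 1) c) (s := ρ a c) (fun k hk => hρ a c k (by omega) hc hk) h5 hνβ
    refine ⟨μ, _, ⟨α, s₁, h4, h1, rfl⟩, h2, ?_⟩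
    rw [← add_assoc a c 1]
    linarith

/-- At level 0 the chain starts from a single point, so interlacing forces every edge to be counted.
All strips then weigh zero, and only the starting value is left. -/
lemma chain_zero_iff {ρ : ℕ → ℕ → ℕ → ℝ} {a : ℕ} {μ : ℕ → ℤ} {s : ℝ} (h : Chain ρ 0 a μ s) :
    (∀ k ≤ a, μ k = k) ∧ s = ρ 0 0 0 := by
  induction a generalizing μ s with
  | zero =>
    obtain ⟨h0, rfl⟩ := h
    exact ⟨fun k hk => by obtain rfl : k = 0 := by omega
                          exact_mod_cast h0 0 le_rfl, by ring⟩
  | succ a ih =>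
    obtain ⟨α, s₀, hα, hi, rfl⟩ := h
    obtain ⟨h1, rfl⟩ := ih hα
    rw [Nat.add_zero] at *
    have hμ : ∀ k ≤ a + 1, μ k = k := by
      intro k hk
      rcases Nat.lt_or_ge a k with hk' | hk'
      · obtain rfl : k = a + 1 := by omega
        rw [hi.last, h1 a le_rfl]; push_cast; ring
      · have h2 := hi.le k hk'
        have h3 := hi.le_add_one k hk'
        have h4 := hi.mono' k hk'
        rcases k with _ | k
        · rw [hi.zero, h1 0 hk']
        · have h5 := hi.le_add_one k (by omega)
          rw [h1 k (by omega)] at h5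
          rw [h1 (k + 1) (by omega)] at h2
          push_cast at *
          omega
    refine ⟨hμ, ?_⟩
    rw [growWeight, Nat.add_zero, stripWeight_congr (α' := fun k => k) (μ' := fun k => k)
      (fun _ _ => rfl) h1 (fun _ _ => rfl) hμ, stripWeight_id]
    ring

lemma exists_chain_id (ρ : ℕ → ℕ → ℕ → ℝ) (a : ℕ) : ∃ s, Chain ρ 0 a (fun k => k) s := by
  induction a with
  | zero => exact ⟨_, fun k hk => by simpa using hk, rfl⟩
  | succ a ih =>
    obtain ⟨s, hs⟩ := ih
    refine ⟨_, _, s, hs, ⟨rfl, ?_, fun k hk => ?_, fun k hk => ?_, fun k hk => ?_,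
      fun k hk => ?_⟩, rfl⟩
    all_goals push_cast; omega

lemma Interlace.congr {N : ℕ} {α μ μ' : ℕ → ℤ} (h : Interlace N α μ)
    (hμ : ∀ k ≤ N + 1, μ k = μ' k) : Interlace N α μ' where
  zero := by rw [← hμ 0 (by omega), h.zero]
  last := by rw [← hμ (N + 1) le_rfl, h.last]
  mono := h.mono
  le k hk := by rw [← hμ k (by omega)]; exact h.le k hk
  mono' k hk := by rw [← hμ k (by omega), ← hμ (k + 1) (by omega)]; exact h.mono' k hk
  le_add_one k hk := by rw [← hμ (k + 1) (by omega)]; exact h.le_add_one k hk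

lemma Chain.congr {ρ : ℕ → ℕ → ℕ → ℝ} {c a : ℕ} {μ μ' : ℕ → ℤ} {s : ℝ} (h : Chain ρ c a μ s)
    (hμ : ∀ k ≤ a + c, μ k = μ' k) : Chain ρ c a μ' s := by
  cases a with
  | zero => exact ⟨fun k hk => by rw [← hμ k (by omega), h.1 k hk], h.2⟩
  | succ a =>
    obtain ⟨α, s₀, h1, h2, rfl⟩ := h
    refine ⟨α, s₀, h1, h2.congr fun k hk => hμ k (by omega), ?_⟩
    rw [growWeight, growWeight, stripWeight_congr (fun _ _ => rfl) (fun _ _ => rfl)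
      (fun _ _ => rfl) fun k hk => hμ k (by omega)]

/-- The row counts of a lozenge tiling: `f a` counts the edges crossed upwards in the rows below
the border, `g c` counts the edges that are crossed downwards in the rows above it. -/
structure RowCounts (Z W : ℕ) (f g : ℕ → ℕ → ℤ) : Prop where
  zero : ∀ k ≤ W, f 0 k = 0
  grow : ∀ a < Z, Interlace (a + W) (f a) (f (a + 1))
  border : ∀ k ≤ Z + W, f Z k + g W k = k
  shrink : ∀ c < W, Interlace (Z + c) (g c) (g (c + 1))

/-- The total weight of row counts. -/
noncomputable def rowCountsWeight (Z W : ℕ) (ρ : ℕ → ℕ → ℕ → ℝ) (f g : ℕ → ℕ → ℤ) : ℝ :=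
  ∑ a ∈ range Z, stripWeight (a + W) (ρ a W) (f a) (ρ (a + 1) W) (f (a + 1)) +
    ∑ c ∈ range W, stripWeight (Z + c) (ρ Z c) (g c) (ρ Z (c + 1)) (g (c + 1)) +
    (ρ 0 W 0 + ρ 0 W W + ρ Z 0 0 + ρ Z 0 Z) / 3 - (ρ Z W 0 + ρ Z W (Z + W)) / 6

/-- The corrections in `growWeight` and `shrinkWeight` telescope along the two halves of the
hexagon, leaving only values at its corners. -/
lemma rowCountsWeight_eq (Z W : ℕ) (ρ : ℕ → ℕ → ℕ → ℝ) (f g : ℕ → ℕ → ℤ) :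
    rowCountsWeight Z W ρ f g = (ρ 0 W 0 + ρ 0 W W) / 2 +
      ∑ a ∈ range Z, growWeight (a + W) (ρ a W) (f a) (ρ (a + 1) W) (f (a + 1)) +
      ∑ c ∈ range W, shrinkWeight (Z + c) (ρ Z (c + 1)) (compl (g (c + 1))) (ρ Z c)
        (compl (g c)) := by
  have h1 := sum_range_sub (fun a => (ρ a W 0 + ρ a W (a + W)) / 6) Z
  have h2 := sum_range_sub (fun c => (ρ Z c 0 + ρ Z c (Z + c)) / 3) W
  simp only [Nat.zero_add, Nat.add_zero] at h1 h2
  have h3 : ∑ a ∈ range Z, growWeight (a + W) (ρ a W) (f a) (ρ (a + 1) W) (f (a + 1)) =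
      ∑ a ∈ range Z, stripWeight (a + W) (ρ a W) (f a) (ρ (a + 1) W) (f (a + 1)) +
      ((ρ Z W 0 + ρ Z W (Z + W)) / 6 - (ρ 0 W 0 + ρ 0 W W) / 6) := by
    rw [← h1, ← sum_add_distrib]
    refine sum_congr rfl fun a _ => ?_
    rw [growWeight, show a + 1 + W = a + W + 1 by omega]
    ring
  have h4 : ∑ c ∈ range W, shrinkWeight (Z + c) (ρ Z (c + 1)) (compl (g (c + 1))) (ρ Z c)
        (compl (g c)) =
      ∑ c ∈ range W, stripWeight (Z + c) (ρ Z c) (g c) (ρ Z (c + 1)) (g (c + 1)) -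
      ((ρ Z W 0 + ρ Z W (Z + W)) / 3 - (ρ Z 0 0 + ρ Z 0 Z) / 3) := by
    rw [← h2, ← sum_sub_distrib]
    refine sum_congr rfl fun c _ => ?_
    rw [shrinkWeight, compl_compl, compl_compl, ← add_assoc Z c 1]
    ring
  rw [h3, h4, rowCountsWeight]
  ring

lemma RowCounts.chain {Z W : ℕ} {f g : ℕ → ℕ → ℤ} (h : RowCounts Z W f g)
    (ρ : ℕ → ℕ → ℕ → ℝ) {a : ℕ} (ha : a ≤ Z) :
    Chain ρ W a (f a) ((ρ 0 W 0 + ρ 0 W W) / 2 +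
      ∑ a ∈ range a, growWeight (a + W) (ρ a W) (f a) (ρ (a + 1) W) (f (a + 1))) := by
  induction a with
  | zero => exact ⟨h.zero, by simp⟩
  | succ a ih =>
    exact ⟨_, _, ih (by omega), h.grow a (by omega), by rw [sum_range_succ]; ring⟩

/-- All shrinking strips are absorbed in turn, so that the staircase ends up at level 0, where the
weight is known. -/
lemma exists_chain_of_shrink {Z W : ℕ} {ρ : ℕ → ℕ → ℕ → ℝ} (hρ : RowRule Z W ρ)
    {g : ℕ → ℕ → ℤ} (hg : ∀ c < W, Interlace (Z + c) (g c) (g (c + 1))) {c : ℕ} (hc : c ≤ W)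
    {s : ℝ} (hs : Chain ρ c Z (compl (g c)) s) :
    ∃ s', Chain ρ 0 Z (compl (g 0)) s' ∧
      s + ∑ c ∈ range c, shrinkWeight (Z + c) (ρ Z (c + 1)) (compl (g (c + 1))) (ρ Z c)
        (compl (g c)) ≤ s' := by
  induction c generalizing s with
  | zero => exact ⟨s, hs, by simp⟩
  | succ c ih =>
    obtain ⟨s₁, h1, h2⟩ := hs.exists_shrink hρ (β := compl (g c)) (by omega) le_rfl
      (by simpa only [compl_compl] using hg c (by omega))
    obtain ⟨s', h3, h4⟩ := ih (by omega) h1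
    exact ⟨s', h3, by rw [sum_range_succ]; linarith⟩

/-- Starting from the forced counts at level 0, shrinking strips are released one by one without
loss; the rows recorded on the way become the upper half of an optimal tiling. -/
lemma exists_shrink_chain {Z W : ℕ} {ρ : ℕ → ℕ → ℕ → ℝ} (hρ : RowRule Z W ρ)
    {c : ℕ} (hc : c ≤ W) :
    ∃ (g : ℕ → ℕ → ℤ) (s : ℝ), (∀ c' < c, Interlace (Z + c') (g c') (g (c' + 1))) ∧
      Chain ρ c Z (compl (g c)) s ∧
      ρ 0 0 0 ≤ s + ∑ c ∈ range c, shrinkWeight (Z + c) (ρ Z (c + 1)) (compl (g (c + 1))) (ρ Z c)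
        (compl (g c)) := by
  induction c with
  | zero =>
    obtain ⟨s, hs⟩ := exists_chain_id ρ Z
    refine ⟨fun _ => compl fun k => k, s, by simp, by simpa only [compl_compl] using hs, ?_⟩
    rw [(chain_zero_iff hs).2]
    simp
  | succ c ih =>
    obtain ⟨g, s, h1, h2, h3⟩ := ih (by omega)
    obtain ⟨μ, s', h4, h5, h6⟩ := h2.exists_grow hρ (by omega) le_rfl
    rw [compl_compl] at h5
    refine ⟨Function.update g (c + 1) (compl μ), s', fun c' hc' => ?_, ?_, ?_⟩
    · rw [Function.update_of_ne (by omega)]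
      rcases Nat.lt_or_ge c' c with h | h
      · rw [Function.update_of_ne (by omega)]
        exact h1 c' h
      · obtain rfl : c' = c := by omega
        rwa [Function.update_self]
    · rwa [Function.update_self, compl_compl]
    · rw [sum_range_succ, Function.update_self, Function.update_of_ne (by omega), compl_compl]
      have : ∀ x ∈ range c, shrinkWeight (Z + x) (ρ Z (x + 1))
          (compl (Function.update g (c + 1) (compl μ) (x + 1))) (ρ Z x)
          (compl (Function.update g (c + 1) (compl μ) x)) =
          shrinkWeight (Z + x) (ρ Z (x + 1)) (compl (g (x + 1))) (ρ Z x) (compl (g x)) := by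
        intro x hx
        rw [mem_range] at hx
        rw [Function.update_of_ne (by omega), Function.update_of_ne (by omega)]
      rw [sum_congr rfl this]
      linarith

lemma Chain.exists_rows {ρ : ℕ → ℕ → ℕ → ℝ} {W a : ℕ} {μ : ℕ → ℤ} {s : ℝ}
    (h : Chain ρ W a μ s) :
    ∃ f : ℕ → ℕ → ℤ, f a = μ ∧ (∀ k ≤ W, f 0 k = 0) ∧
      (∀ a' < a, Interlace (a' + W) (f a') (f (a' + 1))) ∧ s = (ρ 0 W 0 + ρ 0 W W) / 2 +
      ∑ a ∈ range a, growWeight (a + W) (ρ a W) (f a) (ρ (a + 1) W) (f (a + 1)) := by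
  induction a generalizing μ s with
  | zero => exact ⟨fun _ => μ, rfl, h.1, by simp, by simp [h.2]⟩
  | succ a ih =>
    obtain ⟨α, s₀, hα, hi, rfl⟩ := h
    obtain ⟨f, rfl, h1, h2, rfl⟩ := ih hα
    refine ⟨Function.update f (a + 1) μ, Function.update_self .., ?_, fun a' ha' => ?_, ?_⟩
    · rwa [Function.update_of_ne (by omega)]
    · rw [Function.update_of_ne (by omega)]
      rcases Nat.lt_or_ge a' a with h | h
      · rw [Function.update_of_ne (by omega)]
        exact h2 a' h
      · obtain rfl : a' = a := by omega
        rwa [Function.update_self]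
    · rw [sum_range_succ, Function.update_self, Function.update_of_ne (by omega), add_assoc]
      congr 2
      refine sum_congr rfl fun x hx => ?_
      rw [mem_range] at hx
      rw [Function.update_of_ne (by omega), Function.update_of_ne (by omega)]

lemma RowCounts.weight_le {Z W : ℕ} {ρ : ℕ → ℕ → ℕ → ℝ} (hρ : RowRule Z W ρ)
    {f g : ℕ → ℕ → ℤ} (h : RowCounts Z W f g) : rowCountsWeight Z W ρ f g ≤ ρ 0 0 0 := by
  rw [rowCountsWeight_eq]
  have h1 := h.chain ρ le_rfl
  set s := (ρ 0 W 0 + ρ 0 W W) / 2 +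
      ∑ a ∈ range Z, growWeight (a + W) (ρ a W) (f a) (ρ (a + 1) W) (f (a + 1))
  have h2 : ∃ s', Chain ρ 0 Z (compl (g 0)) s' ∧
      s + ∑ c ∈ range W, shrinkWeight (Z + c) (ρ Z (c + 1)) (compl (g (c + 1))) (ρ Z c)
        (compl (g c)) ≤ s' := by
    -- The border condition says that the last count of the lower half is the complement of the
    -- first count of the upper half, which glues the two halves.
    refine exists_chain_of_shrink hρ h.shrink le_rfl (h1.congr fun k hk => ?_)
    have := h.border k hk
    simp only [compl]
    omega
  obtain ⟨s', h3, h4⟩ := h2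
  rw [(chain_zero_iff h3).2] at h4
  linarith

lemma exists_rowCounts {Z W : ℕ} {ρ : ℕ → ℕ → ℕ → ℝ} (hρ : RowRule Z W ρ) :
    ∃ f g, RowCounts Z W f g ∧ ρ 0 0 0 ≤ rowCountsWeight Z W ρ f g := by
  obtain ⟨g, s, h1, h2, h3⟩ := exists_shrink_chain hρ le_rfl
  obtain ⟨f, h4, h5, h6, rfl⟩ := h2.exists_rows
  refine ⟨f, g, ⟨h5, h6, fun k hk => ?_, h1⟩, by rwa [rowCountsWeight_eq]⟩
  rw [h4]
  simp [compl]

end HiveOct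

namespace HiveOct

open Finset

/-! ### The octahedron recurrence as an evolution of functions on the square -/

/-- The vertices of the square whose values change at time `t`. -/
def Active (n : ℕ) (t : ℕ) (v : ℤ × ℤ) : Prop :=
  (n : ℤ) - v.1 - v.2 + 2 ≤ t ∧ v.1 + v.2 - n + 2 ≤ t ∧ t + v.1 - v.2 ≤ n ∧ t + v.2 - v.1 ≤ n ∧
    (t + n - v.1 - v.2) % 2 = 0

instance (n t : ℕ) (v : ℤ × ℤ) : Decidable (Active n t v) := by unfold Active; infer_instance

/-- The new value at a vertex, given the old values. -/
noncomputable def flipValue (S : ℤ × ℤ → ℝ) (v : ℤ × ℤ) : ℝ :=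
  max (S (v.1, v.2 - 1) + S (v.1, v.2 + 1)) (S (v.1 + 1, v.2) + S (v.1 - 1, v.2)) - S v

/-- One time step of the octahedron recurrence. -/
noncomputable def octStep (n t : ℕ) (S : ℤ × ℤ → ℝ) (v : ℤ × ℤ) : ℝ :=
  if Active n t v then flipValue S v else S v

/-- The values after `t` time steps: at `(x + w, y + w)` this is the value at `[x, y, z, w]`, where
`z + w ≤ t` is as large as possible. -/
noncomputable def octState (n : ℕ) (κ : ℤ × ℤ → ℝ) : ℕ → ℤ × ℤ → ℝ
  | 0 => κ
  | t + 1 => octStep n (t + 1) (octState n κ t)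

lemma octState_eq_of_not_active {n : ℕ} {κ : ℤ × ℤ → ℝ} {v : ℤ × ℤ} {t t' : ℕ} (h : t ≤ t')
    (ha : ∀ s, t < s → s ≤ t' → ¬ Active n s v) : octState n κ t' v = octState n κ t v := by
  induction t', h using Nat.le_induction with
  | base => rfl
  | succ t' h ih =>
    rw [← ih fun s h1 h2 => ha s h1 (by omega)]
    exact if_neg (ha (t' + 1) (by omega) le_rfl)

/-- The octahedron rule on the tetrahedron of size `n`. -/
def IsOctahedral (n : ℕ) (o : ℤ → ℤ → ℤ → ℤ → ℝ) : Prop :=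
  ∀ x y z w : ℤ, 0 ≤ x → 0 ≤ y → 0 ≤ z → 0 ≤ w → x + y + z + w + 2 = n →
    o x y (z + 1) (w + 1) =
      max (o (x + 1) y (z + 1) w + o x (y + 1) z (w + 1))
        (o (x + 1) y z (w + 1) + o x (y + 1) (z + 1) w) - o (x + 1) (y + 1) z w

/-- The function `o` restricts to `κ` on the faces `z = 0` and `w = 0`. -/
def InitialFaces (n : ℕ) (o : ℤ → ℤ → ℤ → ℤ → ℝ) (κ : ℤ × ℤ → ℝ) : Prop :=
  (∀ i j : ℤ, i ≤ n → j ≤ n → n ≤ i + j → o (n - j) (n - i) 0 (i + j - n) = κ (i, j)) ∧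
    (∀ i j : ℤ, 0 ≤ i → 0 ≤ j → i + j ≤ n → o i j (n - i - j) 0 = κ (i, j))

/-- The function `o` restricts to `η` on the faces `x = 0` and `y = 0`. -/
def FinalFaces (n : ℕ) (o : ℤ → ℤ → ℤ → ℤ → ℝ) (η : ℤ × ℤ → ℝ) : Prop :=
  (∀ i j : ℤ, 0 ≤ i → i ≤ j → j ≤ n → o 0 (j - i) (n - j) i = η (i, j)) ∧
    (∀ i j : ℤ, 0 ≤ j → j ≤ i → i ≤ n → o (i - j) 0 (n - i) j = η (i, j))

lemma octRecurrence_iff_exists {n : ℕ} {κ η : ℤ × ℤ → ℝ} :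
    OctRecurrence n κ η ↔ ∃ o, IsOctahedral n o ∧ InitialFaces n o κ ∧ FinalFaces n o η := by
  simp only [OctRecurrence, IsOctahedral, InitialFaces, FinalFaces, and_assoc]

/-- Passing from `[x+1, y+1, z, w]` to `[x, y, z+1, w+1]` keeps the vertex of the square and raises
the time `z + w` by 2. The other four corners of the octahedron lie over the four neighbours of that
vertex, at the time in between, so the octahedron rule is `flipValue`. -/
lemma eq_octState {n : ℕ} {κ : ℤ × ℤ → ℝ} {o : ℤ → ℤ → ℤ → ℤ → ℝ} (ho : IsOctahedral n o)
    (hκ : InitialFaces n o κ) (t : ℕ) {x y z w : ℤ} (hx : 0 ≤ x) (hy : 0 ≤ y) (hz : 0 ≤ z)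
    (hw : 0 ≤ w) (hn : x + y + z + w = n) (ht : z + w = t) :
    o x y z w = octState n κ t (x + w, y + w) := by
  induction t using Nat.strong_induction_on generalizing x y z w with
  | _ t ih =>
    rcases hz.eq_or_lt with rfl | hz'
    · rw [octState_eq_of_not_active (Nat.zero_le t)
        (by rintro s h1 h2 ⟨h3, h4, -⟩; dsimp only at h3 h4; omega)]
      have := hκ.1 (x + w) (y + w) (by omega) (by omega) (by omega)
      rw [show (n : ℤ) - (y + w) = x by omega, show (n : ℤ) - (x + w) = y by omega,
        show x + w + (y + w) - n = w by omega] at this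
      exact this
    rcases hw.eq_or_lt with rfl | hw'
    · rw [octState_eq_of_not_active (Nat.zero_le t)
        (by rintro s h1 h2 ⟨h3, h4, -⟩; dsimp only at h3 h4; omega)]
      have := hκ.2 (x + 0) (y + 0) (by omega) (by omega) (by omega)
      rw [show (n : ℤ) - (x + 0) - (y + 0) = z by omega] at this
      simpa only [add_zero, octState] using this
    obtain ⟨z, rfl⟩ : ∃ z', z = z' + 1 := ⟨z - 1, by omega⟩
    obtain ⟨w, rfl⟩ : ∃ w', w = w' + 1 := ⟨w - 1, by omega⟩
    obtain ⟨t, rfl⟩ : ∃ t', t = t' + 2 := ⟨t - 2, by omega⟩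
    rw [ho x y z w hx hy (by omega) (by omega) (by omega)]
    -- Time and vertex determine all four coordinates; `Active` says that they are integers with `x,
    -- y ≥ 0` and `z, w ≥ 1`. By parity the vertex is not active one step earlier.
    have hact : Active n (t + 2) (x + (w + 1), y + (w + 1)) := by
      unfold Active; dsimp only; push_cast; omega
    have hnact : ∀ s, t < s → s ≤ t + 1 → ¬ Active n s (x + (w + 1), y + (w + 1)) := by
      unfold Active; dsimp only; omega
    rw [show octState n κ (t + 2) (x + (w + 1), y + (w + 1)) =
      flipValue (octState n κ (t + 1)) (x + (w + 1), y + (w + 1)) from if_pos hact, flipValue,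
      octState_eq_of_not_active (Nat.le_succ t) hnact]
    rw [ih (t + 1) (by omega) (x := x + 1) (y := y) (z := z + 1) (w := w),
      ih (t + 1) (by omega) (x := x) (y := y + 1) (z := z) (w := w + 1),
      ih (t + 1) (by omega) (x := x + 1) (y := y) (z := z) (w := w + 1),
      ih (t + 1) (by omega) (x := x) (y := y + 1) (z := z + 1) (w := w),
      ih t (by omega) (x := x + 1) (y := y + 1) (z := z) (w := w)]
    any_goals (push_cast; omega)
    dsimp only
    rw [show x + 1 + w = x + (w + 1) by ring, show y + 1 + (w + 1) = y + (w + 1) + 1 by ring,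
      show x + 1 + (w + 1) = x + (w + 1) + 1 by ring, show y + w = y + (w + 1) - 1 by ring,
      show x + w = x + (w + 1) - 1 by ring, show y + 1 + w = y + (w + 1) by ring]

/-- The values of `octState` on the tetrahedron. -/
noncomputable def octExtension (n : ℕ) (κ : ℤ × ℤ → ℝ) (x y z w : ℤ) : ℝ :=
  octState n κ (z + w).toNat (x + w, y + w)

lemma initialFaces_octExtension (n : ℕ) (κ : ℤ × ℤ → ℝ) :
    InitialFaces n (octExtension n κ) κ := by
  constructor
  · intro i j hi hj hij
    rw [octExtension, show (n : ℤ) - j + (i + j - n) = i by ring,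
      show (n : ℤ) - i + (i + j - n) = j by ring]
    refine octState_eq_of_not_active (Nat.zero_le _) ?_
    rintro s h1 h2 ⟨h3, h4, -⟩
    dsimp only at h3 h4
    omega
  · intro i j hi hj hij
    rw [octExtension, add_zero, add_zero, add_zero]
    refine octState_eq_of_not_active (Nat.zero_le _) ?_
    rintro s h1 h2 ⟨h3, h4, -⟩
    dsimp only at h3 h4
    omega

lemma isOctahedral_octExtension (n : ℕ) (κ : ℤ × ℤ → ℝ) :
    IsOctahedral n (octExtension n κ) := by
  intro x y z w hx hy hz hw hn
  simp only [octExtension]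
  obtain ⟨t, ht⟩ : ∃ t : ℕ, z + w = t := ⟨(z + w).toNat, by omega⟩
  rw [show (z + 1 + (w + 1)).toNat = t + 2 by omega, show (z + 1 + w).toNat = t + 1 by omega,
    show (z + (w + 1)).toNat = t + 1 by omega, show (z + w).toNat = t by omega]
  have hact : Active n (t + 2) (x + (w + 1), y + (w + 1)) := by
    unfold Active; dsimp only; push_cast; omega
  have hnact : ∀ s, t < s → s ≤ t + 1 → ¬ Active n s (x + (w + 1), y + (w + 1)) := by
    unfold Active; dsimp only; omega
  rw [show octState n κ (t + 2) (x + (w + 1), y + (w + 1)) =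
    flipValue (octState n κ (t + 1)) (x + (w + 1), y + (w + 1)) from if_pos hact, flipValue,
    octState_eq_of_not_active (Nat.le_succ t) hnact]
  dsimp only
  rw [show x + 1 + w = x + (w + 1) by ring, show y + 1 + (w + 1) = y + (w + 1) + 1 by ring,
    show x + 1 + (w + 1) = x + (w + 1) + 1 by ring, show y + w = y + (w + 1) - 1 by ring,
    show x + w = x + (w + 1) - 1 by ring, show y + 1 + w = y + (w + 1) by ring]

lemma finalFaces_iff {n : ℕ} {κ η : ℤ × ℤ → ℝ} {o : ℤ → ℤ → ℤ → ℤ → ℝ} (ho : IsOctahedral n o)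
    (hκ : InitialFaces n o κ) :
    FinalFaces n o η ↔ ∀ v ∈ Square n, η v = octState n κ n v := by
  have key1 : ∀ i j : ℤ, 0 ≤ i → i ≤ j → j ≤ n →
      o 0 (j - i) (n - j) i = octState n κ n (i, j) := by
    intro i j h0 h1 h2
    obtain ⟨t, ht⟩ : ∃ t : ℕ, (n : ℤ) - j + i = t := ⟨(n - j + i).toNat, by omega⟩
    rw [eq_octState ho hκ t le_rfl (by omega) (by omega) h0 (by ring) ht, zero_add,
      sub_add_cancel]
    -- A further change at this vertex would need a negative `x`- or `y`-coordinate, so its value is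
    -- final.
    refine (octState_eq_of_not_active (by omega) ?_).symm
    rintro s h1 h2 ⟨-, -, h3, h4, -⟩
    dsimp only at h3 h4
    omega
  have key2 : ∀ i j : ℤ, 0 ≤ j → j ≤ i → i ≤ n →
      o (i - j) 0 (n - i) j = octState n κ n (i, j) := by
    intro i j h0 h1 h2
    obtain ⟨t, ht⟩ : ∃ t : ℕ, (n : ℤ) - i + j = t := ⟨(n - i + j).toNat, by omega⟩
    rw [eq_octState ho hκ t (by omega) le_rfl (by omega) h0 (by ring) ht, zero_add,
      sub_add_cancel]
    refine (octState_eq_of_not_active (by omega) ?_).symm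
    rintro s h1 h2 ⟨-, -, h3, h4, -⟩
    dsimp only at h3 h4
    omega
  constructor
  · rintro ⟨h1, h2⟩ ⟨i, j⟩ ⟨h3, h4, h5, h6⟩
    dsimp only at h3 h4 h5 h6
    rcases le_total i j with h | h
    · rw [← h1 i j h3 h h6, key1 i j h3 h h6]
    · rw [← h2 i j h5 h h4, key2 i j h5 h h4]
  · intro h
    refine ⟨fun i j h1 h2 h3 => ?_, fun i j h1 h2 h3 => ?_⟩
    · rw [key1 i j h1 h2 h3, h _ ⟨h1, by dsimp only; omega, by dsimp only; omega, h3⟩]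
    · rw [key2 i j h1 h2 h3, h _ ⟨by dsimp only; omega, h3, h1, by dsimp only; omega⟩]

lemma octRecurrence_iff {n : ℕ} {κ η : ℤ × ℤ → ℝ} :
    OctRecurrence n κ η ↔ ∀ v ∈ Square n, η v = octState n κ n v := by
  rw [octRecurrence_iff_exists]
  constructor
  · rintro ⟨o, h1, h2, h3⟩
    exact (finalFaces_iff h1 h2).1 h3
  · intro h
    exact ⟨_, isOctahedral_octExtension n κ, initialFaces_octExtension n κ,
      (finalFaces_iff (isOctahedral_octExtension n κ) (initialFaces_octExtension n κ)).2 h⟩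

end HiveOct

namespace HiveOct

open Finset

/-! ### Tilings as assignments of tiles to unit triangles -/

/-- The lattice points of the hexagon whose corners are `(X, Y + Z + W)`, `(X, Y + W)`,
`(X + W, Y)`, `(X + Z + W, Y)`, `(X + Z + W, Y + W)`, `(X + W, Y + Z + W)`. -/
def InHex (X Y : ℤ) (Z W : ℕ) (p : ℤ × ℤ) : Prop :=
  X ≤ p.1 ∧ p.1 ≤ X + Z + W ∧ Y ≤ p.2 ∧ p.2 ≤ Y + Z + W ∧ X + Y + W ≤ p.1 + p.2 ∧
    p.1 + p.2 ≤ X + Y + Z + 2 * W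

open Classical in
/-- The indicator of membership in `Ξ`. -/
noncomputable def ind (Ξ : Finset Tile) (t : Tile) : ℤ := if t ∈ Ξ then 1 else 0

lemma ind_nonneg (Ξ : Finset Tile) (t : Tile) : 0 ≤ ind Ξ t := by
  unfold ind; split_ifs <;> simp

lemma ind_eq_zero {Ξ : Finset Tile} {t : Tile} : ind Ξ t = 0 ↔ t ∉ Ξ := by
  unfold ind; split_ifs <;> simp [*]

lemma ind_eq_one {Ξ : Finset Tile} {t : Tile} : ind Ξ t = 1 ↔ t ∈ Ξ := by
  unfold ind; split_ifs <;> simp [*]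

lemma up_subset_verts_iff {n : ℕ} {i j : ℤ} {t : Tile} :
    ({(i, j), (i + 1, j), (i + 1, j - 1)} : Finset (ℤ × ℤ)) ⊆ t.verts n ↔
      t = .lozI i j ∨ t = .lozII (i + 1) (j - 1) ∨ t = .lozIII i (j - 1) ∨
        (t = .borderUp i ∧ i + j = n) := by
  cases t <;>
  · simp only [Tile.verts, insert_subset_iff, singleton_subset_iff, mem_insert, mem_singleton,
      Prod.mk.injEq, Tile.lozI.injEq, Tile.lozII.injEq, Tile.lozIII.injEq, Tile.borderUp.injEq,
      reduceCtorEq, false_and, or_false, false_or]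
    constructor
    · rintro ⟨h1, h2, h3⟩
      omega
    · intro h
      first | omega | exact h.elim

lemma down_subset_verts_iff {n : ℕ} {i j : ℤ} {t : Tile} :
    ({(i, j), (i, j - 1), (i + 1, j - 1)} : Finset (ℤ × ℤ)) ⊆ t.verts n ↔
      t = .lozI (i - 1) j ∨ t = .lozII (i + 1) (j - 2) ∨ t = .lozIII i (j - 1) ∨
        (t = .borderDown i ∧ i + j = n) := by
  cases t <;>
  · simp only [Tile.verts, insert_subset_iff, singleton_subset_iff, mem_insert, mem_singleton,
      Prod.mk.injEq, Tile.lozI.injEq, Tile.lozII.injEq, Tile.lozIII.injEq, Tile.borderDown.injEq,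
      reduceCtorEq, false_and, or_false, false_or]
    constructor
    · rintro ⟨h1, h2, h3⟩
      omega
    · intro h
      first | omega | exact h.elim

/-- Unique coverage becomes a linear equation between 0-1 indicators. Partial sums along rows will
solve these equations. -/
lemma existsUnique_iff_sum_ind {Ξ : Finset Tile} {a b c d : Tile} (hab : a ≠ b) (hac : a ≠ c)
    (had : a ≠ d) (hbc : b ≠ c) (hbd : b ≠ d) (hcd : c ≠ d) (q : Prop) [Decidable q] :
    (∃! t, t ∈ Ξ ∧ (t = a ∨ t = b ∨ t = c ∨ (t = d ∧ q))) ↔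
      ind Ξ a + ind Ξ b + ind Ξ c + (if q then ind Ξ d else 0) = 1 := by
  simp only [ExistsUnique]
  constructor
  · rintro ⟨t, ⟨h1, h2⟩, h3⟩
    have ha : a ∈ Ξ → a = t := fun h => h3 a ⟨h, .inl rfl⟩
    have hb : b ∈ Ξ → b = t := fun h => h3 b ⟨h, .inr (.inl rfl)⟩
    have hc : c ∈ Ξ → c = t := fun h => h3 c ⟨h, .inr (.inr (.inl rfl))⟩
    have hd : q → d ∈ Ξ → d = t := fun hq h => h3 d ⟨h, .inr (.inr (.inr ⟨rfl, hq⟩))⟩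
    rcases h2 with rfl | rfl | rfl | ⟨rfl, hq⟩
    · rw [ind_eq_one.2 h1, ind_eq_zero.2 fun h => hab (hb h).symm,
        ind_eq_zero.2 fun h => hac (hc h).symm]
      split_ifs with hq
      · rw [ind_eq_zero.2 fun h => had (hd hq h).symm]; rfl
      · rfl
    · rw [ind_eq_one.2 h1, ind_eq_zero.2 fun h => hab (ha h),
        ind_eq_zero.2 fun h => hbc (hc h).symm]
      split_ifs with hq
      · rw [ind_eq_zero.2 fun h => hbd (hd hq h).symm]; rfl
      · rfl
    · rw [ind_eq_one.2 h1, ind_eq_zero.2 fun h => hac (ha h),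
        ind_eq_zero.2 fun h => hbc (hb h)]
      split_ifs with hq
      · rw [ind_eq_zero.2 fun h => hcd (hd hq h).symm]; rfl
      · rfl
    · rw [if_pos hq, ind_eq_one.2 h1, ind_eq_zero.2 fun h => had (ha h),
        ind_eq_zero.2 fun h => hbd (hb h), ind_eq_zero.2 fun h => hcd (hc h)]; rfl
  · intro h
    have na := ind_nonneg Ξ a
    have nb := ind_nonneg Ξ b
    have nc := ind_nonneg Ξ c
    have nd := ind_nonneg Ξ d
    by_cases ha : a ∈ Ξ
    · rw [ind_eq_one.2 ha] at h
      refine ⟨a, ⟨ha, .inl rfl⟩, ?_⟩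
      rintro t ⟨h1, rfl | rfl | rfl | ⟨rfl, hq⟩⟩
      · rfl
      · rw [ind_eq_one.2 h1] at h; split_ifs at h <;> omega
      · rw [ind_eq_one.2 h1] at h; split_ifs at h <;> omega
      · rw [ind_eq_one.2 h1, if_pos hq] at h; omega
    by_cases hb : b ∈ Ξ
    · rw [ind_eq_one.2 hb] at h
      refine ⟨b, ⟨hb, .inr (.inl rfl)⟩, ?_⟩
      rintro t ⟨h1, rfl | rfl | rfl | ⟨rfl, hq⟩⟩
      · exact absurd h1 ha
      · rfl
      · rw [ind_eq_one.2 h1] at h; split_ifs at h <;> omega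
      · rw [ind_eq_one.2 h1, if_pos hq] at h; omega
    by_cases hc : c ∈ Ξ
    · rw [ind_eq_one.2 hc] at h
      refine ⟨c, ⟨hc, .inr (.inr (.inl rfl))⟩, ?_⟩
      rintro t ⟨h1, rfl | rfl | rfl | ⟨rfl, hq⟩⟩
      · exact absurd h1 ha
      · exact absurd h1 hb
      · rfl
      · rw [ind_eq_one.2 h1, if_pos hq] at h; omega
    · rw [ind_eq_zero.2 ha, ind_eq_zero.2 hb, ind_eq_zero.2 hc] at h
      split_ifs at h with hq
      · refine ⟨d, ⟨ind_eq_one.1 (by omega), .inr (.inr (.inr ⟨rfl, hq⟩))⟩, ?_⟩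
        rintro t ⟨h1, rfl | rfl | rfl | ⟨rfl, hq⟩⟩
        · exact absurd h1 ha
        · exact absurd h1 hb
        · exact absurd h1 hc
        · rfl
      · omega

/-- The conditions for a tiling of a hexagon in terms of indicators. -/
structure HexTiling (n : ℕ) (X Y : ℤ) (Z W : ℕ) (Ξ : Finset Tile) : Prop where
  inside : ∀ t ∈ Ξ, t.Valid n ∧ ∀ p ∈ t.verts n, InHex X Y Z W p
  up : ∀ i j, InHex X Y Z W (i, j) → InHex X Y Z W (i + 1, j) → InHex X Y Z W (i + 1, j - 1) →
    ind Ξ (.lozI i j) + ind Ξ (.lozII (i + 1) (j - 1)) + ind Ξ (.lozIII i (j - 1)) +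
      (if i + j = n then ind Ξ (.borderUp i) else 0) = 1
  down : ∀ i j, InHex X Y Z W (i, j) → InHex X Y Z W (i, j - 1) →
    InHex X Y Z W (i + 1, j - 1) →
    ind Ξ (.lozI (i - 1) j) + ind Ξ (.lozII (i + 1) (j - 2)) + ind Ξ (.lozIII i (j - 1)) +
      (if i + j = n then ind Ξ (.borderDown i) else 0) = 1
  border : ∀ i, InHex X Y Z W (i, n - i) → InHex X Y Z W (i + 1, n - i - 1) →
    ind Ξ (.borderUp i) + ind Ξ (.borderDown i) = 1

lemma isTiling_iff {n : ℕ} {v : ℤ × ℤ} {X Y : ℤ} {Z W : ℕ}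
    (hv : ∀ p, p ∈ (excavationHexagon n v).points ↔ InHex X Y Z W p) (Ξ : Finset Tile) :
    IsTiling n v Ξ ↔ HexTiling n X Y Z W Ξ := by
  have hU : ∀ i j : ℤ, (∃! t, t ∈ Ξ ∧
      ({(i, j), (i + 1, j), (i + 1, j - 1)} : Finset (ℤ × ℤ)) ⊆ t.verts n) ↔
      ind Ξ (.lozI i j) + ind Ξ (.lozII (i + 1) (j - 1)) + ind Ξ (.lozIII i (j - 1)) +
      (if i + j = n then ind Ξ (.borderUp i) else 0) = 1 := by
    intro i j
    simp only [up_subset_verts_iff]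
    exact existsUnique_iff_sum_ind (by simp) (by simp) (by simp) (by simp) (by simp) (by simp) _
  have hD : ∀ i j : ℤ, (∃! t, t ∈ Ξ ∧
      ({(i, j), (i, j - 1), (i + 1, j - 1)} : Finset (ℤ × ℤ)) ⊆ t.verts n) ↔
      ind Ξ (.lozI (i - 1) j) + ind Ξ (.lozII (i + 1) (j - 2)) + ind Ξ (.lozIII i (j - 1)) +
      (if i + j = n then ind Ξ (.borderDown i) else 0) = 1 := by
    intro i j
    simp only [down_subset_verts_iff]
    exact existsUnique_iff_sum_ind (by simp) (by simp) (by simp) (by simp) (by simp) (by simp) _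
  have hB : ∀ i : ℤ, ((Tile.borderUp i ∈ Ξ ∧ Tile.borderDown i ∉ Ξ) ∨
      (Tile.borderDown i ∈ Ξ ∧ Tile.borderUp i ∉ Ξ)) ↔
      ind Ξ (.borderUp i) + ind Ξ (.borderDown i) = 1 := by
    intro i
    unfold ind
    split_ifs <;> simp [*]
  unfold IsTiling
  simp only [hv, hB]
  constructor
  · rintro ⟨h1, h2, h3⟩
    refine ⟨h1, fun i j a b c => ?_, fun i j a b c => ?_, h3⟩
    · rw [← hU]
      exact h2 _ ⟨i, j, .inl rfl⟩ (by simp [a, b, c])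
    · rw [← hD]
      exact h2 _ ⟨i, j, .inr rfl⟩ (by simp [a, b, c])
  · rintro ⟨h1, h2, h3, h4⟩
    refine ⟨h1, ?_, h4⟩
    rintro s ⟨i, j, rfl | rfl⟩ hs
    · rw [hU]
      exact h2 i j (hs _ (by simp)) (hs _ (by simp)) (hs _ (by simp))
    · rw [hD]
      exact h3 i j (hs _ (by simp)) (hs _ (by simp)) (hs _ (by simp))

end HiveOct

/-! ### From tilings to row counts -/

namespace HiveOct

open Finset

/-- The row counts `f`, `g` are those of the set `Ξ` of tiles. -/
structure Matches (X Y : ℤ) (Z W : ℕ) (Ξ : Finset Tile) (f g : ℕ → ℕ → ℤ) : Prop where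
  lozI_grow : ∀ a < Z, ∀ k ≤ a + W,
    ind Ξ (.lozI (X + k - 1) (Y + a + W - k + 1)) = f (a + 1) k - f a k
  lozII_grow : ∀ a < Z, ∀ k ≤ a + W,
    ind Ξ (.lozII (X + k + 1) (Y + a + W - k - 1)) = 1 - f (a + 1) (k + 1) + f a k
  lozIII_grow : ∀ a < Z, ∀ k < a + W,
    ind Ξ (.lozIII (X + k) (Y + a + W - k - 1)) = f a (k + 1) - f a k
  borderDown : ∀ k < Z + W, ind Ξ (.borderDown (X + k)) = f Z (k + 1) - f Z k
  lozII_shrink : ∀ c < W, ∀ k ≤ Z + c,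
    ind Ξ (.lozII (X + k + W - c) (Y + Z + W - k - 1)) = g (c + 1) k - g c k
  lozI_shrink : ∀ c < W, ∀ k ≤ Z + c,
    ind Ξ (.lozI (X + k + W - c - 1) (Y + Z + W - k)) = 1 - g (c + 1) (k + 1) + g c k
  lozIII_shrink : ∀ c < W, ∀ k < Z + c,
    ind Ξ (.lozIII (X + k + W - c) (Y + Z + W - k - 1)) = g c (k + 1) - g c k
  borderUp : ∀ k < Z + W, ind Ξ (.borderUp (X + k)) = g W (k + 1) - g W k

/-- `A` and `M` mark the crossed edges of two consecutive rows, `V` and `H` the crossed edges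
between them. `h1` and `h2` cover the triangles on the longer and the shorter row. Going along the
strip, they determine `V` and `H` from the partial sums, and non-negativity of all bits is then
interlacing. -/
lemma interlace_of_bits {N : ℕ} {A M V H : ℕ → ℤ} (hA : ∀ k < N, 0 ≤ A k)
    (hM : ∀ k ≤ N, 0 ≤ M k) (hV : ∀ k ≤ N, 0 ≤ V k) (hH : ∀ k ≤ N, 0 ≤ H k) (hV0 : V 0 = 0)
    (hHN : H N = 0) (h1 : ∀ k ≤ N, M k + V k + H k = 1)
    (h2 : ∀ k < N, A k + H k + V (k + 1) = 1) {α μ : ℕ → ℤ} (hα : ∀ k, α k = ∑ l ∈ range k, A l)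
    (hμ : ∀ k, μ k = ∑ l ∈ range k, M l) :
    (∀ k ≤ N, V k = μ k - α k) ∧ (∀ k ≤ N, H k = 1 - μ (k + 1) + α k) ∧ Interlace N α μ := by
  have eα : ∀ k, α (k + 1) = α k + A k := fun k => by rw [hα, hα, sum_range_succ]
  have eμ : ∀ k, μ (k + 1) = μ k + M k := fun k => by rw [hμ, hμ, sum_range_succ]
  have e0 : α 0 = 0 ∧ μ 0 = 0 := by simp [hα, hμ]
  have v : ∀ k ≤ N, V k = μ k - α k := by
    intro k hk
    induction k with
    | zero => omega
    | succ k ih =>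
      have := ih (by omega)
      have := h1 k (by omega)
      have := h2 k (by omega)
      have := eα k
      have := eμ k
      omega
  have h : ∀ k ≤ N, H k = 1 - μ (k + 1) + α k := by
    intro k hk
    have := v k hk
    have := h1 k hk
    have := eμ k
    omega
  refine ⟨v, h, ⟨by omega, ?_, fun k hk => ?_, fun k hk => ?_, fun k hk => ?_, fun k hk => ?_⟩⟩
  · have := h N le_rfl
    omega
  · have := eα k
    have := hA k hk
    omega
  · have := v k hk
    have := hV k hk
    omega
  · have := eμ k
    have := hM k hk
    omega
  · have := h k hk
    have := hH k hk
    omega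

variable {n : ℕ} {X Y : ℤ} {Z W : ℕ} {Ξ : Finset Tile}

lemma HexTiling.ind_eq_zero_of_not_inHex (h : HexTiling n X Y Z W Ξ) {t : Tile} {p : ℤ × ℤ}
    (hp : p ∈ t.verts n) (hp' : ¬ InHex X Y Z W p) : ind Ξ t = 0 :=
  ind_eq_zero.2 fun ht => hp' ((h.inside t ht).2 p hp)

/-- The short diagonal of such a lozenge lies on the antidiagonal, which a valid tile may not cross.
-/
lemma HexTiling.ind_lozIII_border (h : HexTiling n X Y Z W Ξ) {i j : ℤ} (hij : i + j + 1 = n) :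
    ind Ξ (.lozIII i j) = 0 := by
  refine ind_eq_zero.2 fun ht => ?_
  rcases (h.inside _ ht).1 with h1 | h1
  · have := (h1 (i, j) (by simp [Tile.verts])).2.2
    dsimp only at this
    omega
  · have := (h1 (i + 1, j + 1) (by simp [Tile.verts])).2.2
    dsimp only at this
    omega

lemma HexTiling.exists_rowCounts (h : HexTiling n X Y Z W Ξ) (hn : (n : ℤ) = X + Y + Z + W) :
    ∃ f g, RowCounts Z W f g ∧ Matches X Y Z W Ξ f g := by
  -- An edge of a row is crossed by a lozenge of type III, except on the border row, where a border
  -- triangle takes its place.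
  set A : ℕ → ℕ → ℤ := fun a k => if a < Z then ind Ξ (.lozIII (X + k) (Y + a + W - k - 1)) else
    ind Ξ (.borderDown (X + k)) with hA
  set B : ℕ → ℕ → ℤ := fun c k => if c < W then
    ind Ξ (.lozIII (X + k + W - c) (Y + Z + W - k - 1)) else ind Ξ (.borderUp (X + k)) with hB
  have hA0 : ∀ a k, 0 ≤ A a k := fun a k => by
    simp only [hA]; split_ifs <;> exact ind_nonneg _ _
  have hB0 : ∀ c k, 0 ≤ B c k := fun c k => by
    simp only [hB]; split_ifs <;> exact ind_nonneg _ _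
  have grow : ∀ a < Z, _ := fun a ha => interlace_of_bits (N := a + W) (A := A a) (M := A (a + 1))
    (V := fun k => ind Ξ (.lozI (X + k - 1) (Y + a + W - k + 1)))
    (H := fun k => ind Ξ (.lozII (X + k + 1) (Y + a + W - k - 1)))
    (fun k _ => hA0 _ _) (fun k _ => hA0 _ _) (fun k _ => ind_nonneg _ _)
    (fun k _ => ind_nonneg _ _)
    -- The extreme bits `V 0` and `H N` vanish because those lozenges would stick out of the sides
    -- of the hexagon.
    (h.ind_eq_zero_of_not_inHex (p := (X + (0 : ℕ) - 1, Y + a + W - (0 : ℕ) + 1))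
      (by simp [Tile.verts]) (by simp [InHex]))
    (h.ind_eq_zero_of_not_inHex
      (p := (X + (a + W : ℕ) + 1, Y + a + W - (a + W : ℕ) - 1))
      (by simp [Tile.verts]) (by simp only [InHex]; push_cast; omega))
    (fun k hk => by
      have := h.down (X + k) (Y + (a + 1) + W - k) (by simp only [InHex]; omega)
        (by simp only [InHex]; omega) (by simp only [InHex]; omega)
      rw [show Y + ((a : ℤ) + 1) + W - k = Y + a + W - k + 1 by ring,
        show Y + (a : ℤ) + W - k + 1 - 2 = Y + a + W - k - 1 by ring] at this
      simp only [hA]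
      by_cases hZ : a + 1 < Z
      · rw [if_neg (by omega)] at this
        rw [if_pos hZ, show Y + ((a + 1 : ℕ) : ℤ) + W - k - 1 = Y + a + W - k + 1 - 1 by
          push_cast; ring]
        omega
      · rw [if_pos (by omega), h.ind_lozIII_border (i := X + k) (by omega)] at this
        rw [if_neg hZ]
        omega)
    (fun k hk => by
      have := h.up (X + k) (Y + a + W - k) (by simp only [InHex]; omega)
        (by simp only [InHex]; omega) (by simp only [InHex]; omega)
      rw [if_neg (by omega)] at this
      simp only [hA, if_pos ha]
      rw [show X + ((k + 1 : ℕ) : ℤ) - 1 = X + k by push_cast; ring,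
        show Y + (a : ℤ) + W - (k + 1 : ℕ) + 1 = Y + a + W - k by push_cast; ring]
      omega)
    (α := fun k => ∑ l ∈ range k, A a l) (μ := fun k => ∑ l ∈ range k, A (a + 1) l)
    (fun _ => rfl) (fun _ => rfl)
  have shrink : ∀ c < W, _ := fun c hc => interlace_of_bits (N := Z + c) (A := B c)
    (M := B (c + 1))
    (V := fun k => ind Ξ (.lozII (X + k + W - c) (Y + Z + W - k - 1)))
    (H := fun k => ind Ξ (.lozI (X + k + W - c - 1) (Y + Z + W - k)))
    (fun k _ => hB0 _ _) (fun k _ => hB0 _ _) (fun k _ => ind_nonneg _ _)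
    (fun k _ => ind_nonneg _ _)
    (h.ind_eq_zero_of_not_inHex
      (p := (X + (0 : ℕ) + W - c - 1, Y + Z + W - (0 : ℕ) - 1 + 2))
      (by simp [Tile.verts]) (by simp only [InHex]; push_cast; omega))
    (h.ind_eq_zero_of_not_inHex
      (p := (X + (Z + c : ℕ) + W - c - 1 + 2, Y + Z + W - (Z + c : ℕ) - 1))
      (by simp [Tile.verts]) (by simp only [InHex]; push_cast; omega))
    (fun k hk => by
      have := h.up (X + k + W - c - 1) (Y + Z + W - k) (by simp only [InHex]; omega)
        (by simp only [InHex]; omega) (by simp only [InHex]; omega)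
      rw [show X + (k : ℤ) + W - c - 1 + 1 = X + k + W - c by ring] at this
      simp only [hB]
      by_cases hZ : c + 1 < W
      · rw [if_neg (by omega)] at this
        rw [if_pos hZ, show X + (k : ℤ) + W - (c + 1 : ℕ) = X + k + W - c - 1 by
          push_cast; ring]
        omega
      · rw [if_pos (by omega), h.ind_lozIII_border (i := X + k + W - c - 1) (by omega),
          show X + (k : ℤ) + W - c - 1 = X + k by omega] at this
        rw [if_neg hZ, show X + (k : ℤ) + W - c - 1 = X + k by omega]
        omega)
    (fun k hk => by
      have := h.down (X + k + W - c) (Y + Z + W - k) (by simp only [InHex]; omega)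
        (by simp only [InHex]; omega) (by simp only [InHex]; omega)
      rw [if_neg (by omega)] at this
      simp only [hB, if_pos hc]
      rw [show X + ((k + 1 : ℕ) : ℤ) + W - c = X + k + W - c + 1 by push_cast; ring,
        show Y + (Z : ℤ) + W - (k + 1 : ℕ) - 1 = Y + Z + W - k - 2 by push_cast; ring]
      omega)
    (α := fun k => ∑ l ∈ range k, B c l) (μ := fun k => ∑ l ∈ range k, B (c + 1) l)
    (fun _ => rfl) (fun _ => rfl)
  refine ⟨fun a k => ∑ l ∈ range k, A a l, fun c k => ∑ l ∈ range k, B c l,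
    ⟨fun k hk => ?_, fun a ha => (grow a ha).2.2, fun k hk => ?_, fun c hc => (shrink c hc).2.2⟩,
    ⟨fun a ha => (grow a ha).1, fun a ha => (grow a ha).2.1, fun a ha k hk => ?_, fun k hk => ?_,
      fun c hc => (shrink c hc).1, fun c hc => (shrink c hc).2.1, fun c hc k hk => ?_,
      fun k hk => ?_⟩⟩
  -- A tile crossing an edge of the shortest lower row would reach outside the hexagon.
  · refine sum_eq_zero fun l hl => ?_
    rw [mem_range] at hl
    simp only [hA]
    split_ifs with hZ
    · exact h.ind_eq_zero_of_not_inHex (p := (X + l, Y + (0 : ℕ) + W - l - 1))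
        (by simp [Tile.verts]) (by simp only [InHex]; push_cast; omega)
    · exact h.ind_eq_zero_of_not_inHex (p := (X + l, n - (X + l) - 1))
        (by simp [Tile.verts]) (by simp only [InHex]; omega)
  · rw [← sum_add_distrib, sum_congr rfl (g := fun _ => (1 : ℤ)) fun l hl => ?_]
    · simp
    rw [mem_range] at hl
    simp only [hA, hB, lt_irrefl, if_false]
    have := h.border (X + l) (by simp only [InHex]; omega) (by simp only [InHex]; omega)
    omega
  · rw [sum_range_succ]; simp only [hA, if_pos ha]; ring
  · rw [sum_range_succ]; simp only [hA, lt_irrefl, if_false]; ring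
  · rw [sum_range_succ]; simp only [hB, if_pos hc]; ring
  · rw [sum_range_succ]; simp only [hB, lt_irrefl, if_false]; ring

end HiveOct

/-! ### From row counts to tilings -/

namespace HiveOct

open Finset

/-- The tiles of the tiling with row counts `f` and `g`. -/
inductive IsTileOf (X Y : ℤ) (Z W : ℕ) (f g : ℕ → ℕ → ℤ) : Tile → Prop
  | lozI_grow (a k : ℕ) (ha : a < Z) (hk : k ≤ a + W) (h : f (a + 1) k - f a k = 1) :
    IsTileOf X Y Z W f g (.lozI (X + k - 1) (Y + a + W - k + 1))
  | lozII_grow (a k : ℕ) (ha : a < Z) (hk : k ≤ a + W) (h : 1 - f (a + 1) (k + 1) + f a k = 1) :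
    IsTileOf X Y Z W f g (.lozII (X + k + 1) (Y + a + W - k - 1))
  | lozIII_grow (a k : ℕ) (ha : a < Z) (hk : k < a + W) (h : f a (k + 1) - f a k = 1) :
    IsTileOf X Y Z W f g (.lozIII (X + k) (Y + a + W - k - 1))
  | borderDown (k : ℕ) (hk : k < Z + W) (h : f Z (k + 1) - f Z k = 1) :
    IsTileOf X Y Z W f g (.borderDown (X + k))
  | lozII_shrink (c k : ℕ) (hc : c < W) (hk : k ≤ Z + c) (h : g (c + 1) k - g c k = 1) :
    IsTileOf X Y Z W f g (.lozII (X + k + W - c) (Y + Z + W - k - 1))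
  | lozI_shrink (c k : ℕ) (hc : c < W) (hk : k ≤ Z + c) (h : 1 - g (c + 1) (k + 1) + g c k = 1) :
    IsTileOf X Y Z W f g (.lozI (X + k + W - c - 1) (Y + Z + W - k))
  | lozIII_shrink (c k : ℕ) (hc : c < W) (hk : k < Z + c) (h : g c (k + 1) - g c k = 1) :
    IsTileOf X Y Z W f g (.lozIII (X + k + W - c) (Y + Z + W - k - 1))
  | borderUp (k : ℕ) (hk : k < Z + W) (h : g W (k + 1) - g W k = 1) :
    IsTileOf X Y Z W f g (.borderUp (X + k))

variable {n : ℕ} {X Y : ℤ} {Z W : ℕ} {f g : ℕ → ℕ → ℤ}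

lemma exists_finset_isTileOf (X Y : ℤ) (Z W : ℕ) (f g : ℕ → ℕ → ℤ) :
    ∃ Ξ : Finset Tile, ∀ t, t ∈ Ξ ↔ IsTileOf X Y Z W f g t := by
  have hfin : {t | IsTileOf X Y Z W f g t}.Finite := by
    let J : Finset ℤ := Icc (X - Z - W - 2) (X + Z + W + 2)
    let K : Finset ℤ := Icc (Y - Z - W - 2) (Y + Z + W + 2)
    have hs : ((J ×ˢ K : Finset (ℤ × ℤ)) : Set (ℤ × ℤ)).Finite := Finset.finite_toSet _
    refine ((((hs.image fun p => Tile.lozI p.1 p.2).union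
      (hs.image fun p => Tile.lozII p.1 p.2)).union
      (hs.image fun p => Tile.lozIII p.1 p.2)).union
      ((J.finite_toSet.image Tile.borderUp).union
        (J.finite_toSet.image Tile.borderDown))).subset ?_
    rintro t (⟨a, k, ha, hk, h⟩ | ⟨a, k, ha, hk, h⟩ | ⟨a, k, ha, hk, h⟩ | ⟨k, hk, h⟩ |
      ⟨c, k, hc, hk, h⟩ | ⟨c, k, hc, hk, h⟩ | ⟨c, k, hc, hk, h⟩ | ⟨k, hk, h⟩) <;>
    · simp only [J, K, coe_product, coe_Icc, Set.mem_union, Set.mem_image, Set.mem_prod,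
        Set.mem_Icc, Prod.exists, Tile.lozI.injEq, Tile.lozII.injEq, Tile.lozIII.injEq,
        Tile.borderUp.injEq, Tile.borderDown.injEq, reduceCtorEq, and_false, exists_false,
        or_false, false_or, exists_eq_right_right, exists_eq_right]
      omega
  exact ⟨hfin.toFinset, by simp⟩

lemma ind_eq_of_iff {Ξ : Finset Tile} {t : Tile} {z : ℤ} (h0 : 0 ≤ z) (h1 : z ≤ 1)
    (h : t ∈ Ξ ↔ z = 1) : ind Ξ t = z := by
  unfold ind
  split_ifs with ht <;> rw [h] at ht <;> omega

lemma Interlace.steps {N : ℕ} {α μ : ℕ → ℤ} (h : Interlace N α μ) {k : ℕ} (hk : k ≤ N) :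
    0 ≤ μ k - α k ∧ μ k - α k ≤ 1 ∧ 0 ≤ μ (k + 1) - μ k ∧ μ (k + 1) - μ k ≤ 1 ∧
      0 ≤ 1 - μ (k + 1) + α k ∧ 1 - μ (k + 1) + α k ≤ 1 := by
  have h1 := h.le k hk
  have h2 := h.mono' k hk
  have h3 := h.le_add_one k hk
  omega

lemma Interlace.steps_left {N : ℕ} {α μ : ℕ → ℤ} (h : Interlace N α μ) {k : ℕ} (hk : k < N) :
    0 ≤ α (k + 1) - α k ∧ α (k + 1) - α k ≤ 1 := by
  have h1 := h.le (k + 1) hk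
  have h2 := h.mono k hk
  have h3 := h.le_add_one k hk.le
  omega

/-- `RowCounts` says nothing directly about the last row above the border; this follows by counting.
Each strip adds one to the total of a row, so the totals on the border row are `Z` from below and `g
0 Z + W` from above, while the border condition makes them add up to `Z + W`. -/
lemma RowCounts.shrink_zero (h : RowCounts Z W f g) (hW : 0 < W) : ∀ k ≤ Z, g 0 k = 0 := by
  have hf : ∀ a ≤ Z, f a 0 = 0 ∧ f a (a + W) = a := by
    intro a ha
    induction a with
    | zero => exact ⟨h.zero 0 (by omega), by simpa using h.zero W le_rfl⟩
    | succ a ih =>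
      have h1 := ih (by omega)
      have h2 := h.grow a (by omega)
      refine ⟨by rw [h2.zero, h1.1], ?_⟩
      rw [show a + 1 + W = a + W + 1 by ring, h2.last, h1.2]
      push_cast; ring
  have hg : ∀ c ≤ W, g c 0 = g 0 0 ∧ g c (Z + c) = g 0 Z + c := by
    intro c hc
    induction c with
    | zero => simp
    | succ c ih =>
      have h1 := ih (by omega)
      have h2 := h.shrink c (by omega)
      refine ⟨by rw [h2.zero, h1.1], ?_⟩
      rw [← add_assoc, h2.last, h1.2]
      push_cast; ring
  have hmono : ∀ k l, k ≤ l → l ≤ Z → g 0 k ≤ g 0 l := by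
    intro k l hkl hl
    induction l, hkl using Nat.le_induction with
    | base => exact le_rfl
    | succ l hkl ih => exact (ih (by omega)).trans ((h.shrink 0 hW).mono l (by omega))
  intro k hk
  have h1 := hf Z le_rfl
  have h2 := hg W le_rfl
  have h3 := h.border 0 (by omega)
  have h4 := h.border (Z + W) le_rfl
  have h5 := hmono 0 k (by omega) hk
  have h6 := hmono k Z hk le_rfl
  push_cast at *
  omega

lemma isTileOf_lozI_iff {i j : ℤ} : IsTileOf X Y Z W f g (.lozI i j) ↔
    (∃ a k : ℕ, a < Z ∧ k ≤ a + W ∧ f (a + 1) k - f a k = 1 ∧ i = X + k - 1 ∧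
      j = Y + a + W - k + 1) ∨
    (∃ c k : ℕ, c < W ∧ k ≤ Z + c ∧ 1 - g (c + 1) (k + 1) + g c k = 1 ∧
      i = X + k + W - c - 1 ∧ j = Y + Z + W - k) := by
  constructor
  · intro h
    generalize ht : Tile.lozI i j = t at h
    cases h <;> simp only [Tile.lozI.injEq, reduceCtorEq] at ht
    · exact .inl ⟨_, _, ‹_›, ‹_›, ‹_›, ht.1, ht.2⟩
    · exact .inr ⟨_, _, ‹_›, ‹_›, ‹_›, ht.1, ht.2⟩
  · rintro (⟨a, k, h1, h2, h3, rfl, rfl⟩ | ⟨a, k, h1, h2, h3, rfl, rfl⟩)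
    · exact .lozI_grow a k h1 h2 h3
    · exact .lozI_shrink a k h1 h2 h3

lemma isTileOf_lozII_iff {i j : ℤ} : IsTileOf X Y Z W f g (.lozII i j) ↔
    (∃ a k : ℕ, a < Z ∧ k ≤ a + W ∧ 1 - f (a + 1) (k + 1) + f a k = 1 ∧ i = X + k + 1 ∧
      j = Y + a + W - k - 1) ∨
    (∃ c k : ℕ, c < W ∧ k ≤ Z + c ∧ g (c + 1) k - g c k = 1 ∧
      i = X + k + W - c ∧ j = Y + Z + W - k - 1) := by
  constructor
  · intro h
    generalize ht : Tile.lozII i j = t at h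
    cases h <;> simp only [Tile.lozII.injEq, reduceCtorEq] at ht
    · exact .inl ⟨_, _, ‹_›, ‹_›, ‹_›, ht.1, ht.2⟩
    · exact .inr ⟨_, _, ‹_›, ‹_›, ‹_›, ht.1, ht.2⟩
  · rintro (⟨a, k, h1, h2, h3, rfl, rfl⟩ | ⟨a, k, h1, h2, h3, rfl, rfl⟩)
    · exact .lozII_grow a k h1 h2 h3
    · exact .lozII_shrink a k h1 h2 h3

lemma isTileOf_lozIII_iff {i j : ℤ} : IsTileOf X Y Z W f g (.lozIII i j) ↔
    (∃ a k : ℕ, a < Z ∧ k < a + W ∧ f a (k + 1) - f a k = 1 ∧ i = X + k ∧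
      j = Y + a + W - k - 1) ∨
    (∃ c k : ℕ, c < W ∧ k < Z + c ∧ g c (k + 1) - g c k = 1 ∧
      i = X + k + W - c ∧ j = Y + Z + W - k - 1) := by
  constructor
  · intro h
    generalize ht : Tile.lozIII i j = t at h
    cases h <;> simp only [Tile.lozIII.injEq, reduceCtorEq] at ht
    · exact .inl ⟨_, _, ‹_›, ‹_›, ‹_›, ht.1, ht.2⟩
    · exact .inr ⟨_, _, ‹_›, ‹_›, ‹_›, ht.1, ht.2⟩
  · rintro (⟨a, k, h1, h2, h3, rfl, rfl⟩ | ⟨a, k, h1, h2, h3, rfl, rfl⟩)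
    · exact .lozIII_grow a k h1 h2 h3
    · exact .lozIII_shrink a k h1 h2 h3

lemma isTileOf_borderUp_iff {i : ℤ} : IsTileOf X Y Z W f g (.borderUp i) ↔
    ∃ k : ℕ, k < Z + W ∧ g W (k + 1) - g W k = 1 ∧ i = X + k := by
  constructor
  · intro h
    generalize ht : Tile.borderUp i = t at h
    cases h <;> simp only [Tile.borderUp.injEq, reduceCtorEq] at ht
    exact ⟨_, ‹_›, ‹_›, ht⟩
  · rintro ⟨k, h1, h2, rfl⟩
    exact .borderUp k h1 h2

lemma isTileOf_borderDown_iff {i : ℤ} : IsTileOf X Y Z W f g (.borderDown i) ↔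
    ∃ k : ℕ, k < Z + W ∧ f Z (k + 1) - f Z k = 1 ∧ i = X + k := by
  constructor
  · intro h
    generalize ht : Tile.borderDown i = t at h
    cases h <;> simp only [Tile.borderDown.injEq, reduceCtorEq] at ht
    exact ⟨_, ‹_›, ‹_›, ht⟩
  · rintro ⟨k, h1, h2, rfl⟩
    exact .borderDown k h1 h2

/-- Interlacing makes all relevant differences 0 or 1, and the position of a tile determines its
indices and its side of the border. So membership in `Ξ` reads off one difference. -/
lemma RowCounts.matches (h : RowCounts Z W f g) (hZ : 0 < Z) (hW : 0 < W) {Ξ : Finset Tile}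
    (hΞ : ∀ t, t ∈ Ξ ↔ IsTileOf X Y Z W f g t) : Matches X Y Z W Ξ f g := by
  refine ⟨fun a ha k hk => ?_, fun a ha k hk => ?_, fun a ha k hk => ?_, fun k hk => ?_,
    fun c hc k hk => ?_, fun c hc k hk => ?_, fun c hc k hk => ?_, fun k hk => ?_⟩
  · have := (h.grow a ha).steps hk
    refine ind_eq_of_iff (by omega) (by omega) ?_
    rw [hΞ, isTileOf_lozI_iff]
    constructor
    · rintro (⟨a', k', h1, h2, h3, h4, h5⟩ | ⟨a', k', h1, h2, h3, h4, h5⟩)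
      · obtain rfl : k = k' := by omega
        obtain rfl : a = a' := by omega
        exact h3
      · omega
    · exact fun h' => .inl ⟨a, k, ha, hk, h', rfl, rfl⟩
  · have := (h.grow a ha).steps hk
    refine ind_eq_of_iff (by omega) (by omega) ?_
    rw [hΞ, isTileOf_lozII_iff]
    constructor
    · rintro (⟨a', k', h1, h2, h3, h4, h5⟩ | ⟨a', k', h1, h2, h3, h4, h5⟩)
      · obtain rfl : k = k' := by omega
        obtain rfl : a = a' := by omega
        exact h3
      · omega
    · exact fun h' => .inl ⟨a, k, ha, hk, h', rfl, rfl⟩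
  · have := (h.grow a ha).steps_left hk
    refine ind_eq_of_iff (by omega) (by omega) ?_
    rw [hΞ, isTileOf_lozIII_iff]
    constructor
    · rintro (⟨a', k', h1, h2, h3, h4, h5⟩ | ⟨a', k', h1, h2, h3, h4, h5⟩)
      · obtain rfl : k = k' := by omega
        obtain rfl : a = a' := by omega
        exact h3
      · omega
    · exact fun h' => .inl ⟨a, k, ha, hk, h', rfl, rfl⟩
  · obtain ⟨a, rfl⟩ : ∃ a, Z = a + 1 := ⟨Z - 1, by omega⟩
    have := (h.grow a (by omega)).steps (k := k) (by omega)
    refine ind_eq_of_iff (by omega) (by omega) ?_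
    rw [hΞ, isTileOf_borderDown_iff]
    constructor
    · rintro ⟨k', h1, h2, h3⟩
      obtain rfl : k = k' := by omega
      exact h2
    · exact fun h' => ⟨k, hk, h', rfl⟩
  · have := (h.shrink c hc).steps hk
    refine ind_eq_of_iff (by omega) (by omega) ?_
    rw [hΞ, isTileOf_lozII_iff]
    constructor
    · rintro (⟨a', k', h1, h2, h3, h4, h5⟩ | ⟨a', k', h1, h2, h3, h4, h5⟩)
      · omega
      · obtain rfl : k = k' := by omega
        obtain rfl : c = a' := by omega
        exact h3
    · exact fun h' => .inr ⟨c, k, hc, hk, h', rfl, rfl⟩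
  · have := (h.shrink c hc).steps hk
    refine ind_eq_of_iff (by omega) (by omega) ?_
    rw [hΞ, isTileOf_lozI_iff]
    constructor
    · rintro (⟨a', k', h1, h2, h3, h4, h5⟩ | ⟨a', k', h1, h2, h3, h4, h5⟩)
      · omega
      · obtain rfl : k = k' := by omega
        obtain rfl : c = a' := by omega
        exact h3
    · exact fun h' => .inr ⟨c, k, hc, hk, h', rfl, rfl⟩
  · have := (h.shrink c hc).steps_left hk
    refine ind_eq_of_iff (by omega) (by omega) ?_
    rw [hΞ, isTileOf_lozIII_iff]
    constructor
    · rintro (⟨a', k', h1, h2, h3, h4, h5⟩ | ⟨a', k', h1, h2, h3, h4, h5⟩)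
      · omega
      · obtain rfl : k = k' := by omega
        obtain rfl : c = a' := by omega
        exact h3
    · exact fun h' => .inr ⟨c, k, hc, hk, h', rfl, rfl⟩
  · obtain ⟨c, rfl⟩ : ∃ c, W = c + 1 := ⟨W - 1, by omega⟩
    have := (h.shrink c (by omega)).steps (k := k) (by omega)
    refine ind_eq_of_iff (by omega) (by omega) ?_
    rw [hΞ, isTileOf_borderUp_iff]
    constructor
    · rintro ⟨k', h1, h2, h3⟩
      obtain rfl : k = k' := by omega
      exact h2
    · exact fun h' => ⟨k, hk, h', rfl⟩

/-- Only the extreme tiles of a strip or of an end row could stick out; the end conditions of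
`Interlace`, `h.zero` and `RowCounts.shrink_zero` make their differences vanish. -/
lemma IsTileOf.inside (h : RowCounts Z W f g) (hW : 0 < W) (hX : 0 ≤ X)
    (hY : 0 ≤ Y) (hn : (n : ℤ) = X + Y + Z + W) {t : Tile} (ht : IsTileOf X Y Z W f g t) :
    t.Valid n ∧ ∀ p ∈ t.verts n, InHex X Y Z W p := by
  rcases ht with ⟨a, k, ha, hk, h'⟩ | ⟨a, k, ha, hk, h'⟩ | ⟨a, k, ha, hk, h'⟩ | ⟨k, hk, h'⟩ |
      ⟨c, k, hc, hk, h'⟩ | ⟨c, k, hc, hk, h'⟩ | ⟨c, k, hc, hk, h'⟩ | ⟨k, hk, h'⟩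
  · have hk0 : k ≠ 0 := by
      rintro rfl
      have := (h.grow a ha).zero
      omega
    refine ⟨.inr ?_, ?_⟩ <;>
    · simp only [Tile.verts, mem_insert, mem_singleton, forall_eq_or_imp, forall_eq, InHex]
      omega
  · have hk0 : k ≠ a + W := by
      rintro rfl
      have := (h.grow a ha).last
      omega
    refine ⟨.inr ?_, ?_⟩ <;>
    · simp only [Tile.verts, mem_insert, mem_singleton, forall_eq_or_imp, forall_eq, InHex]
      omega
  · have ha0 : a ≠ 0 := by
      rintro rfl
      rw [h.zero k (by omega), h.zero (k + 1) (by omega)] at h'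
      omega
    refine ⟨.inr ?_, ?_⟩ <;>
    · simp only [Tile.verts, mem_insert, mem_singleton, forall_eq_or_imp, forall_eq, InHex]
      omega
  · have hZ0 : Z ≠ 0 := by
      rintro rfl
      rw [h.zero k (by omega), h.zero (k + 1) (by omega)] at h'
      omega
    refine ⟨.inr ?_, ?_⟩ <;>
    · simp only [Tile.verts, mem_insert, mem_singleton, forall_eq_or_imp, forall_eq, InHex]
      omega
  · have hk0 : k ≠ 0 := by
      rintro rfl
      have := (h.shrink c hc).zero
      omega
    refine ⟨.inl ?_, ?_⟩ <;>
    · simp only [Tile.verts, mem_insert, mem_singleton, forall_eq_or_imp, forall_eq, InHex]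
      omega
  · have hk0 : k ≠ Z + c := by
      rintro rfl
      have := (h.shrink c hc).last
      omega
    refine ⟨.inl ?_, ?_⟩ <;>
    · simp only [Tile.verts, mem_insert, mem_singleton, forall_eq_or_imp, forall_eq, InHex]
      omega
  · have hc0 : c ≠ 0 := by
      rintro rfl
      rw [h.shrink_zero hW k (by omega), h.shrink_zero hW (k + 1) (by omega)] at h'
      omega
    refine ⟨.inl ?_, ?_⟩ <;>
    · simp only [Tile.verts, mem_insert, mem_singleton, forall_eq_or_imp, forall_eq, InHex]
      omega
  · refine ⟨.inl ?_, ?_⟩ <;>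
    · simp only [Tile.verts, mem_insert, mem_singleton, forall_eq_or_imp, forall_eq, InHex]
      omega

/-- With indicators given by differences of counts, the covering equation of each triangle is an
identity in the counts. -/
lemma RowCounts.exists_hexTiling (h : RowCounts Z W f g) (hZ : 0 < Z) (hW : 0 < W) (hX : 0 ≤ X)
    (hY : 0 ≤ Y) (hn : (n : ℤ) = X + Y + Z + W) :
    ∃ Ξ, HexTiling n X Y Z W Ξ ∧ Matches X Y Z W Ξ f g := by
  obtain ⟨Ξ, hΞ⟩ := exists_finset_isTileOf X Y Z W f g
  have hm := h.matches hZ hW hΞ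
  have hborder : ∀ i j : ℤ, i + j + 1 = n → ind Ξ (.lozIII i j) = 0 := by
    intro i j hij
    rw [ind_eq_zero, hΞ, isTileOf_lozIII_iff]
    rintro (⟨a', k', h1, h2, h3, h4, h5⟩ | ⟨a', k', h1, h2, h3, h4, h5⟩) <;> omega
  refine ⟨Ξ, ⟨fun t ht => ((hΞ t).1 ht).inside h hW hX hY hn, fun i j p1 p2 p3 => ?_,
    fun i j p1 p2 p3 => ?_, fun i p1 p2 => ?_⟩, hm⟩
  · simp only [InHex] at p1 p2 p3
    by_cases hij : i + j < n
    · obtain ⟨k, hk⟩ : ∃ k : ℕ, i = X + k := ⟨(i - X).toNat, by omega⟩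
      obtain ⟨a, ha⟩ : ∃ a : ℕ, i + j = X + Y + W + a := ⟨(i + j - X - Y - W).toNat, by omega⟩
      have e1 := hm.lozI_grow a (by omega) (k + 1) (by omega)
      have e2 := hm.lozII_grow a (by omega) k (by omega)
      have e3 := hm.lozIII_grow a (by omega) k (by omega)
      rw [show X + ((k + 1 : ℕ) : ℤ) - 1 = i by push_cast; omega,
        show Y + (a : ℤ) + W - (k + 1 : ℕ) + 1 = j by push_cast; omega] at e1
      rw [show X + (k : ℤ) + 1 = i + 1 by omega, show Y + (a : ℤ) + W - k - 1 = j - 1 by omega]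
        at e2
      rw [show X + (k : ℤ) = i by omega, show Y + (a : ℤ) + W - k - 1 = j - 1 by omega] at e3
      rw [e1, e2, e3, if_neg (by omega)]
      ring
    · obtain ⟨k, hk⟩ : ∃ k : ℕ, j = Y + Z + W - k := ⟨(Y + Z + W - j).toNat, by omega⟩
      obtain ⟨c, hc⟩ : ∃ c : ℕ, i + j = X + Y + Z + 2 * W - c - 1 :=
        ⟨(X + Y + Z + 2 * W - 1 - i - j).toNat, by omega⟩
      have e1 := hm.lozI_shrink c (by omega) k (by omega)
      have e2 := hm.lozII_shrink c (by omega) k (by omega)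
      rw [show X + (k : ℤ) + W - c - 1 = i by omega, ← hk] at e1
      rw [show X + (k : ℤ) + W - c = i + 1 by omega, ← hk] at e2
      rw [e1, e2]
      by_cases hcW : c + 1 < W
      · have e3 := hm.lozIII_shrink (c + 1) hcW k (by omega)
        rw [show X + (k : ℤ) + W - (c + 1 : ℕ) = i by push_cast; omega, ← hk] at e3
        rw [e3, if_neg (by omega)]
        ring
      · have e3 := hm.borderUp k (by omega)
        rw [show X + (k : ℤ) = i by omega] at e3
        rw [hborder i (j - 1) (by omega), e3, if_pos (by omega),
          show c + 1 = W by omega]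
        ring
  · simp only [InHex] at p1 p2 p3
    by_cases hij : i + j ≤ n
    · obtain ⟨k, hk⟩ : ∃ k : ℕ, i = X + k := ⟨(i - X).toNat, by omega⟩
      obtain ⟨a, ha⟩ : ∃ a : ℕ, i + j = X + Y + W + a + 1 :=
        ⟨(i + j - X - Y - W - 1).toNat, by omega⟩
      have e1 := hm.lozI_grow a (by omega) k (by omega)
      have e2 := hm.lozII_grow a (by omega) k (by omega)
      rw [show X + (k : ℤ) - 1 = i - 1 by omega,
        show Y + (a : ℤ) + W - k + 1 = j by omega] at e1
      rw [show X + (k : ℤ) + 1 = i + 1 by omega, show Y + (a : ℤ) + W - k - 1 = j - 2 by omega]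
        at e2
      rw [e1, e2]
      by_cases haZ : a + 1 < Z
      · have e3 := hm.lozIII_grow (a + 1) haZ k (by omega)
        rw [show X + (k : ℤ) = i by omega,
          show Y + ((a + 1 : ℕ) : ℤ) + W - k - 1 = j - 1 by push_cast; omega] at e3
        rw [e3, if_neg (by omega)]
        ring
      · have e3 := hm.borderDown k (by omega)
        rw [show X + (k : ℤ) = i by omega] at e3
        rw [hborder i (j - 1) (by omega), e3, if_pos (by omega), show a + 1 = Z by omega]
        ring
    · obtain ⟨k, hk⟩ : ∃ k : ℕ, j = Y + Z + W - k := ⟨(Y + Z + W - j).toNat, by omega⟩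
      obtain ⟨c, hc⟩ : ∃ c : ℕ, i + j = X + Y + Z + 2 * W - c :=
        ⟨(X + Y + Z + 2 * W - i - j).toNat, by omega⟩
      have e1 := hm.lozI_shrink c (by omega) k (by omega)
      have e2 := hm.lozII_shrink c (by omega) (k + 1) (by omega)
      have e3 := hm.lozIII_shrink c (by omega) k (by omega)
      rw [show X + (k : ℤ) + W - c - 1 = i - 1 by omega, ← hk] at e1
      rw [show X + ((k + 1 : ℕ) : ℤ) + W - c = i + 1 by push_cast; omega,
        show Y + (Z : ℤ) + W - (k + 1 : ℕ) - 1 = j - 2 by push_cast; omega] at e2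
      rw [show X + (k : ℤ) + W - c = i by omega, ← hk] at e3
      rw [e1, e2, e3, if_neg (by omega)]
      ring
  · simp only [InHex] at p1 p2
    obtain ⟨k, rfl⟩ : ∃ k : ℕ, i = X + k := ⟨(i - X).toNat, by omega⟩
    rw [hm.borderUp k (by omega), hm.borderDown k (by omega)]
    have h1 := h.border k (by omega)
    have h2 := h.border (k + 1) (by omega)
    push_cast at h2
    omega

end HiveOct

namespace HiveOct

open Finset

/-! ### The weight of a tiling as a sum over unit triangles -/

/-- The contribution of the upper unit triangle of a tile to its weight. -/
noncomputable def Tile.upShare (n : ℕ) (κ : ℤ × ℤ → ℝ) : Tile → ℝ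
  | .lozI i j => κ (i, j) / 3 - (κ (i + 1, j - 1) + κ (i + 1, j)) / 6
  | .lozII i j => κ (i, j) / 3 - (κ (i - 1, j + 1) + κ (i, j + 1)) / 6
  | .lozIII i j => κ (i + 1, j + 1) / 3 - (κ (i, j + 1) + κ (i + 1, j)) / 6
  | .borderUp i => κ (i + 1, n - i) / 3 - (κ (i, n - i) + κ (i + 1, n - i - 1)) / 6
  | .borderDown _ => 0

/-- The contribution of the lower unit triangle of a tile to its weight. -/
noncomputable def Tile.downShare (n : ℕ) (κ : ℤ × ℤ → ℝ) : Tile → ℝ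
  | .lozI i j => κ (i + 2, j - 1) / 3 - (κ (i + 1, j - 1) + κ (i + 1, j)) / 6
  | .lozII i j => κ (i - 1, j + 2) / 3 - (κ (i - 1, j + 1) + κ (i, j + 1)) / 6
  | .lozIII i j => κ (i, j) / 3 - (κ (i, j + 1) + κ (i + 1, j)) / 6
  | .borderUp _ => 0
  | .borderDown i => κ (i, n - i - 1) / 3 - (κ (i, n - i) + κ (i + 1, n - i - 1)) / 6

/-- The remaining contribution of a border triangle to its weight. -/
noncomputable def Tile.borderShare (n : ℕ) (κ : ℤ × ℤ → ℝ) : Tile → ℝ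
  | .borderUp i => (κ (i + 1, n - i - 1) - κ (i, n - i)) / 6
  | .borderDown i => (κ (i + 1, n - i - 1) - κ (i, n - i)) / 6
  | _ => 0

lemma Tile.weight_eq (n : ℕ) (κ : ℤ × ℤ → ℝ) (t : Tile) :
    t.weight n κ = t.upShare n κ + t.downShare n κ + t.borderShare n κ := by
  cases t <;> simp only [Tile.weight, Tile.upShare, Tile.downShare, Tile.borderShare] <;> ring

-- A double count: each tile with a non-zero contribution is found among the candidates at exactly
-- one position, namely its key.
open Classical in
lemma sum_eq_sum_candidates {β γ : Type*} (Ξ : Finset Tile) (F : Tile → ℝ) (B : Finset β)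
    (C : γ → Finset Tile) (key : Tile → γ) (pos : β → γ) (hpos : Set.InjOn pos B)
    (hC : ∀ c, ∀ t ∈ C c, key t = c)
    (hex : ∀ t ∈ Ξ, F t ≠ 0 → t ∈ C (key t) ∧ ∃ b ∈ B, pos b = key t) :
    ∑ t ∈ Ξ, F t = ∑ b ∈ B, ∑ t ∈ C (pos b), (ind Ξ t : ℝ) * F t := by
  have h1 : ∀ b ∈ B, ∑ t ∈ C (pos b), (ind Ξ t : ℝ) * F t =
      ∑ t ∈ Ξ, if t ∈ C (pos b) then F t else 0 := by
    intro b _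
    rw [sum_ite_mem, inter_comm, ← sum_ite_mem]
    refine sum_congr rfl fun t _ => ?_
    unfold ind
    split_ifs <;> simp
  rw [sum_congr rfl h1, sum_comm]
  refine sum_congr rfl fun t ht => ?_
  by_cases hF : F t = 0
  · simp [hF]
  obtain ⟨h2, b, hb, h3⟩ := hex t ht hF
  rw [sum_eq_single b]
  · rw [h3, if_pos h2]
  · intro b' hb' hne
    rw [if_neg]
    intro h4
    exact hne (hpos hb' hb ((hC _ t h4).symm.trans h3.symm))
  · exact fun h => absurd hb h

/-- The position of the upper unit triangle of a tile. -/
def Tile.upKey (n : ℕ) : Tile → ℤ × ℤ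
  | .lozI i j => (i, j)
  | .lozII i j => (i - 1, j + 1)
  | .lozIII i j => (i, j + 1)
  | .borderUp i => (i, n - i)
  | .borderDown i => (i, n - i)

/-- The position of the lower unit triangle of a tile. -/
def Tile.downKey (n : ℕ) : Tile → ℤ × ℤ
  | .lozI i j => (i + 1, j)
  | .lozII i j => (i - 1, j + 2)
  | .lozIII i j => (i, j + 1)
  | .borderUp i => (i, n - i)
  | .borderDown i => (i, n - i)

lemma apply_pair_congr {κ : ℤ × ℤ → ℝ} {a b c d : ℤ} (h1 : a = c) (h2 : b = d) :
    κ (a, b) = κ (c, d) := by rw [h1, h2]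

/-- The tiles that may cover the upper unit triangle at a given position. -/
noncomputable def upCandidates (n : ℕ) (p : ℤ × ℤ) : Finset Tile :=
  open Classical in {.lozI p.1 p.2, .lozII (p.1 + 1) (p.2 - 1),
    if p.1 + p.2 = n then .borderUp p.1 else .lozIII p.1 (p.2 - 1)}

/-- The tiles that may cover the lower unit triangle at a given position. -/
noncomputable def downCandidates (n : ℕ) (p : ℤ × ℤ) : Finset Tile :=
  open Classical in {.lozI (p.1 - 1) p.2, .lozII (p.1 + 1) (p.2 - 2),
    if p.1 + p.2 = n then .borderDown p.1 else .lozIII p.1 (p.2 - 1)}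

lemma sum_upCandidates (n : ℕ) (i j : ℤ) (F : Tile → ℝ) :
    ∑ t ∈ upCandidates n (i, j), F t = F (.lozI i j) + F (.lozII (i + 1) (j - 1)) +
      if i + j = n then F (.borderUp i) else F (.lozIII i (j - 1)) := by
  classical
  unfold upCandidates
  dsimp only
  split_ifs <;> rw [sum_insert (by simp), sum_insert (by simp), sum_singleton] <;> ring

lemma sum_downCandidates (n : ℕ) (i j : ℤ) (F : Tile → ℝ) :
    ∑ t ∈ downCandidates n (i, j), F t = F (.lozI (i - 1) j) + F (.lozII (i + 1) (j - 2)) +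
      if i + j = n then F (.borderDown i) else F (.lozIII i (j - 1)) := by
  classical
  unfold downCandidates
  dsimp only
  split_ifs <;> rw [sum_insert (by simp), sum_insert (by simp), sum_singleton] <;> ring

lemma upKey_of_mem {n : ℕ} {p : ℤ × ℤ} {t : Tile} (h : t ∈ upCandidates n p) :
    t.upKey n = p := by
  unfold upCandidates at h
  split_ifs at h with hp <;> simp only [mem_insert, mem_singleton] at h <;>
    rcases h with rfl | rfl | rfl <;> ext <;> simp only [Tile.upKey] <;> omega

lemma downKey_of_mem {n : ℕ} {p : ℤ × ℤ} {t : Tile} (h : t ∈ downCandidates n p) :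
    t.downKey n = p := by
  unfold downCandidates at h
  split_ifs at h with hp <;> simp only [mem_insert, mem_singleton] at h <;>
    rcases h with rfl | rfl | rfl <;> ext <;> simp only [Tile.downKey] <;> omega

variable {n : ℕ} {X Y : ℤ} {Z W : ℕ} {Ξ : Finset Tile} {f g : ℕ → ℕ → ℤ} {κ : ℤ × ℤ → ℝ}

/-- The indices of the upper unit triangles of a hexagon. -/
def upIndices (Z W : ℕ) : Finset ((_ : ℕ) × ℕ ⊕ (_ : ℕ) × ℕ) :=
  ((range Z).sigma fun a => range (a + W)).disjSum ((range W).sigma fun c => range (Z + c + 1))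

/-- The indices of the lower unit triangles of a hexagon. -/
def downIndices (Z W : ℕ) : Finset ((_ : ℕ) × ℕ ⊕ (_ : ℕ) × ℕ) :=
  ((range Z).sigma fun a => range (a + W + 1)).disjSum ((range W).sigma fun c => range (Z + c))

/-- The positions of the upper unit triangles of a hexagon. -/
def upPosition (X Y : ℤ) (Z W : ℕ) : (_ : ℕ) × ℕ ⊕ (_ : ℕ) × ℕ → ℤ × ℤ
  | .inl ⟨a, k⟩ => (X + k, Y + a + W - k)
  | .inr ⟨c, k⟩ => (X + k + W - c - 1, Y + Z + W - k)

/-- The positions of the lower unit triangles of a hexagon. -/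
def downPosition (X Y : ℤ) (Z W : ℕ) : (_ : ℕ) × ℕ ⊕ (_ : ℕ) × ℕ → ℤ × ℤ
  | .inl ⟨a, k⟩ => (X + k, Y + a + W - k + 1)
  | .inr ⟨c, k⟩ => (X + k + W - c, Y + Z + W - k)

lemma injOn_upPosition (X Y : ℤ) (Z W : ℕ) : Set.InjOn (upPosition X Y Z W) (upIndices Z W) := by
  rintro (⟨a, k⟩ | ⟨a, k⟩) h1 (⟨b, l⟩ | ⟨b, l⟩) h2 h
  all_goals
    simp only [upIndices, mem_coe, inl_mem_disjSum, inr_mem_disjSum, mem_sigma, mem_range]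
      at h1 h2
    simp only [upPosition, Prod.mk.injEq] at h
  · obtain rfl : k = l := by omega
    obtain rfl : a = b := by omega
    rfl
  · omega
  · omega
  · obtain rfl : k = l := by omega
    obtain rfl : a = b := by omega
    rfl

lemma injOn_downPosition (X Y : ℤ) (Z W : ℕ) :
    Set.InjOn (downPosition X Y Z W) (downIndices Z W) := by
  rintro (⟨a, k⟩ | ⟨a, k⟩) h1 (⟨b, l⟩ | ⟨b, l⟩) h2 h
  all_goals
    simp only [downIndices, mem_coe, inl_mem_disjSum, inr_mem_disjSum, mem_sigma, mem_range]
      at h1 h2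
    simp only [downPosition, Prod.mk.injEq] at h
  · obtain rfl : k = l := by omega
    obtain rfl : a = b := by omega
    rfl
  · omega
  · omega
  · obtain rfl : k = l := by omega
    obtain rfl : a = b := by omega
    rfl

lemma exists_upPosition (i j : ℤ) (h1 : InHex X Y Z W (i, j)) (h2 : InHex X Y Z W (i + 1, j))
    (h3 : InHex X Y Z W (i + 1, j - 1)) :
    ∃ b ∈ upIndices Z W, upPosition X Y Z W b = (i, j) := by
  simp only [InHex] at h1 h2 h3
  by_cases hij : i + j < X + Y + Z + W
  · refine ⟨.inl ⟨(i + j - X - Y - W).toNat, (i - X).toNat⟩, ?_, ?_⟩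
    · simp only [upIndices, inl_mem_disjSum, mem_sigma, mem_range]
      omega
    · simp only [upPosition, Prod.mk.injEq]
      omega
  · refine ⟨.inr ⟨(X + Y + Z + 2 * W - 1 - i - j).toNat, (Y + Z + W - j).toNat⟩, ?_, ?_⟩
    · simp only [upIndices, inr_mem_disjSum, mem_sigma, mem_range]
      omega
    · simp only [upPosition, Prod.mk.injEq]
      omega

lemma exists_downPosition (i j : ℤ) (h1 : InHex X Y Z W (i, j)) (h2 : InHex X Y Z W (i, j - 1))
    (h3 : InHex X Y Z W (i + 1, j - 1)) :
    ∃ b ∈ downIndices Z W, downPosition X Y Z W b = (i, j) := by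
  simp only [InHex] at h1 h2 h3
  by_cases hij : i + j ≤ X + Y + Z + W
  · refine ⟨.inl ⟨(i + j - X - Y - W - 1).toNat, (i - X).toNat⟩, ?_, ?_⟩
    · simp only [downIndices, inl_mem_disjSum, mem_sigma, mem_range]
      omega
    · simp only [downPosition, Prod.mk.injEq]
      omega
  · refine ⟨.inr ⟨(X + Y + Z + 2 * W - i - j).toNat, (Y + Z + W - j).toNat⟩, ?_, ?_⟩
    · simp only [downIndices, inr_mem_disjSum, mem_sigma, mem_range]
      omega
    · simp only [downPosition, Prod.mk.injEq]
      omega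

lemma HexTiling.sum_upShare (h : HexTiling n X Y Z W Ξ) :
    ∑ t ∈ Ξ, t.upShare n κ = ∑ b ∈ upIndices Z W,
      ∑ t ∈ upCandidates n (upPosition X Y Z W b), (ind Ξ t : ℝ) * t.upShare n κ := by
  refine sum_eq_sum_candidates Ξ (Tile.upShare n κ) _ (upCandidates n) (Tile.upKey n)
    (upPosition X Y Z W) (injOn_upPosition X Y Z W) (fun c t => upKey_of_mem) fun t ht hF => ?_
  have hin := (h.inside t ht).2
  cases t with
  | lozI i j =>
    simp only [Tile.verts, mem_insert, mem_singleton, forall_eq_or_imp, forall_eq] at hin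
    exact ⟨by simp [upCandidates, Tile.upKey], exists_upPosition _ _ hin.1 hin.2.2.2 hin.2.1⟩
  | lozII i j =>
    simp only [Tile.verts, mem_insert, mem_singleton, forall_eq_or_imp, forall_eq] at hin
    refine ⟨by simp [upCandidates, Tile.upKey], exists_upPosition _ _ hin.2.2.2 ?_ ?_⟩
    · rw [sub_add_cancel]; exact hin.2.1
    · rw [sub_add_cancel, add_sub_cancel_right]; exact hin.1
  | lozIII i j =>
    have hb : ¬ i + (j + 1) = n := fun hb =>
      ind_eq_zero.1 (h.ind_lozIII_border (i := i) (j := j) (by omega)) ht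
    simp only [Tile.verts, mem_insert, mem_singleton, forall_eq_or_imp, forall_eq] at hin
    refine ⟨by simp [upCandidates, Tile.upKey, hb],
      exists_upPosition _ _ hin.2.2.2 hin.2.2.1 ?_⟩
    rw [add_sub_cancel_right]; exact hin.2.1
  | borderUp i =>
    simp only [Tile.verts, mem_insert, mem_singleton, forall_eq_or_imp, forall_eq] at hin
    exact ⟨by simp [upCandidates, Tile.upKey], exists_upPosition _ _ hin.1 hin.2.1 hin.2.2⟩
  | borderDown i => exact absurd rfl hF

lemma HexTiling.sum_downShare (h : HexTiling n X Y Z W Ξ) :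
    ∑ t ∈ Ξ, t.downShare n κ = ∑ b ∈ downIndices Z W,
      ∑ t ∈ downCandidates n (downPosition X Y Z W b), (ind Ξ t : ℝ) * t.downShare n κ := by
  refine sum_eq_sum_candidates Ξ (Tile.downShare n κ) _ (downCandidates n) (Tile.downKey n)
    (downPosition X Y Z W) (injOn_downPosition X Y Z W) (fun c t => downKey_of_mem)
    fun t ht hF => ?_
  have hin := (h.inside t ht).2
  cases t with
  | lozI i j =>
    simp only [Tile.verts, mem_insert, mem_singleton, forall_eq_or_imp, forall_eq] at hin
    refine ⟨by simp [downCandidates, Tile.downKey], exists_downPosition _ _ hin.2.2.2 hin.2.1 ?_⟩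
    rw [add_assoc]; exact hin.2.2.1
  | lozII i j =>
    simp only [Tile.verts, mem_insert, mem_singleton, forall_eq_or_imp, forall_eq] at hin
    refine ⟨by simp [downCandidates, Tile.downKey], exists_downPosition _ _ hin.2.2.1 ?_ ?_⟩
    · rw [show j + 2 - 1 = j + 1 by ring]; exact hin.2.2.2
    · rw [sub_add_cancel, show j + 2 - 1 = j + 1 by ring]; exact hin.2.1
  | lozIII i j =>
    have hb : ¬ i + (j + 1) = n := fun hb =>
      ind_eq_zero.1 (h.ind_lozIII_border (i := i) (j := j) (by omega)) ht
    simp only [Tile.verts, mem_insert, mem_singleton, forall_eq_or_imp, forall_eq] at hin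
    refine ⟨by simp [downCandidates, Tile.downKey, hb],
      exists_downPosition _ _ hin.2.2.2 ?_ ?_⟩
    · rw [add_sub_cancel_right]; exact hin.1
    · rw [add_sub_cancel_right]; exact hin.2.1
  | borderUp i => exact absurd rfl hF
  | borderDown i =>
    simp only [Tile.verts, mem_insert, mem_singleton, forall_eq_or_imp, forall_eq] at hin
    exact ⟨by simp [downCandidates, Tile.downKey], exists_downPosition _ _ hin.1 hin.2.1 hin.2.2⟩

/-- The border share is the same for both triangles at an edge, and exactly one of them is used, so
the sum telescopes along the border. -/
lemma HexTiling.sum_borderShare (h : HexTiling n X Y Z W Ξ) (hn : (n : ℤ) = X + Y + Z + W) :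
    ∑ t ∈ Ξ, t.borderShare n κ = (κ (X + Z + W, Y) - κ (X, Y + Z + W)) / 6 := by
  classical
  rw [sum_eq_sum_candidates Ξ (Tile.borderShare n κ) (range (Z + W))
    (fun p : ℤ × ℤ => if p.1 + p.2 = (n : ℤ) then {.borderUp p.1, .borderDown p.1} else ∅) (Tile.upKey n)
    (fun k => (X + k, n - (X + k)))
    (fun k _ l _ hkl => by simpa using congrArg Prod.fst hkl)]
  · have : ∀ k ∈ range (Z + W), ∑ t ∈ (if X + k + (n - (X + k)) = (n : ℤ) then
        {.borderUp (X + k), .borderDown (X + k)} else ∅ : Finset Tile),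
        (ind Ξ t : ℝ) * t.borderShare n κ =
        κ (X + (k + 1 : ℕ), Y + Z + W - (k + 1 : ℕ)) / 6 - κ (X + k, Y + Z + W - k) / 6 := by
      intro k hk
      rw [mem_range] at hk
      have hb := h.border (X + k) (by simp only [InHex]; omega) (by simp only [InHex]; omega)
      have hb' : (ind Ξ (.borderUp (X + k)) : ℝ) + ind Ξ (.borderDown (X + k)) = 1 := by
        exact_mod_cast hb
      rw [if_pos (by ring), sum_insert (by simp), sum_singleton, Tile.borderShare,
        Tile.borderShare, ← add_mul, hb', one_mul, sub_div]
      congr 2 <;> refine apply_pair_congr ?_ ?_ <;> push_cast <;> omega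
    rw [sum_congr rfl this, sum_range_sub (fun k : ℕ => κ (X + k, Y + Z + W - k) / 6), ← sub_div]
    congr 2 <;> refine apply_pair_congr ?_ ?_ <;> push_cast <;> ring
  · intro c t ht
    split_ifs at ht with hc
    · simp only [mem_insert, mem_singleton] at ht
      rcases ht with rfl | rfl <;> ext <;> simp only [Tile.upKey] <;> omega
    · simp at ht
  · intro t ht hF
    have hin := (h.inside t ht).2
    cases t with
    | lozI i j => exact absurd rfl hF
    | lozII i j => exact absurd rfl hF
    | lozIII i j => exact absurd rfl hF
    | borderUp i =>
      simp only [Tile.verts, mem_insert, mem_singleton, forall_eq_or_imp, forall_eq, InHex] at hin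
      refine ⟨by simp [Tile.upKey], (i - X).toNat, ?_, ?_⟩
      · rw [mem_range]; omega
      · simp only [Tile.upKey, Prod.mk.injEq]; omega
    | borderDown i =>
      simp only [Tile.verts, mem_insert, mem_singleton, forall_eq_or_imp, forall_eq, InHex] at hin
      refine ⟨by simp [Tile.upKey], (i - X).toNat, ?_, ?_⟩
      · rw [mem_range]; omega
      · simp only [Tile.upKey, Prod.mk.injEq]; omega

/-- Each unit triangle contributes the share of its unique tile. Written with indicators as
differences of counts, this is a summand of `stripWeight`; the four families are upper and lower
triangles, below and above the border. -/
lemma HexTiling.sum_weight (h : HexTiling n X Y Z W Ξ) (hm : Matches X Y Z W Ξ f g)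
    (hn : (n : ℤ) = X + Y + Z + W) {ρ : ℕ → ℕ → ℕ → ℝ}
    (hρL : ∀ a ≤ Z, ∀ k ≤ a + W, ρ a W k = κ (X + k, Y + a + W - k))
    (hρR : ∀ c ≤ W, ∀ k ≤ Z + c, ρ Z c k = κ (X + k + W - c, Y + Z + W - k)) :
    ∑ t ∈ Ξ, t.weight n κ =
      ∑ a ∈ range Z, stripWeight (a + W) (ρ a W) (f a) (ρ (a + 1) W) (f (a + 1)) +
      ∑ c ∈ range W, stripWeight (Z + c) (ρ Z c) (g c) (ρ Z (c + 1)) (g (c + 1)) +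
      (κ (X + Z + W, Y) - κ (X, Y + Z + W)) / 6 := by
  simp only [Tile.weight_eq, sum_add_distrib]
  rw [h.sum_upShare, h.sum_downShare, h.sum_borderShare hn]
  unfold upIndices downIndices
  simp only [sum_disjSum, sum_sigma, stripWeight, sum_add_distrib]
  have u1 : ∀ a ∈ range Z, ∀ k ∈ range (a + W),
      ∑ t ∈ upCandidates n (upPosition X Y Z W (.inl ⟨a, k⟩)), (ind Ξ t : ℝ) * t.upShare n κ =
      ((ρ a W k + ρ a W (k + 1) + ρ (a + 1) W (k + 1)) / 3 -
    (((f a (k + 1) : ℝ) - f a k) * (ρ a W k + ρ a W (k + 1)) +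
      (1 - (f (a + 1) (k + 1) : ℝ) + f a k) * (ρ a W k + ρ (a + 1) W (k + 1)) +
      ((f (a + 1) (k + 1) : ℝ) - f a (k + 1)) * (ρ a W (k + 1) + ρ (a + 1) W (k + 1))) / 2) := by
    intro a ha k hk
    rw [mem_range] at ha hk
    have e1 := hm.lozI_grow a (by omega) (k + 1) (by omega)
    have e2 := hm.lozII_grow a (by omega) k (by omega)
    have e3 := hm.lozIII_grow a (by omega) k (by omega)
    rw [hρL a (by omega) k (by omega), hρL a (by omega) (k + 1) (by omega),
      hρL (a + 1) (by omega) (k + 1) (by omega)]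
    simp only [upPosition]
    obtain ⟨i, hi⟩ : ∃ i, i = X + (k : ℤ) := ⟨_, rfl⟩
    obtain ⟨j, hj⟩ : ∃ j, j = Y + a + W - (k : ℤ) := ⟨_, rfl⟩
    rw [show X + ((k + 1 : ℕ) : ℤ) = i + 1 by push_cast; omega] at e1 ⊢
    rw [show Y + (a : ℤ) + W - (k + 1 : ℕ) = j - 1 by push_cast; omega] at e1 ⊢
    rw [show Y + ((a + 1 : ℕ) : ℤ) + W - (k + 1 : ℕ) = j by push_cast; omega]
    rw [← hi, ← hj] at e2 e3 ⊢
    rw [sum_upCandidates, if_neg (by omega), e2, e3,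
      show Tile.lozI i j = .lozI (i + 1 - 1) (j - 1 + 1) by congr 1 <;> ring, e1]
    simp only [Tile.upShare]
    rw [show i + 1 - 1 = i by ring, show j - 1 + 1 = j by ring]
    push_cast
    ring
  have u2 : ∀ c ∈ range W, ∀ k ∈ range (Z + c + 1),
      ∑ t ∈ upCandidates n (upPosition X Y Z W (.inr ⟨c, k⟩)), (ind Ξ t : ℝ) * t.upShare n κ =
      ((ρ Z c k + ρ Z (c + 1) k + ρ Z (c + 1) (k + 1)) / 3 -
    (((g (c + 1) (k + 1) : ℝ) - g (c + 1) k) * (ρ Z (c + 1) k + ρ Z (c + 1) (k + 1)) +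
      ((g (c + 1) k : ℝ) - g c k) * (ρ Z c k + ρ Z (c + 1) k) +
      (1 - (g (c + 1) (k + 1) : ℝ) + g c k) * (ρ Z c k + ρ Z (c + 1) (k + 1))) / 2) := by
    intro c hc k hk
    rw [mem_range] at hc hk
    have e1 := hm.lozI_shrink c (by omega) k (by omega)
    have e2 := hm.lozII_shrink c (by omega) k (by omega)
    rw [hρR c (by omega) k (by omega), hρR (c + 1) (by omega) k (by omega),
      hρR (c + 1) (by omega) (k + 1) (by omega)]
    simp only [upPosition]
    obtain ⟨i, hi⟩ : ∃ i, i = X + (k : ℤ) + W - c - 1 := ⟨_, rfl⟩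
    obtain ⟨j, hj⟩ : ∃ j, j = Y + Z + W - (k : ℤ) := ⟨_, rfl⟩
    -- A border triangle has the same share as the half of a type III lozenge that it replaces, so
    -- the border row needs no separate formula.
    have e3 : (if i + j = n then (ind Ξ (.borderUp i) : ℝ) * (Tile.borderUp i).upShare n κ else
        (ind Ξ (.lozIII i (j - 1)) : ℝ) * (Tile.lozIII i (j - 1)).upShare n κ) =
        ((g (c + 1) (k + 1) - g (c + 1) k : ℤ) : ℝ) *
          (κ (i + 1, j) / 3 - (κ (i, j) + κ (i + 1, j - 1)) / 6) := by
      split_ifs with hij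
      · have e3 := hm.borderUp k (by omega)
        rw [show X + (k : ℤ) = i by omega, show W = c + 1 by omega] at e3
        rw [e3, Tile.upShare, show (n : ℤ) - i = j by omega]
      · have e3 := hm.lozIII_shrink (c + 1) (by omega) k (by omega)
        rw [show X + (k : ℤ) + W - (c + 1 : ℕ) = i by push_cast; omega,
          show Y + (Z : ℤ) + W - k - 1 = j - 1 by omega] at e3
        rw [e3, Tile.upShare, sub_add_cancel]
    rw [← hi, ← hj] at e1 ⊢
    rw [show X + (k : ℤ) + W - c = i + 1 by omega, ← hj] at e2
    rw [show X + (k : ℤ) + W - c = i + 1 by omega]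
    rw [show X + ((k + 1 : ℕ) : ℤ) + W - (c + 1 : ℕ) = i + 1 by push_cast; omega,
      show X + (k : ℤ) + W - (c + 1 : ℕ) = i by push_cast; omega,
      show Y + (Z : ℤ) + W - (k + 1 : ℕ) = j - 1 by push_cast; omega]
    rw [sum_upCandidates, e1, e2, e3]
    simp only [Tile.upShare]
    rw [show i + 1 - 1 = i by ring, show j - 1 + 1 = j by ring]
    push_cast
    ring
  have d1 : ∀ a ∈ range Z, ∀ k ∈ range (a + W + 1),
      ∑ t ∈ downCandidates n (downPosition X Y Z W (.inl ⟨a, k⟩)),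
        (ind Ξ t : ℝ) * t.downShare n κ =
      ((ρ a W k + ρ (a + 1) W k + ρ (a + 1) W (k + 1)) / 3 -
    (((f (a + 1) (k + 1) : ℝ) - f (a + 1) k) * (ρ (a + 1) W k + ρ (a + 1) W (k + 1)) +
      ((f (a + 1) k : ℝ) - f a k) * (ρ a W k + ρ (a + 1) W k) +
      (1 - (f (a + 1) (k + 1) : ℝ) + f a k) * (ρ a W k + ρ (a + 1) W (k + 1))) / 2) := by
    intro a ha k hk
    rw [mem_range] at ha hk
    have e1 := hm.lozI_grow a (by omega) k (by omega)
    have e2 := hm.lozII_grow a (by omega) k (by omega)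
    rw [hρL a (by omega) k (by omega), hρL (a + 1) (by omega) k (by omega),
      hρL (a + 1) (by omega) (k + 1) (by omega)]
    simp only [downPosition]
    obtain ⟨i, hi⟩ : ∃ i, i = X + (k : ℤ) := ⟨_, rfl⟩
    obtain ⟨j, hj⟩ : ∃ j, j = Y + a + W - (k : ℤ) + 1 := ⟨_, rfl⟩
    have e3 : (if i + j = n then (ind Ξ (.borderDown i) : ℝ) * (Tile.borderDown i).downShare n κ
        else (ind Ξ (.lozIII i (j - 1)) : ℝ) * (Tile.lozIII i (j - 1)).downShare n κ) =
        ((f (a + 1) (k + 1) - f (a + 1) k : ℤ) : ℝ) *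
          (κ (i, j - 1) / 3 - (κ (i, j) + κ (i + 1, j - 1)) / 6) := by
      split_ifs with hij
      · have e3 := hm.borderDown k (by omega)
        rw [← hi, show Z = a + 1 by omega] at e3
        rw [e3, Tile.downShare, show (n : ℤ) - i = j by omega]
      · have e3 := hm.lozIII_grow (a + 1) (by omega) k (by omega)
        rw [← hi, show Y + ((a + 1 : ℕ) : ℤ) + W - k - 1 = j - 1 by push_cast; omega] at e3
        rw [e3, Tile.downShare, sub_add_cancel]
    rw [← hi, ← hj] at e1 ⊢
    rw [← hi, show Y + (a : ℤ) + W - k - 1 = j - 2 by omega] at e2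
    rw [show X + ((k + 1 : ℕ) : ℤ) = i + 1 by push_cast; omega,
      show Y + ((a + 1 : ℕ) : ℤ) + W - (k + 1 : ℕ) = j - 1 by push_cast; omega,
      show Y + ((a + 1 : ℕ) : ℤ) + W - k = j by push_cast; omega,
      show Y + (a : ℤ) + W - k = j - 1 by omega]
    rw [sum_downCandidates, e1, e2, e3]
    simp only [Tile.downShare]
    rw [show i - 1 + 1 = i by ring, show i - 1 + 2 = i + 1 by ring, show i + 1 - 1 = i by ring,
      show j - 2 + 2 = j by ring, show j - 2 + 1 = j - 1 by ring]
    push_cast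
    ring
  have d2 : ∀ c ∈ range W, ∀ k ∈ range (Z + c),
      ∑ t ∈ downCandidates n (downPosition X Y Z W (.inr ⟨c, k⟩)),
        (ind Ξ t : ℝ) * t.downShare n κ =
      ((ρ Z c k + ρ Z c (k + 1) + ρ Z (c + 1) (k + 1)) / 3 -
    (((g c (k + 1) : ℝ) - g c k) * (ρ Z c k + ρ Z c (k + 1)) +
      (1 - (g (c + 1) (k + 1) : ℝ) + g c k) * (ρ Z c k + ρ Z (c + 1) (k + 1)) +
      ((g (c + 1) (k + 1) : ℝ) - g c (k + 1)) * (ρ Z c (k + 1) + ρ Z (c + 1) (k + 1))) / 2) := by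
    intro c hc k hk
    rw [mem_range] at hc hk
    have e1 := hm.lozI_shrink c (by omega) k (by omega)
    have e2 := hm.lozII_shrink c (by omega) (k + 1) (by omega)
    have e3 := hm.lozIII_shrink c (by omega) k (by omega)
    rw [hρR c (by omega) k (by omega), hρR c (by omega) (k + 1) (by omega),
      hρR (c + 1) (by omega) (k + 1) (by omega)]
    simp only [downPosition]
    obtain ⟨i, hi⟩ : ∃ i, i = X + (k : ℤ) + W - c := ⟨_, rfl⟩
    obtain ⟨j, hj⟩ : ∃ j, j = Y + Z + W - (k : ℤ) := ⟨_, rfl⟩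
    rw [← hi, ← hj] at e1 e3 ⊢
    rw [show X + ((k + 1 : ℕ) : ℤ) + W - c = i + 1 by push_cast; omega,
      show Y + (Z : ℤ) + W - (k + 1 : ℕ) = j - 1 by push_cast; omega] at e2 ⊢
    rw [show X + ((k + 1 : ℕ) : ℤ) + W - (c + 1 : ℕ) = i by push_cast; omega]
    rw [show j - 1 - 1 = j - 2 by ring] at e2
    rw [sum_downCandidates, if_neg (by omega), e1, e2, e3]
    simp only [Tile.downShare]
    rw [show i - 1 + 1 = i by ring, show i - 1 + 2 = i + 1 by ring, show i + 1 - 1 = i by ring,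
      show j - 2 + 2 = j by ring, show j - 2 + 1 = j - 1 by ring, show j - 1 + 1 = j by ring]
    push_cast
    ring
  rw [sum_congr rfl fun a ha => sum_congr rfl (u1 a ha),
    sum_congr rfl fun c hc => sum_congr rfl (u2 c hc),
    sum_congr rfl fun a ha => sum_congr rfl (d1 a ha),
    sum_congr rfl fun c hc => sum_congr rfl (d2 c hc)]
  ring

end HiveOct

namespace HiveOct

open Finset

/-! ### The largest weight of a tiling -/

variable {n : ℕ} {X Y : ℤ} {Z W : ℕ} {κ : ℤ × ℤ → ℝ}

/-- Using the coordinates `[X, Y, Z, W]` of the point over `v` on a final face, where `X` or `Y` is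
zero, both cases of the hexagon have the same description. -/
lemma excavationHexagon_eq {v : ℤ × ℤ} (hX : X = max (v.1 - v.2) 0) (hY : Y = max (v.2 - v.1) 0)
    (hZ : (Z : ℤ) = n - max v.1 v.2) (hW : (W : ℤ) = min v.1 v.2) :
    excavationHexagon n v = ⟨(X, Y + Z + W), (X, Y + W), (X + W, Y), (X + Z + W, Y),
      (X + Z + W, Y + W), (X + W, Y + Z + W)⟩ := by
  unfold excavationHexagon
  dsimp only
  split_ifs with h
  · simp only [Hexagon.mk.injEq, Prod.mk.injEq]
    omega
  · simp only [Hexagon.mk.injEq, Prod.mk.injEq]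
    omega

/-- The values of `o` on the rows of points below `[X, Y, Z, W]`. -/
def rowValues (o : ℤ → ℤ → ℤ → ℤ → ℝ) (X Y : ℤ) (Z W : ℕ) (a c k : ℕ) : ℝ :=
  o (X + k) (Y + a + c - k) (Z - a) (W - c)

lemma IsOctahedral.rowRule {o : ℤ → ℤ → ℤ → ℤ → ℝ} (ho : IsOctahedral n o) (hX : 0 ≤ X)
    (hY : 0 ≤ Y) (hn : (n : ℤ) = X + Y + Z + W) : RowRule Z W (rowValues o X Y Z W) := by
  intro a c k ha hc hk
  have := ho (X + k) (Y + a + c - k) (Z - a - 1) (W - c - 1) (by omega) (by omega) (by omega)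
    (by omega) (by omega)
  simp only [rowValues]
  rw [sub_add_cancel, sub_add_cancel] at this
  rw [this]
  push_cast
  rw [show X + ((k : ℤ) + 1) = X + k + 1 by ring,
    show Y + ((a : ℤ) + 1) + (c + 1) - (k + 1) = Y + a + c - k + 1 by ring,
    show (Z : ℤ) - (a + 1) = Z - a - 1 by ring, show (W : ℤ) - (c + 1) = W - c - 1 by ring,
    show Y + (a : ℤ) + (c + 1) - (k + 1) = Y + a + c - k by ring,
    show Y + ((a : ℤ) + 1) + c - k = Y + a + c - k + 1 by ring,
    show Y + (a : ℤ) + (c + 1) - k = Y + a + c - k + 1 by ring,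
    show Y + ((a : ℤ) + 1) + c - (k + 1) = Y + a + c - k by ring, sub_add_cancel,
    add_comm (o (X + k) (Y + a + c - k + 1) (Z - a) (W - c - 1))]

/-- Tilings correspond to row counts of the same weight, so the bound and the optimum of the
exchange argument carry over. -/
theorem isGreatest_tilingWeights {o : ℤ → ℤ → ℤ → ℤ → ℝ} (ho : IsOctahedral n o)
    (hκ : InitialFaces n o κ) {v : ℤ × ℤ} (hv : v ∈ Interior n) :
    IsGreatest (tilingWeights n κ v)
      (o (max (v.1 - v.2) 0) (max (v.2 - v.1) 0) (n - max v.1 v.2) (min v.1 v.2)) := by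
  simp only [Interior, mem_product, mem_Ioo] at hv
  obtain ⟨X, hX⟩ : ∃ X, X = max (v.1 - v.2) 0 := ⟨_, rfl⟩
  obtain ⟨Y, hY⟩ : ∃ Y, Y = max (v.2 - v.1) 0 := ⟨_, rfl⟩
  obtain ⟨Z, hZ⟩ : ∃ Z : ℕ, (Z : ℤ) = n - max v.1 v.2 := ⟨(n - max v.1 v.2).toNat, by omega⟩
  obtain ⟨W, hW⟩ : ∃ W : ℕ, (W : ℤ) = min v.1 v.2 := ⟨(min v.1 v.2).toNat, by omega⟩
  have hn : (n : ℤ) = X + Y + Z + W := by omega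
  have hX0 : 0 ≤ X := by omega
  have hY0 : 0 ≤ Y := by omega
  have hZ0 : 0 < Z := by omega
  have hW0 : 0 < W := by omega
  have hH := excavationHexagon_eq hX hY hZ hW
  have hpts : ∀ p, p ∈ (excavationHexagon n v).points ↔ InHex X Y Z W p := by
    intro p
    rw [hH]
    simp only [Hexagon.points, Set.mem_ofPred_eq, InHex]
    constructor <;> intro h <;> omega
  rw [← hX, ← hY, ← hZ, ← hW]
  have hρ := ho.rowRule hX0 hY0 hn
  have h0 : rowValues o X Y Z W 0 0 0 = o X Y Z W := by simp [rowValues]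
  -- The rows with `c = W` or `a = Z` lie on the faces `w = 0` and `z = 0`, where `o` is given by
  -- `κ`.
  have hρL : ∀ a ≤ Z, ∀ k ≤ a + W,
      rowValues o X Y Z W a W k = κ (X + k, Y + a + W - k) := by
    intro a ha k hk
    rw [← hκ.2 _ _ (by omega) (by omega) (by omega), rowValues, sub_self]
    congr 1
    omega
  have hρR : ∀ c ≤ W, ∀ k ≤ Z + c,
      rowValues o X Y Z W Z c k = κ (X + k + W - c, Y + Z + W - k) := by
    intro c hc k hk
    rw [← hκ.1 _ _ (by omega) (by omega) (by omega), rowValues, sub_self]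
    congr 1 <;> omega
  have hweight : ∀ {Ξ f g}, HexTiling n X Y Z W Ξ → Matches X Y Z W Ξ f g →
      tilingWeight n κ v Ξ = rowCountsWeight Z W (rowValues o X Y Z W) f g := by
    intro Ξ f g h1 h2
    rw [tilingWeight, h1.sum_weight h2 hn hρL hρR, hH, rowCountsWeight, Hexagon.weight,
      hρL 0 (by omega) 0 (by omega), hρL 0 (by omega) W (by omega),
      hρL Z le_rfl 0 (by omega), hρL Z le_rfl (Z + W) le_rfl,
      hρR 0 (by omega) 0 (by omega), hρR 0 (by omega) Z (by omega)]
    dsimp only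
    push_cast
    rw [show Y + (0 : ℤ) + W - 0 = Y + W by ring, show Y + (0 : ℤ) + W - W = Y by ring,
      show Y + (Z : ℤ) + W - 0 = Y + Z + W by ring, show Y + (Z : ℤ) + W - (Z + W) = Y by ring,
      show X + (0 : ℤ) + W - 0 = X + W by ring, show X + (Z : ℤ) + W - 0 = X + Z + W by ring,
      show Y + (Z : ℤ) + W - Z = Y + W by ring, show X + (0 : ℤ) = X by ring,
      show X + ((Z : ℤ) + W) = X + Z + W by ring]
    ring
  have hle : ∀ w ∈ tilingWeights n κ v, w ≤ o X Y Z W := by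
    rintro w ⟨Ξ, hΞ, rfl⟩
    have h1 := (isTiling_iff hpts Ξ).1 hΞ
    obtain ⟨f, g, h2, h3⟩ := h1.exists_rowCounts hn
    rw [hweight h1 h3, ← h0]
    exact h2.weight_le hρ
  refine ⟨?_, hle⟩
  obtain ⟨f, g, h1, h2⟩ := exists_rowCounts hρ
  obtain ⟨Ξ, h3, h4⟩ := h1.exists_hexTiling hZ0 hW0 hX0 hY0 hn
  have hmem : tilingWeight n κ v Ξ ∈ tilingWeights n κ v := ⟨Ξ, (isTiling_iff hpts Ξ).2 h3, rfl⟩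
  rw [← hweight h3 h4, h0] at h2
  rwa [le_antisymm (hle _ hmem) h2] at hmem

lemma isGreatest_octState {v : ℤ × ℤ} (hv : v ∈ Interior n) :
    IsGreatest (tilingWeights n κ v) (octState n κ n v) := by
  have ho := isOctahedral_octExtension n κ
  have hκ := initialFaces_octExtension n κ
  have h := isGreatest_tilingWeights ho hκ hv
  simp only [Interior, mem_product, mem_Ioo] at hv
  have hF := (finalFaces_iff (η := octState n κ n) ho hκ).2 fun _ _ => rfl
  rcases le_total v.1 v.2 with hle | hle
  · rw [max_eq_right (by omega), max_eq_left (by omega), max_eq_right hle, min_eq_left hle,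
      hF.1 v.1 v.2 (by omega) hle (by omega)] at h
    exact h
  · rw [max_eq_left (by omega), max_eq_right (by omega), max_eq_left hle, min_eq_right hle,
      hF.2 v.1 v.2 (by omega) hle (by omega)] at h
    exact h

lemma octState_eq_of_boundary {v : ℤ × ℤ} (hv : v ∉ Interior n) (t : ℕ) :
    octState n κ t v = κ v := by
  refine octState_eq_of_not_active (Nat.zero_le t) fun s _ _ h => hv ?_
  simp only [Interior, mem_product, mem_Ioo]
  unfold Active at h
  omega

lemma lozengeMax_eq_octState (v : ℤ × ℤ) : lozengeMax n κ v = octState n κ n v := by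
  unfold lozengeMax
  split_ifs with hv
  · exact (isGreatest_octState hv).csSup_eq
  · exact (octState_eq_of_boundary hv n).symm

end HiveOct

namespace HiveOct

/-! ### The octahedron recurrence preserves rhombus concavity -/

variable {n : ℕ} {o : ℤ → ℤ → ℤ → ℤ → ℝ}

lemma IsOctahedral.swap_left (ho : IsOctahedral n o) :
    IsOctahedral n fun x y z w => o y x z w := by
  intro x y z w hx hy hz hw hn
  dsimp only
  rw [ho y x z w hy hx hz hw (by omega), max_comm, add_comm (o (y + 1) x z (w + 1)),
    add_comm (o (y + 1) x (z + 1) w)]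

lemma IsOctahedral.swap_right (ho : IsOctahedral n o) :
    IsOctahedral n fun x y z w => o x y w z := by
  intro x y z w hx hy hz hw hn
  dsimp only
  rw [ho x y w z hx hy hw hz (by omega), max_comm]

/-- The sum of the two opposite corners equals the maximum, and this form of the rule does not
distinguish the new corner from the old one: time can be reversed. -/
lemma IsOctahedral.swap_pairs (ho : IsOctahedral n o) :
    IsOctahedral n fun x y z w => o z w x y := by
  intro x y z w hx hy hz hw hn
  have := ho z w x y hz hw hx hy (by omega)
  dsimp only
  rw [add_comm (o z (w + 1) (x + 1) y), this]
  ring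

/-- The concavity of `o` at the unit rhombus with obtuse corners `xy` and `xz`, and acute corners
`xx` and `yz`, over `[x, y, z, w]`. -/
def RhombusAt (o : ℤ → ℤ → ℤ → ℤ → ℝ) (x y z w : ℤ) : Prop :=
  o (x + 2) y z w + o x (y + 1) (z + 1) w ≤ o (x + 1) (y + 1) z w + o (x + 1) y (z + 1) w

/-- The concavity of `o` at all the unit rhombi of the type of `RhombusAt` in the tetrahedron. -/
def RhombusConcave (n : ℕ) (o : ℤ → ℤ → ℤ → ℤ → ℝ) : Prop :=
  ∀ x y z w : ℤ, 0 ≤ x → 0 ≤ y → 0 ≤ z → 0 ≤ w → x + y + z + w + 2 = n → RhombusAt o x y z w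

/-- The concavity of `o` at all the unit rhombi of the type of `RhombusAt` in the face `w = 0`. -/
def FaceConcave (n : ℕ) (o : ℤ → ℤ → ℤ → ℤ → ℝ) : Prop :=
  ∀ x y z : ℤ, 0 ≤ x → 0 ≤ y → 0 ≤ z → x + y + z + 2 = n → RhombusAt o x y z 0

/-- Two octahedra overlap here. Pick the branch attaining the maximum in `e1`, bound the maximum in
`e2` below by a suitable branch, and compare the two with the rhombi one layer down. -/
lemma IsOctahedral.rhombusAt_step (ho : IsOctahedral n o) {x y z w : ℤ} (hx : 0 ≤ x) (hy : 0 ≤ y)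
    (hz : 0 ≤ z) (hw : 0 ≤ w) (hn : x + y + z + w + 3 = n) (h1 : RhombusAt o x (y + 1) z w)
    (h2 : RhombusAt (fun x y z w => o x y w z) x (y + 1) w z) : RhombusAt o x y z (w + 1) := by
  have e1 := ho x (y + 1) z w hx (by omega) hz hw (by omega)
  have e2 := ho (x + 1) y z w (by omega) hy hz hw (by omega)
  simp only [RhombusAt] at h1 h2 ⊢
  rw [show x + 1 + 1 = x + 2 by ring] at e2
  rw [show y + 1 + 1 = y + 2 by ring] at *
  have l1 := le_max_left (o (x + 2) y (z + 1) w + o (x + 1) (y + 1) z (w + 1))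
    (o (x + 2) y z (w + 1) + o (x + 1) (y + 1) (z + 1) w)
  have l2 := le_max_right (o (x + 2) y (z + 1) w + o (x + 1) (y + 1) z (w + 1))
    (o (x + 2) y z (w + 1) + o (x + 1) (y + 1) (z + 1) w)
  rcases max_cases (o (x + 1) (y + 1) (z + 1) w + o x (y + 2) z (w + 1))
    (o (x + 1) (y + 1) z (w + 1) + o x (y + 2) (z + 1) w) with h | h <;> linarith

/-- The two types of rhombi, in planes of constant `w` and of constant `z`, feed each other, so they
are treated together by induction on `z + w`. -/
lemma IsOctahedral.rhombusConcave_base (ho : IsOctahedral n o) (h1 : FaceConcave n o)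
    (h2 : FaceConcave n fun x y z w => o x y w z) :
    RhombusConcave n o ∧ RhombusConcave n fun x y z w => o x y w z := by
  have key : ∀ t : ℕ, ∀ x y z w : ℤ, 0 ≤ x → 0 ≤ y → 0 ≤ z → 0 ≤ w → x + y + z + w + 2 = n →
      z + w = t → RhombusAt o x y z w ∧ RhombusAt (fun x y z w => o x y w z) x y w z := by
    intro t
    induction t with
    | zero =>
      intro x y z w hx hy hz hw hn ht
      obtain rfl : z = 0 := by push_cast at ht; omega
      obtain rfl : w = 0 := by push_cast at ht; omega
      exact ⟨h1 x y 0 hx hy le_rfl (by omega), h2 x y 0 hx hy le_rfl (by omega)⟩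
    | succ t ih =>
      intro x y z w hx hy hz hw hn ht
      push_cast at ht
      constructor
      · rcases hw.eq_or_lt with rfl | hw'
        · exact h1 x y z hx hy hz (by omega)
        · obtain ⟨w, rfl⟩ : ∃ w', w = w' + 1 := ⟨w - 1, by omega⟩
          have := ih x (y + 1) z w hx (by omega) hz (by omega) (by omega) (by omega)
          exact ho.rhombusAt_step hx hy hz (by omega) (by omega) this.1 this.2
      · rcases hz.eq_or_lt with rfl | hz'
        · exact h2 x y w hx hy hw (by omega)
        · obtain ⟨z, rfl⟩ : ∃ z', z = z' + 1 := ⟨z - 1, by omega⟩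
          have := ih x (y + 1) z w hx (by omega) (by omega) hw (by omega) (by omega)
          exact ho.swap_right.rhombusAt_step hx hy hw (by omega) (by omega) this.2 this.1
  exact ⟨fun x y z w hx hy hz hw hn => (key (z + w).toNat x y z w hx hy hz hw hn (by omega)).1,
    fun x y z w hx hy hz hw hn =>
      (key (z + w).toNat x y w z hx hy hw hz (by omega) (by omega)).2⟩

/-- In each branch of the octahedron rule, one of the two given rhombi bounds the corner `zw` from
above, which gives `xx + zw ≤ xz + xw`. -/
lemma IsOctahedral.rhombusConcave_side (ho : IsOctahedral n o) (h1 : RhombusConcave n o)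
    (h2 : RhombusConcave n fun x y z w => o x y w z) :
    RhombusConcave n fun x y z w => o x w y z := by
  intro x z w y hx hz hw hy hn
  have e1 := h1 x y z w hx hy hz hw (by omega)
  have e2 := h2 x y w z hx hy hw hz (by omega)
  have e3 := ho x y z w hx hy hz hw (by omega)
  simp only [RhombusAt] at e1 e2 ⊢
  rcases max_cases (o (x + 1) y (z + 1) w + o x (y + 1) z (w + 1))
    (o (x + 1) y z (w + 1) + o x (y + 1) (z + 1) w) with h | h <;> linarith

/-- Add `zz + xy ≤ xz + yz` to the lower bound `xw + yz ≤ zw + xy` from the rule: this leaves `zz +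
xw ≤ xz + zw`. -/
lemma IsOctahedral.rhombusAt_top (ho : IsOctahedral n o) {x y z w : ℤ} (hx : 0 ≤ x) (hy : 0 ≤ y)
    (hz : 0 ≤ z) (hw : 0 ≤ w) (hn : x + y + z + w + 2 = n)
    (h : RhombusAt (fun z x y w => o x y z w) z x y w) :
    RhombusAt (fun z x w y => o x y z w) z x w y := by
  have e3 := ho x y z w hx hy hz hw (by omega)
  simp only [RhombusAt] at h ⊢
  have l2 := le_max_right (o (x + 1) y (z + 1) w + o x (y + 1) z (w + 1))
    (o (x + 1) y z (w + 1) + o x (y + 1) (z + 1) w)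
  linarith

/-- Induction on `w`: `rhombusAt_top` turns two rhombi of the layer below into upright ones, and
either branch of the rule combines with one of these. -/
lemma IsOctahedral.rhombusConcave_top (ho : IsOctahedral n o)
    (h : FaceConcave n fun z x y w => o x y z w) :
    RhombusConcave n fun z x y w => o x y z w := by
  have key : ∀ t : ℕ, ∀ x y z w : ℤ, 0 ≤ x → 0 ≤ y → 0 ≤ z → 0 ≤ w → x + y + z + w + 2 = n →
      w = t → RhombusAt (fun z x y w => o x y z w) z x y w := by
    intro t
    induction t with
    | zero =>
      rintro x y z w hx hy hz hw hn rfl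
      exact h z x y hz hx hy (by push_cast at hn; omega)
    | succ t ih =>
      intro x y z w hx hy hz hw hn ht
      push_cast at ht
      obtain ⟨w, rfl⟩ : ∃ w', w = w' + 1 := ⟨w - 1, by omega⟩
      have a1 := ih (x + 1) y z w (by omega) hy hz (by omega) (by omega) (by omega)
      have a2 := ih x (y + 1) z w hx (by omega) hz (by omega) (by omega) (by omega)
      have b2 := ho.rhombusAt_top (x := x) (y := y + 1) (z := z) (w := w) hx (by omega) hz
        (by omega) (by omega) a2
      have b1 := ho.swap_left.rhombusAt_top (x := y) (y := x + 1) (z := z) (w := w) hy (by omega)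
        hz (by omega) (by omega) (by simp only [RhombusAt] at a1 ⊢; linarith)
      have e := ho x y (z + 1) w hx hy (by omega) (by omega) (by omega)
      simp only [RhombusAt] at b1 b2 ⊢
      rw [show z + 1 + 1 = z + 2 by ring] at e
      rcases max_cases (o (x + 1) y (z + 2) w + o x (y + 1) (z + 1) (w + 1))
        (o (x + 1) y (z + 1) (w + 1) + o x (y + 1) (z + 2) w) with h | h <;> linarith
  exact fun z x y w hz hx hy hw hn => key w.toNat x y z w hx hy hz hw (by omega) (by omega)

/-- A function of barycentric coordinates is concave at the unit rhombi of a triangle of size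
`n`. -/
def TriConcave (n : ℕ) (F : ℤ → ℤ → ℤ → ℝ) : Prop :=
  ∀ u v w : ℤ, 0 ≤ u → 0 ≤ v → 0 ≤ w → u + v + w + 2 = n →
    F (u + 2) v w + F u (v + 1) (w + 1) ≤ F (u + 1) (v + 1) w + F (u + 1) v (w + 1) ∧
    F u (v + 2) w + F (u + 1) v (w + 1) ≤ F (u + 1) (v + 1) w + F u (v + 1) (w + 1) ∧
    F u v (w + 2) + F (u + 1) (v + 1) w ≤ F (u + 1) v (w + 1) + F u (v + 1) (w + 1)

/-- Of the three types of rhombi on a final face, one is of the `side` kind and two of the `top`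
kind. The symmetries exchanging `x, y` and `z, w` supply all of them. -/
theorem IsOctahedral.triConcave (ho : IsOctahedral n o)
    (hz : TriConcave n fun x y w => o x y 0 w) (hw : TriConcave n fun x z y => o x y z 0) :
    (TriConcave n fun z y w => o 0 y z w) ∧ TriConcave n fun x z w => o x 0 z w := by
  have f1 : FaceConcave n o := fun x y z h1 h2 h3 h4 => by
    have := (hw x z y h1 h3 h2 (by omega)).1
    simp only [RhombusAt]; linarith
  have f2 : FaceConcave n fun x y z w => o x y w z := fun x y z h1 h2 h3 h4 => by
    have := (hz x y z h1 h2 h3 (by omega)).1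
    simp only [RhombusAt]; linarith
  have f3 : FaceConcave n fun x y z w => o y x z w := fun x y z h1 h2 h3 h4 => by
    have := (hw y z x h2 h3 h1 (by omega)).2.2
    simp only [RhombusAt]; linarith
  have f4 : FaceConcave n fun x y z w => o y x w z := fun x y z h1 h2 h3 h4 => by
    have := (hz y x z h2 h1 h3 (by omega)).2.1
    simp only [RhombusAt]; linarith
  have f5 : FaceConcave n fun z x y w => o x y z w := fun z x y h1 h2 h3 h4 => by
    have := (hw x z y h2 h1 h3 (by omega)).2.1
    simp only [RhombusAt]; linarith
  have f6 : FaceConcave n fun z x y w => o x y w z := fun z x y h1 h2 h3 h4 => by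
    have := (hz x y z h2 h3 h1 (by omega)).2.2
    simp only [RhombusAt]; linarith
  obtain ⟨a1, a2⟩ := ho.rhombusConcave_base f1 f2
  obtain ⟨a3, a4⟩ := ho.swap_left.rhombusConcave_base f3 f4
  have b1 := ho.rhombusConcave_side a1 a2
  have b2 := ho.swap_left.rhombusConcave_side a3 a4
  have c1 := ho.rhombusConcave_top f5
  have c2 := ho.swap_right.rhombusConcave_top f6
  constructor
  · intro z y w h1 h2 h3 h4
    have d1 := b2 y z w 0 h2 h1 h3 le_rfl (by omega)
    have d2 := ho.swap_left.rhombusAt_top (x := y) (y := 0) (z := z) (w := w) h2 le_rfl h1 h3 (by omega)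
      (by have := c1 z 0 y w h1 le_rfl h2 h3 (by omega)
          simp only [RhombusAt] at this ⊢; linarith)
    have d3 := ho.swap_left.swap_right.rhombusAt_top (x := y) (y := 0) (z := w) (w := z) h2 le_rfl h3 h1 (by omega)
      (by have := c2 w 0 y z h3 le_rfl h2 h1 (by omega)
          simp only [RhombusAt] at this ⊢; linarith)
    simp only [RhombusAt] at d1 d2 d3
    refine ⟨?_, ?_, ?_⟩ <;> linarith
  · intro x z w h1 h2 h3 h4
    have d1 := b1 x z w 0 h1 h2 h3 le_rfl (by omega)
    have d2 := ho.rhombusAt_top (x := x) (y := 0) (z := z) (w := w) h1 le_rfl h2 h3 (by omega)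
      (c1 z x 0 w h2 h1 le_rfl h3 (by omega))
    have d3 := ho.swap_right.rhombusAt_top (x := x) (y := 0) (z := w) (w := z) h1 le_rfl h3 h2 (by omega)
      (c2 w x 0 z h3 h1 le_rfl h2 (by omega))
    simp only [RhombusAt] at d1 d2 d3
    refine ⟨?_, ?_, ?_⟩ <;> linarith

end HiveOct

namespace HiveOct

open Finset

/-! ### Pairs of hives and concave functions on the square -/

variable {n : ℕ}

lemma TriConcave.congr {F G : ℤ → ℤ → ℤ → ℝ} (hF : TriConcave n F)
    (h : ∀ u v w : ℤ, 0 ≤ u → 0 ≤ v → 0 ≤ w → u + v + w = n → G u v w = F u v w) :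
    TriConcave n G := by
  intro u v w hu hv hw hn
  rw [h (u + 2) v w (by omega) hv hw (by omega), h u (v + 2) w hu (by omega) hw (by omega),
    h u v (w + 2) hu hv (by omega) (by omega),
    h (u + 1) (v + 1) w (by omega) (by omega) hw (by omega),
    h (u + 1) v (w + 1) (by omega) hv (by omega) (by omega),
    h u (v + 1) (w + 1) hu (by omega) (by omega) (by omega)]
  exact hF u v w hu hv hw hn

lemma TriConcave.add_const {F : ℤ → ℤ → ℤ → ℝ} (hF : TriConcave n F) (c : ℝ) :
    TriConcave n fun u v w => F u v w + c := by
  intro u v w hu hv hw hn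
  obtain ⟨h1, h2, h3⟩ := hF u v w hu hv hw hn
  refine ⟨?_, ?_, ?_⟩ <;> linarith

lemma triConcave_iff_of_eq_sub {F G : ℤ → ℤ → ℤ → ℝ} (c : ℝ)
    (h : ∀ u v w : ℤ, 0 ≤ u → 0 ≤ v → 0 ≤ w → u + v + w = n → G u v w = F u v w - c) :
    TriConcave n F ↔ TriConcave n G := by
  constructor
  · intro hF
    exact (hF.add_const (-c)).congr fun u v w hu hv hw hn => by
      rw [h u v w hu hv hw hn, sub_eq_add_neg]
  · intro hG
    exact (hG.add_const c).congr fun u v w hu hv hw hn => by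
      rw [h u v w hu hv hw hn, sub_add_cancel]

lemma triExt_apply {h : Tri n → ℝ} {p : ℤ × ℤ} (hp : p ∈ Tri n) : triExt h p = h ⟨p, hp⟩ :=
  dif_pos hp

lemma triExt_coe (h : Tri n → ℝ) (p : Tri n) : triExt h p = h p := dif_pos p.2

/-- The barycentric coordinates of `(i, j)` are `u = n - j`, `v = j - i`, `w = i`; the three types
of rhombi become the three inequalities. -/
lemma isHive_iff {h : Tri n → ℝ} :
    IsHive n h ↔ TriConcave n fun _ v w => triExt h (w, v + w) := by
  constructor
  · intro hh u v w hu hv hw hn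
    have m1 : (w, v + w) ∈ Tri n := ⟨hw, by dsimp only; omega, by dsimp only; omega⟩
    have m2 : (w + 1, v + 1 + (w + 1)) ∈ Tri n :=
      ⟨by dsimp only; omega, by dsimp only; omega, by dsimp only; omega⟩
    have m3 : (w, v + 1 + w) ∈ Tri n := ⟨hw, by dsimp only; omega, by dsimp only; omega⟩
    have m4 : (w + 1, v + (w + 1)) ∈ Tri n :=
      ⟨by dsimp only; omega, by dsimp only; omega, by dsimp only; omega⟩
    have m5 : (w, v + 2 + w) ∈ Tri n := ⟨hw, by dsimp only; omega, by dsimp only; omega⟩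
    have m6 : (w + 2, v + (w + 2)) ∈ Tri n :=
      ⟨by dsimp only; omega, by dsimp only; omega, by dsimp only; omega⟩
    dsimp only
    rw [triExt_apply m1, triExt_apply m2, triExt_apply m3, triExt_apply m4, triExt_apply m5,
      triExt_apply m6]
    refine ⟨?_, ?_, ?_⟩
    · rw [add_comm (h ⟨_, m3⟩)]
      refine hh _ _ _ _ ⟨w, v + w, Or.inr (Or.inl ⟨rfl, ?_, ?_, ?_⟩)⟩ <;>
        refine Prod.ext ?_ ?_ <;> dsimp only <;> omega
    · refine hh _ _ _ _ ⟨w, v + 2 + w, Or.inr (Or.inr ⟨rfl, ?_, ?_, ?_⟩)⟩ <;>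
        refine Prod.ext ?_ ?_ <;> dsimp only <;> omega
    · rw [add_comm (h ⟨_, m6⟩)]
      refine hh _ _ _ _ ⟨w, v + 1 + w, Or.inl ⟨rfl, ?_, ?_, ?_⟩⟩ <;>
        refine Prod.ext ?_ ?_ <;> dsimp only <;> omega
  · intro hh A B C D hr
    have hA := A.2
    have hB := B.2
    have hC := C.2
    have hD := D.2
    rw [← triExt_coe h A, ← triExt_coe h B, ← triExt_coe h C, ← triExt_coe h D]
    obtain ⟨i, j, ⟨eA, eB, eC, eD⟩ | ⟨eA, eB, eC, eD⟩ | ⟨eA, eB, eC, eD⟩⟩ := hr <;>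
      rw [eA] at hA ⊢ <;> rw [eB] at hB ⊢ <;> rw [eC] at hC ⊢ <;> rw [eD] at hD ⊢ <;>
      simp only [Tri, Set.mem_ofPred_eq] at hA hB hC hD
    · have := (hh (n - j - 1) (j - i - 1) i (by omega) (by omega) (by omega) (by ring)).2.2
      ring_nf at this ⊢
      linarith
    · have := (hh (n - j - 2) (j - i) i (by omega) (by omega) (by omega) (by ring)).1
      ring_nf at this ⊢
      linarith
    · have := (hh (n - j) (j - i - 2) i (by omega) (by omega) (by omega) (by ring)).2.1
      ring_nf at this ⊢
      linarith

/-- Concavity of `κ` on the two triangles cut out by the antidiagonal. -/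
def AntidiagonalConcave (n : ℕ) (κ : ℤ × ℤ → ℝ) : Prop :=
  (TriConcave n fun x y w => κ (x + w, y + w)) ∧ TriConcave n fun x _ y => κ (x, y)

/-- Concavity of `η` on the two triangles cut out by the diagonal. -/
def DiagonalConcave (n : ℕ) (η : ℤ × ℤ → ℝ) : Prop :=
  (TriConcave n fun _ y w => η (w, y + w)) ∧ TriConcave n fun x _ w => η (x + w, w)

lemma InitialFaces.antidiagonalConcave_iff {o : ℤ → ℤ → ℤ → ℤ → ℝ} {κ : ℤ × ℤ → ℝ}
    (h : InitialFaces n o κ) : AntidiagonalConcave n κ ↔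
      (TriConcave n fun x y w => o x y 0 w) ∧ TriConcave n fun x z y => o x y z 0 := by
  refine and_congr (triConcave_iff_of_eq_sub 0 fun x y w hx hy hw hn => ?_)
    (triConcave_iff_of_eq_sub 0 fun x z y hx hz hy hn => ?_)
  · rw [← h.1 _ _ (by omega) (by omega) (by omega), sub_zero]
    congr 1 <;> omega
  · rw [← h.2 _ _ hx hy (by omega), sub_zero]
    congr 1
    omega

lemma FinalFaces.diagonalConcave_iff {o : ℤ → ℤ → ℤ → ℤ → ℝ} {η : ℤ × ℤ → ℝ}
    (h : FinalFaces n o η) : DiagonalConcave n η ↔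
      (TriConcave n fun z y w => o 0 y z w) ∧ TriConcave n fun x z w => o x 0 z w := by
  refine and_congr (triConcave_iff_of_eq_sub 0 fun z y w hz hy hw hn => ?_)
    (triConcave_iff_of_eq_sub 0 fun x z w hx hz hw hn => ?_)
  · rw [← h.1 _ _ hw (by omega) (by omega), sub_zero]
    congr 1 <;> omega
  · rw [← h.2 _ _ hw (by omega) (by omega), sub_zero]
    congr 1 <;> omega

/-- The reflection of the square that exchanges its diagonals. -/
def reflect (n : ℕ) (κ : ℤ × ℤ → ℝ) (p : ℤ × ℤ) : ℝ := κ (n - p.1, p.2)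

lemma reflect_reflect (κ : ℤ × ℤ → ℝ) : reflect n (reflect n κ) = κ := by
  ext p
  simp only [reflect, sub_sub_cancel]

/-- Exchanging the pairs `x, y` and `z, w` interchanges initial and final faces, and on the square
it is the reflection. Hence the inverse of the construction is its conjugate by the reflection. -/
lemma OctRecurrence.reflect {κ η : ℤ × ℤ → ℝ} (h : OctRecurrence n κ η) :
    OctRecurrence n (reflect n η) (reflect n κ) := by
  rw [octRecurrence_iff_exists] at h ⊢
  obtain ⟨o, ho, h1, h2⟩ := h
  refine ⟨_, ho.swap_pairs, ⟨fun i j hi hj hij => ?_, fun i j hi hj hij => ?_⟩,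
    ⟨fun i j hi hij hj => ?_, fun i j hj hij hi => ?_⟩⟩ <;> simp only [HiveOct.reflect]
  · rw [← h2.1 (n - i) j (by omega) (by omega) hj]
    congr 1
    omega
  · rw [← h2.2 (n - i) j hj (by omega) (by omega)]
    congr 1
    omega
  · rw [← h1.1 (n - i) j (by omega) hj (by omega)]
    congr 1 <;> omega
  · rw [← h1.2 (n - i) j (by omega) hj (by omega)]
    congr 1
    omega

lemma OctRecurrence.congr {κ κ' η η' : ℤ × ℤ → ℝ} (h : OctRecurrence n κ η)
    (hκ : Set.EqOn κ κ' (Square n)) (hη : Set.EqOn η η' (Square n)) :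
    OctRecurrence n κ' η' := by
  obtain ⟨o, ho, h1, h2, h3, h4⟩ := h
  refine ⟨o, ho, fun i j hi hj hij => ?_, fun i j hi hj hij => ?_, fun i j hi hij hj => ?_,
    fun i j hj hij hi => ?_⟩
  · rw [h1 i j hi hj hij]
    exact hκ ⟨by dsimp only; omega, hi, by dsimp only; omega, hj⟩
  · rw [h2 i j hi hj hij]
    exact hκ ⟨hi, by dsimp only; omega, hj, by dsimp only; omega⟩
  · rw [h3 i j hi hij hj]
    exact hη ⟨hi, by dsimp only; omega, by dsimp only; omega, hj⟩
  · rw [h4 i j hj hij hi]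
    exact hη ⟨by dsimp only; omega, hi, hj, by dsimp only; omega⟩

lemma octRecurrence_iff_lozengeMax {κ η : ℤ × ℤ → ℝ} :
    OctRecurrence n κ η ↔ Set.EqOn η (lozengeMax n κ) (Square n) := by
  rw [octRecurrence_iff]
  exact forall₂_congr fun v _ => by rw [lozengeMax_eq_octState]

lemma octRecurrence_lozengeMax (κ : ℤ × ℤ → ℝ) : OctRecurrence n κ (lozengeMax n κ) :=
  octRecurrence_iff_lozengeMax.2 fun _ _ => rfl

lemma exists_octRecurrence (η : ℤ × ℤ → ℝ) : ∃ κ, OctRecurrence n κ η :=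
  ⟨_, by simpa only [reflect_reflect] using
    (octRecurrence_lozengeMax (n := n) (reflect n η)).reflect⟩

lemma OctRecurrence.eqOn {κ κ' η : ℤ × ℤ → ℝ} (h : OctRecurrence n κ η)
    (h' : OctRecurrence n κ' η) : Set.EqOn κ κ' (Square n) := by
  have e1 := octRecurrence_iff_lozengeMax.1 h.reflect
  have e2 := octRecurrence_iff_lozengeMax.1 h'.reflect
  intro p hp
  have : ((n : ℤ) - p.1, p.2) ∈ Square n := by
    obtain ⟨h1, h2, h3, h4⟩ := hp
    exact ⟨by dsimp only; omega, by dsimp only; omega, h3, h4⟩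
  simpa only [HiveOct.reflect, sub_sub_cancel] using (e1 this).trans (e2 this).symm

lemma OctRecurrence.diagonalConcave {κ η : ℤ × ℤ → ℝ} (h : OctRecurrence n κ η)
    (hκ : AntidiagonalConcave n κ) : DiagonalConcave n η := by
  obtain ⟨o, ho, h1, h2⟩ := octRecurrence_iff_exists.1 h
  rw [h1.antidiagonalConcave_iff] at hκ
  rw [h2.diagonalConcave_iff]
  exact ho.triConcave hκ.1 hκ.2

lemma OctRecurrence.antidiagonalConcave {κ η : ℤ × ℤ → ℝ} (h : OctRecurrence n κ η)
    (hη : DiagonalConcave n η) : AntidiagonalConcave n κ := by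
  obtain ⟨o, ho, h1, h2⟩ := octRecurrence_iff_exists.1 h
  rw [h2.diagonalConcave_iff] at hη
  rw [h1.antidiagonalConcave_iff]
  -- Time reversal makes this the forward statement; what remains is to permute the barycentric
  -- coordinates on each face.
  have := ho.swap_pairs.triConcave (n := n)
    (fun u v w hu hv hw hn => by
      have := hη.1 u w v hu hw hv (by omega)
      refine ⟨?_, ?_, ?_⟩ <;> linarith [this.1, this.2.1, this.2.2])
    (fun u v w hu hv hw hn => by
      have := hη.2 v u w hv hu hw (by omega)
      refine ⟨?_, ?_, ?_⟩ <;> linarith [this.1, this.2.1, this.2.2])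
  constructor
  · intro u v w hu hv hw hn
    have := this.1 u w v hu hw hv (by omega)
    refine ⟨?_, ?_, ?_⟩ <;> linarith [this.1, this.2.1, this.2.2]
  · intro u v w hu hv hw hn
    have := this.2 v u w hv hu hw (by omega)
    refine ⟨?_, ?_, ?_⟩ <;> linarith [this.1, this.2.1, this.2.2]

end HiveOct

namespace HiveOct

open Finset

/-! ### The bijection -/

variable {n : ℕ}

lemma psum_zero (x : Fin n → ℝ) : psum x 0 = 0 :=
  sum_eq_zero fun m _ => if_neg (by omega)

lemma psum_self (x : Fin n → ℝ) : psum x n = ∑ m, x m :=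
  sum_congr rfl fun m _ => if_pos (by omega)

lemma psum_add_one (x : Fin n → ℝ) (m : Fin n) :
    psum x ((m : ℕ) + 1) = psum x (m : ℕ) + x m := by
  have : x m = ∑ k : Fin n, if k = m then x k else 0 := by simp
  rw [psum, psum, this, ← sum_add_distrib]
  refine sum_congr rfl fun k _ => ?_
  rcases lt_trichotomy (k : ℕ) m with h | h | h
  · rw [if_pos (by omega), if_pos (by omega), if_neg (by rintro rfl; omega), add_zero]
  · rw [if_pos (by omega), if_neg (by omega), if_pos (Fin.ext h), zero_add]
  · rw [if_neg (by omega), if_neg (by omega), if_neg (by rintro rfl; omega), add_zero]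

/-- A concave sequence starting at `0` consists of the partial sums of a non-increasing tuple. -/
lemma exists_antitone_psum {f : ℤ → ℝ} (h0 : f 0 = 0)
    (hf : ∀ j : ℤ, 0 ≤ j → j + 2 ≤ n → f j + f (j + 2) ≤ 2 * f (j + 1)) :
    ∃ σ : Fin n → ℝ, Antitone σ ∧ ∀ j : ℤ, 0 ≤ j → j ≤ n → f j = psum σ j := by
  refine ⟨fun m => f ((m : ℕ) + 1) - f (m : ℕ), ?_, ?_⟩
  · rintro ⟨a, ha⟩ ⟨b, hb⟩ hab
    dsimp only
    replace hab : a ≤ b := hab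
    induction b, hab using Nat.le_induction with
    | base => exact le_rfl
    | succ b hab ih =>
      have := hf b (by omega) (by omega)
      have := ih (by omega)
      push_cast
      rw [show (b : ℤ) + 1 + 1 = b + 2 by ring]
      linarith
  · intro j hj hjn
    lift j to ℕ using hj
    induction j with
    | zero => rw [Nat.cast_zero, psum_zero, h0]
    | succ j ih =>
      have := psum_add_one (fun m : Fin n => f ((m : ℕ) + 1) - f (m : ℕ)) ⟨j, by omega⟩
      push_cast
      rw [this, ← ih (by omega)]
      ring

/-- The boundary values on the square that are prescribed by the outer boundary conditions. -/
def BoundaryValues (lam mu gam pi : Fin n → ℝ) (κ : ℤ × ℤ → ℝ) : Prop :=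
  ∀ j : ℤ, 0 ≤ j → j ≤ n → κ (0, j) = psum lam j ∧ κ (j, n) = ∑ m, lam m + psum mu j ∧
    κ (n - j, 0) = psum gam j - ∑ m, gam m ∧ κ (n, j) = psum pi j - ∑ m, gam m

lemma not_mem_interior_iff {v : ℤ × ℤ} (hv : v ∈ Square n) :
    v ∉ Interior n ↔ v.1 = 0 ∨ v.1 = n ∨ v.2 = 0 ∨ v.2 = n := by
  obtain ⟨h1, h2, h3, h4⟩ := hv
  simp only [Interior, mem_product, mem_Ioo]
  omega

lemma BoundaryValues.eq {lam mu gam pi : Fin n → ℝ} {κ κ' : ℤ × ℤ → ℝ}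
    (h : BoundaryValues lam mu gam pi κ) (h' : BoundaryValues lam mu gam pi κ') {v : ℤ × ℤ}
    (hv : v ∈ Square n) (hvi : v ∉ Interior n) : κ v = κ' v := by
  rw [not_mem_interior_iff hv] at hvi
  obtain ⟨i, j⟩ := v
  obtain ⟨h1, h2, h3, h4⟩ := hv
  dsimp only at *
  obtain rfl | rfl | rfl | rfl := hvi
  · rw [(h j h3 h4).1, (h' j h3 h4).1]
  · rw [(h j h3 h4).2.2.2, (h' j h3 h4).2.2.2]
  · have := ((h (n - i) (by omega) (by omega)).2.2.1).trans
      (h' (n - i) (by omega) (by omega)).2.2.1.symm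
    rwa [sub_sub_cancel] at this
  · rw [(h i h1 h2).2.1, (h' i h1 h2).2.1]

lemma BoundaryValues.congr {lam mu gam pi : Fin n → ℝ} {κ κ' : ℤ × ℤ → ℝ}
    (h : BoundaryValues lam mu gam pi κ)
    (h' : ∀ v ∈ Square n, v ∉ Interior n → κ v = κ' v) : BoundaryValues lam mu gam pi κ' := by
  intro j hj hjn
  have key : ∀ v : ℤ × ℤ, 0 ≤ v.1 → v.1 ≤ n → 0 ≤ v.2 → v.2 ≤ n →
      (v.1 = 0 ∨ v.1 = n ∨ v.2 = 0 ∨ v.2 = n) → κ v = κ' v := fun v h1 h2 h3 h4 h5 =>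
    h' v ⟨h1, h2, h3, h4⟩ ((not_mem_interior_iff ⟨h1, h2, h3, h4⟩).2 h5)
  rw [← key (0, j), ← key (j, n), ← key (n - j, 0), ← key (n, j)]
  · exact h j hj hjn
  all_goals (dsimp only; omega)

lemma OctRecurrence.eq_of_boundary {κ η : ℤ × ℤ → ℝ} (h : OctRecurrence n κ η) {v : ℤ × ℤ}
    (hv : v ∈ Square n) (hvi : v ∉ Interior n) : η v = κ v := by
  rw [octRecurrence_iff.1 h v hv, octState_eq_of_boundary hvi]

lemma OctRecurrence.boundaryValues_iff {lam mu gam pi : Fin n → ℝ} {κ η : ℤ × ℤ → ℝ}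
    (h : OctRecurrence n κ η) :
    BoundaryValues lam mu gam pi κ ↔ BoundaryValues lam mu gam pi η :=
  ⟨fun hκ => hκ.congr fun _ hv hvi => (h.eq_of_boundary hv hvi).symm,
    fun hη => hη.congr fun _ hv hvi => h.eq_of_boundary hv hvi⟩

/-- The two functions of a pair agree where the encoding `kTilde` glues them. -/
def SourceGlue (x : (Tri n → ℝ) × (Tri n → ℝ)) : Prop :=
  ∀ j : ℤ, 0 ≤ j → j ≤ n → triExt x.1 (0, j) = triExt x.2 (j, j)

/-- The two functions of a pair agree where the encoding `hTilde` glues them. -/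
def TargetGlue (gam : Fin n → ℝ) (x : (Tri n → ℝ) × (Tri n → ℝ)) : Prop :=
  ∀ j : ℤ, 0 ≤ j → j ≤ n → triExt x.1 (j, j) = triExt x.2 (j, n) - ∑ m, gam m

variable {gam : Fin n → ℝ} {x y : (Tri n → ℝ) × (Tri n → ℝ)}

lemma kTilde_of_ge {i j : ℤ} (h : n ≤ i + j) :
    kTilde gam x (i, j) = triExt x.1 (i + j - n, j) - ∑ m, gam m := if_pos h

lemma SourceGlue.kTilde_of_le (hx : SourceGlue x) {i j : ℤ} (hi : 0 ≤ i) (hj : 0 ≤ j)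
    (h : i + j ≤ n) : kTilde gam x (i, j) = triExt x.2 (j, n - i) - ∑ m, gam m := by
  rcases h.eq_or_lt with h | h
  · rw [kTilde_of_ge h.ge, show i + j - n = 0 by omega, show (n : ℤ) - i = j by omega,
      hx j hj (by omega)]
  · exact if_neg (not_le.2 h)

lemma hTilde_of_le {i j : ℤ} (h : i ≤ j) : hTilde gam x (i, j) = triExt x.1 (i, j) := if_pos h

lemma TargetGlue.hTilde_of_ge (hx : TargetGlue gam x) {i j : ℤ} (hi : i ≤ n) (hj : 0 ≤ j)
    (h : j ≤ i) : hTilde gam x (i, j) = triExt x.2 (j, n - i + j) - ∑ m, gam m := by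
  rcases h.eq_or_lt with rfl | h
  · rw [hTilde_of_le le_rfl, sub_add_cancel, hx j hj hi]
  · exact if_neg (not_le.2 h)

lemma SourceGlue.isHive_iff (hx : SourceGlue x) :
    IsHive n x.1 ∧ IsHive n x.2 ↔ AntidiagonalConcave n (kTilde gam x) := by
  refine and_congr (HiveOct.isHive_iff.trans
    (triConcave_iff_of_eq_sub (∑ m, gam m) fun u v w hu hv hw hn => ?_))
    (HiveOct.isHive_iff.trans
      (triConcave_iff_of_eq_sub (∑ m, gam m) fun u v w hu hv hw hn => ?_))
  · rw [kTilde_of_ge (by omega), show u + w + (v + w) - n = w by omega]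
  · rw [hx.kTilde_of_le hu hw (by omega), show (n : ℤ) - u = v + w by omega]

lemma TargetGlue.isHive_iff (hx : TargetGlue gam x) :
    IsHive n x.1 ∧ IsHive n x.2 ↔ DiagonalConcave n (hTilde gam x) := by
  refine and_congr (HiveOct.isHive_iff.trans
    (triConcave_iff_of_eq_sub 0 fun u v w hu hv hw hn => ?_))
    (HiveOct.isHive_iff.trans
      (triConcave_iff_of_eq_sub (∑ m, gam m) fun u v w hu hv hw hn => ?_))
  · rw [hTilde_of_le (by omega), sub_zero]
  · rw [hx.hTilde_of_ge (by omega) hw (by omega), show (n : ℤ) - (u + w) + w = v + w by omega]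

lemma mem_HIVE_iff {lam mu nu : Fin n → ℝ} {h : Tri n → ℝ} :
    h ∈ HIVE lam mu nu ↔ IsHive n h ∧ ∀ j : ℤ, 0 ≤ j → j ≤ n → triExt h (0, j) = psum lam j ∧
      triExt h (j, n) = ∑ m, lam m + psum mu j ∧ triExt h (j, j) = psum nu j := by
  refine and_congr_right fun _ => ⟨fun hh j hj hjn => ?_, ?_⟩
  · have m1 : ((0 : ℤ), j) ∈ Tri n := ⟨le_rfl, hj, hjn⟩
    have m2 : (j, (n : ℤ)) ∈ Tri n := ⟨hj, hjn, le_rfl⟩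
    have m3 : (j, j) ∈ Tri n := ⟨hj, le_rfl, hjn⟩
    rw [triExt_apply m1, triExt_apply m2, triExt_apply m3]
    exact ⟨(hh ⟨_, m1⟩).1 rfl, (hh ⟨_, m2⟩).2.1 rfl, (hh ⟨_, m3⟩).2.2 rfl⟩
  · rintro hh ⟨⟨i, j⟩, hp⟩
    rw [← triExt_apply (h := h) hp]
    obtain ⟨h1, h2, h3⟩ := hp
    dsimp only at h1 h2 h3 ⊢
    refine ⟨?_, ?_, ?_⟩
    · rintro rfl
      exact (hh j h2 h3).1
    · rintro rfl
      exact (hh i h1 h2).2.1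
    · rintro rfl
      exact (hh i h1 h3).2.2

/-- The union over `σ` disappears: the common boundary of two glued hives starts at 0 and is
concave, so it is automatically the sequence of partial sums of a non-increasing `σ`. -/
lemma mem_sourcePairs_iff {lam mu pi : Fin n → ℝ} : x ∈ SourcePairs lam mu gam pi ↔
    SourceGlue x ∧ AntidiagonalConcave n (kTilde gam x) ∧
      BoundaryValues lam mu gam pi (kTilde gam x) := by
  simp only [SourcePairs, Set.mem_iUnion, exists_prop, Set.mem_prod, mem_HIVE_iff]
  constructor
  · rintro ⟨σ, -, ⟨hx1, h1⟩, hx2, h2⟩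
    have hg : SourceGlue x := fun j hj hjn => by rw [(h1 j hj hjn).1, (h2 j hj hjn).2.2]
    refine ⟨hg, hg.isHive_iff.1 ⟨hx1, hx2⟩, fun j hj hjn => ⟨?_, ?_, ?_, ?_⟩⟩
    · rw [hg.kTilde_of_le le_rfl hj (by omega), sub_zero, (h2 j hj hjn).2.1, add_sub_cancel_left]
    · rw [kTilde_of_ge (by omega), add_sub_cancel_right, (h1 j hj hjn).2.1, ← psum_self σ,
        ← (h2 n (by omega) le_rfl).2.2, (h2 n (by omega) le_rfl).2.1, psum_self]
      ring
    · rw [hg.kTilde_of_le (by omega) le_rfl (by omega), sub_sub_cancel, (h2 j hj hjn).1]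
    · rw [kTilde_of_ge (by omega), add_sub_cancel_left, (h1 j hj hjn).2.2]
  · rintro ⟨hg, hc, hb⟩
    obtain ⟨hx1, hx2⟩ := hg.isHive_iff.2 hc
    have h0 : triExt x.1 (0, 0) = 0 := by
      have := (hb 0 le_rfl (by omega)).2.2.1
      rw [kTilde_of_ge (by omega), psum_zero] at this
      simpa using this
    obtain ⟨σ, hσ, hσ'⟩ := exists_antitone_psum (n := n) (f := fun j => triExt x.1 (0, j)) h0
      fun j hj hjn => by
        -- The sum of two neighbouring rhombi along the edge of the hive is concavity of the edge
        -- values.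
        have := isHive_iff.1 hx1 (n - j - 2) j 0 (by omega) hj le_rfl (by ring)
        simp only [add_zero] at this
        linarith [this.1, this.2.1]
    refine ⟨σ, hσ, ⟨hx1, fun j hj hjn => ⟨hσ' j hj hjn, ?_, ?_⟩⟩, hx2, fun j hj hjn =>
      ⟨?_, ?_, ?_⟩⟩
    · have e1 := (hb j hj hjn).2.1
      have e2 := (hb n (by omega) le_rfl).1
      rw [kTilde_of_ge (by omega)] at e1 e2
      rw [psum_self] at e2
      have e3 := hσ' n (by omega) le_rfl
      rw [psum_self] at e3
      simp only [add_sub_cancel_right, zero_add, sub_self] at e1 e2 e3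
      linarith
    · have e1 := (hb j hj hjn).2.2.2
      rw [kTilde_of_ge (by omega), add_sub_cancel_left] at e1
      linarith
    · have e1 := (hb j hj hjn).2.2.1
      rw [hg.kTilde_of_le (by omega) le_rfl (by omega), sub_sub_cancel] at e1
      linarith
    · have e1 := (hb j hj hjn).1
      rw [hg.kTilde_of_le le_rfl hj (by omega), sub_zero] at e1
      linarith
    · rw [← hg j hj hjn, ← hσ' j hj hjn]

lemma mem_targetPairs_iff {lam mu pi : Fin n → ℝ} : x ∈ TargetPairs lam mu gam pi ↔
    TargetGlue gam x ∧ DiagonalConcave n (hTilde gam x) ∧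
      BoundaryValues lam mu gam pi (hTilde gam x) := by
  simp only [TargetPairs, Set.mem_iUnion, exists_prop, Set.mem_prod, mem_HIVE_iff]
  constructor
  · rintro ⟨ν, -, ⟨hx1, h1⟩, hx2, h2⟩
    have hg : TargetGlue gam x := fun j hj hjn => by
      rw [(h1 j hj hjn).2.2, (h2 j hj hjn).2.1, add_sub_cancel_left]
    refine ⟨hg, hg.isHive_iff.1 ⟨hx1, hx2⟩, fun j hj hjn => ⟨?_, ?_, ?_, ?_⟩⟩
    · rw [hTilde_of_le hj, (h1 j hj hjn).1]
    · rw [hTilde_of_le hjn, (h1 j hj hjn).2.1]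
    · rw [hg.hTilde_of_ge (by omega) le_rfl (by omega), sub_sub_cancel, add_zero,
        (h2 j hj hjn).1]
    · rw [hg.hTilde_of_ge le_rfl hj hjn, sub_self, zero_add, (h2 j hj hjn).2.2]
  · rintro ⟨hg, hc, hb⟩
    obtain ⟨hx1, hx2⟩ := hg.isHive_iff.2 hc
    have h0 : triExt x.1 (0, 0) = 0 := by
      have := (hb 0 le_rfl (by omega)).1
      rwa [hTilde_of_le le_rfl, psum_zero] at this
    obtain ⟨ν, hν, hν'⟩ := exists_antitone_psum (n := n) (f := fun j => triExt x.1 (j, j)) h0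
      fun j hj hjn => by
        -- Again two neighbouring rhombi, now along the diagonal edge, add up to concavity of the
        -- edge values.
        have := isHive_iff.1 hx1 (n - j - 2) 0 j (by omega) le_rfl hj (by ring)
        simp only [zero_add] at this
        linarith [this.1, this.2.2]
    refine ⟨ν, hν, ⟨hx1, fun j hj hjn => ⟨?_, ?_, hν' j hj hjn⟩⟩, hx2, fun j hj hjn =>
      ⟨?_, ?_, ?_⟩⟩
    · rw [← (hb j hj hjn).1, hTilde_of_le hj]
    · rw [← (hb j hj hjn).2.1, hTilde_of_le hjn]
    · have e1 := (hb j hj hjn).2.2.1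
      rw [hg.hTilde_of_ge (by omega) le_rfl (by omega), sub_sub_cancel, add_zero] at e1
      linarith
    · have e1 := hg j hj hjn
      have e2 := hν' j hj hjn
      linarith
    · have e1 := (hb j hj hjn).2.2.2
      rw [hg.hTilde_of_ge le_rfl hj hjn, sub_self, zero_add] at e1
      linarith

/-- The pair encoded by a function on the square cut along the antidiagonal. -/
noncomputable def decodeSource (gam : Fin n → ℝ) (κ : ℤ × ℤ → ℝ) :
    (Tri n → ℝ) × (Tri n → ℝ) :=
  (fun p => κ (n + p.1.1 - p.1.2, p.1.2) + ∑ m, gam m,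
    fun p => κ (n - p.1.2, p.1.1) + ∑ m, gam m)

/-- The pair encoded by a function on the square cut along the diagonal. -/
noncomputable def decodeTarget (gam : Fin n → ℝ) (η : ℤ × ℤ → ℝ) :
    (Tri n → ℝ) × (Tri n → ℝ) :=
  (fun p => η p.1, fun p => η (n + p.1.1 - p.1.2, p.1.1) + ∑ m, gam m)

lemma oct_eq : oct gam x = decodeTarget gam (lozengeMax n (kTilde gam x)) := rfl

lemma sourceGlue_decodeSource (gam : Fin n → ℝ) (κ : ℤ × ℤ → ℝ) :
    SourceGlue (decodeSource gam κ) := by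
  intro j hj hjn
  rw [triExt_apply ⟨le_rfl, hj, hjn⟩, triExt_apply ⟨hj, le_rfl, hjn⟩]
  simp only [decodeSource, add_zero]

lemma targetGlue_decodeTarget (gam : Fin n → ℝ) (η : ℤ × ℤ → ℝ) :
    TargetGlue gam (decodeTarget gam η) := by
  intro j hj hjn
  rw [triExt_apply ⟨hj, le_rfl, hjn⟩, triExt_apply ⟨hj, hjn, le_rfl⟩]
  simp only [decodeTarget, add_sub_cancel_left, add_sub_cancel_right]

lemma kTilde_decodeSource (gam : Fin n → ℝ) (κ : ℤ × ℤ → ℝ) :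
    Set.EqOn (kTilde gam (decodeSource gam κ)) κ (Square n) := by
  rintro ⟨i, j⟩ ⟨h1, h2, h3, h4⟩
  dsimp only at h1 h2 h3 h4
  rcases le_total (n : ℤ) (i + j) with h | h
  · rw [kTilde_of_ge h, triExt_apply ⟨by dsimp only; omega, by dsimp only; omega, h4⟩]
    simp only [decodeSource, add_sub_cancel_right]
    congr 2
    omega
  · rw [(sourceGlue_decodeSource gam κ).kTilde_of_le h1 h3 h,
      triExt_apply ⟨h3, by dsimp only; omega, by dsimp only; omega⟩]
    simp only [decodeSource, add_sub_cancel_right, sub_sub_cancel]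

lemma hTilde_decodeTarget (gam : Fin n → ℝ) (η : ℤ × ℤ → ℝ) :
    Set.EqOn (hTilde gam (decodeTarget gam η)) η (Square n) := by
  rintro ⟨i, j⟩ ⟨h1, h2, h3, h4⟩
  dsimp only at h1 h2 h3 h4
  rcases le_total i j with h | h
  · rw [hTilde_of_le h, triExt_apply ⟨h1, h, h4⟩]
    rfl
  · rw [(targetGlue_decodeTarget gam η).hTilde_of_ge h2 h3 h,
      triExt_apply ⟨h3, by dsimp only; omega, by dsimp only; omega⟩]
    simp only [decodeTarget, add_sub_cancel_right]
    congr 2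
    omega

lemma SourceGlue.eq_decodeSource (hx : SourceGlue x) {κ : ℤ × ℤ → ℝ}
    (h : Set.EqOn (kTilde gam x) κ (Square n)) : x = decodeSource gam κ := by
  refine Prod.ext (funext fun ⟨⟨a, b⟩, hp⟩ => ?_) (funext fun ⟨⟨a, b⟩, hp⟩ => ?_)
  · rw [← triExt_apply (h := x.1) hp]
    obtain ⟨h1, h2, h3⟩ := hp
    dsimp only at h1 h2 h3
    simp only [decodeSource]
    rw [← h ⟨by dsimp only; omega, by dsimp only; omega, by dsimp only; omega, h3⟩,
      kTilde_of_ge (by omega), show (n : ℤ) + a - b + b - n = a by ring, sub_add_cancel]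
  · rw [← triExt_apply (h := x.2) hp]
    obtain ⟨h1, h2, h3⟩ := hp
    dsimp only at h1 h2 h3
    simp only [decodeSource]
    rw [← h ⟨by dsimp only; omega, by dsimp only; omega, h1, by dsimp only; omega⟩,
      hx.kTilde_of_le (by omega) h1 (by omega), sub_sub_cancel, sub_add_cancel]

lemma TargetGlue.eq_decodeTarget (hx : TargetGlue gam x) {η : ℤ × ℤ → ℝ}
    (h : Set.EqOn (hTilde gam x) η (Square n)) : x = decodeTarget gam η := by
  refine Prod.ext (funext fun ⟨⟨a, b⟩, hp⟩ => ?_) (funext fun ⟨⟨a, b⟩, hp⟩ => ?_)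
  · rw [← triExt_apply (h := x.1) hp]
    obtain ⟨h1, h2, h3⟩ := hp
    dsimp only at h1 h2 h3
    simp only [decodeTarget]
    rw [← h ⟨h1, by dsimp only; omega, by dsimp only; omega, h3⟩, hTilde_of_le h2]
  · rw [← triExt_apply (h := x.2) hp]
    obtain ⟨h1, h2, h3⟩ := hp
    dsimp only at h1 h2 h3
    simp only [decodeTarget]
    rw [← h ⟨by dsimp only; omega, by dsimp only; omega, h1, by dsimp only; omega⟩,
      hx.hTilde_of_ge (by omega) h1 (by omega), show (n : ℤ) - (n + a - b) + a = b by ring,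
      sub_add_cancel]

lemma SourceGlue.ext (gam : Fin n → ℝ) (hx : SourceGlue x) (hy : SourceGlue y)
    (h : Set.EqOn (kTilde gam x) (kTilde gam y) (Square n)) : x = y :=
  (hx.eq_decodeSource h).trans (hy.eq_decodeSource (Set.eqOn_refl _ _)).symm

lemma TargetGlue.ext (hx : TargetGlue gam x) (hy : TargetGlue gam y)
    (h : Set.EqOn (hTilde gam x) (hTilde gam y) (Square n)) : x = y :=
  (hx.eq_decodeTarget h).trans (hy.eq_decodeTarget (Set.eqOn_refl _ _)).symm

lemma hTilde_oct (gam : Fin n → ℝ) (x : (Tri n → ℝ) × (Tri n → ℝ)) :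
    Set.EqOn (hTilde gam (oct gam x)) (lozengeMax n (kTilde gam x)) (Square n) :=
  hTilde_decodeTarget gam _

theorem octRecurrence_oct (gam : Fin n → ℝ) (x : (Tri n → ℝ) × (Tri n → ℝ)) :
    OctRecurrence n (kTilde gam x) (hTilde gam (oct gam x)) :=
  octRecurrence_iff_lozengeMax.2 (hTilde_oct gam x)

/-- The recurrence preserves concavity in both directions and fixes the boundary. Reflection gives
uniqueness and existence of the preimage on the square, and the gluing conditions make encoding and
decoding inverse to each other. -/
theorem bijOn_oct (lam mu gam pi : Fin n → ℝ) :
    Set.BijOn (oct gam) (SourcePairs lam mu gam pi) (TargetPairs lam mu gam pi) := by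
  refine ⟨fun x hx => ?_, fun x hx y hy hxy => ?_, fun y hy => ?_⟩
  · obtain ⟨-, h2, h3⟩ := mem_sourcePairs_iff.1 hx
    have h := octRecurrence_oct gam x
    exact mem_targetPairs_iff.2 ⟨targetGlue_decodeTarget gam _, h.diagonalConcave h2,
      h.boundaryValues_iff.1 h3⟩
  · have h := octRecurrence_oct gam y
    rw [← hxy] at h
    exact (mem_sourcePairs_iff.1 hx).1.ext gam (mem_sourcePairs_iff.1 hy).1
      ((octRecurrence_oct gam x).eqOn h)
  · obtain ⟨h1, h2, h3⟩ := mem_targetPairs_iff.1 hy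
    obtain ⟨κ, hκ⟩ := exists_octRecurrence (n := n) (hTilde gam y)
    have h := hκ.congr (kTilde_decodeSource gam κ).symm (Set.eqOn_refl _ _)
    refine ⟨decodeSource gam κ, mem_sourcePairs_iff.2 ⟨sourceGlue_decodeSource gam κ,
      h.antidiagonalConcave h2, h.boundaryValues_iff.2 h3⟩, ?_⟩
    exact (h1.eq_decodeTarget (octRecurrence_iff_lozengeMax.1 h)).symm

theorem injOn_kCoord (lam mu gam pi : Fin n → ℝ) :
    Set.InjOn (kCoord gam) (SourcePairs lam mu gam pi) := by
  intro x hx y hy hxy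
  obtain ⟨h1, -, h3⟩ := mem_sourcePairs_iff.1 hx
  obtain ⟨h1', -, h3'⟩ := mem_sourcePairs_iff.1 hy
  refine h1.ext gam h1' fun v hv => ?_
  by_cases hvi : v ∈ Interior n
  · exact congrFun hxy ⟨v, hvi⟩
  · exact h3.eq h3' hv hvi

theorem injOn_hCoord (lam mu gam pi : Fin n → ℝ) :
    Set.InjOn (hCoord gam) (TargetPairs lam mu gam pi) := by
  intro x hx y hy hxy
  obtain ⟨h1, -, h3⟩ := mem_targetPairs_iff.1 hx
  obtain ⟨h1', -, h3'⟩ := mem_targetPairs_iff.1 hy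
  refine h1.ext h1' fun v hv => ?_
  by_cases hvi : v ∈ Interior n
  · exact congrFun hxy ⟨v, hvi⟩
  · exact h3.eq h3' hv hvi

end HiveOct

namespace HiveOct

open Finset

/-! ### Piecewise linearity -/

variable {n : ℕ}

lemma finite_valid_tiles (n : ℕ) : {t : Tile | t.Valid n}.Finite := by
  have hI : (Set.Icc (0 : ℤ) n).Finite := Set.finite_Icc _ _
  have hII := hI.prod hI
  refine ((((hII.image fun p => Tile.lozI p.1 p.2).union
    (hII.image fun p => Tile.lozII p.1 p.2)).union
    (hII.image fun p => Tile.lozIII p.1 p.2)).union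
    ((hI.image Tile.borderUp).union (hI.image Tile.borderDown))).subset ?_
  intro t ht
  have key : ∀ p ∈ t.verts n, p ∈ Set.Icc (0 : ℤ) n ×ˢ Set.Icc (0 : ℤ) n := by
    rintro p hp
    simp only [Set.mem_prod, Set.mem_Icc]
    rcases ht with ht | ht <;> have := ht p hp <;> omega
  cases t with
  | lozI i j =>
    exact Or.inl (Or.inl (Or.inl ⟨(i, j), key _ (by simp [Tile.verts]), rfl⟩))
  | lozII i j =>
    exact Or.inl (Or.inl (Or.inr ⟨(i, j), key _ (by simp [Tile.verts]), rfl⟩))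
  | lozIII i j =>
    exact Or.inl (Or.inr ⟨(i, j), key _ (by simp [Tile.verts]), rfl⟩)
  | borderUp i =>
    exact Or.inr (Or.inl ⟨i, (key (i, n - i) (by simp [Tile.verts])).1, rfl⟩)
  | borderDown i =>
    exact Or.inr (Or.inr ⟨i, (key (i, n - i) (by simp [Tile.verts])).1, rfl⟩)

instance (n : ℕ) (v : ℤ × ℤ) : Finite {Ξ : Finset Tile // IsTiling n v Ξ} := by
  classical
  have : {Ξ : Finset Tile | IsTiling n v Ξ}.Finite :=
    ((finite_valid_tiles n).toFinset.powerset.finite_toSet).subset fun Ξ hΞ => by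
      rw [mem_coe, mem_powerset]
      exact fun t ht => (finite_valid_tiles n).mem_toFinset.2 (hΞ.1 t ht).1
  exact this.to_subtype

lemma isLinearMap_weight (n : ℕ) (t : Tile) : IsLinearMap ℝ fun κ => t.weight n κ := by
  constructor
  · intro κ κ'
    cases t <;> simp only [Tile.weight, Pi.add_apply] <;> ring
  · intro c κ
    cases t <;> simp only [Tile.weight, Pi.smul_apply, smul_eq_mul] <;> ring

/-- The weight of a tiling as a linear function of the values on the square. -/
noncomputable def tilingWeightLinear (n : ℕ) (v : ℤ × ℤ) (Ξ : Finset Tile) :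
    (ℤ × ℤ → ℝ) →ₗ[ℝ] ℝ where
  toFun κ := tilingWeight n κ v Ξ
  map_add' κ κ' := by
    simp only [tilingWeight, (isLinearMap_weight n _).map_add, sum_add_distrib, Hexagon.weight,
      Pi.add_apply]
    ring
  map_smul' c κ := by
    simp only [tilingWeight, (isLinearMap_weight n _).map_smul, ← mul_sum, Hexagon.weight,
      Pi.smul_apply, smul_eq_mul, RingHom.id_apply]
    ring

/-- The encoding `kTilde` as an affine map. -/
noncomputable def kTildeAffine (gam : Fin n → ℝ) :
    (Tri n → ℝ) × (Tri n → ℝ) →ᵃ[ℝ] (ℤ × ℤ → ℝ) where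
  toFun := kTilde gam
  linear :=
    { toFun := kTilde 0
      map_add' := fun x y => by
        ext p
        simp only [kTilde, triExt, Prod.fst_add, Prod.snd_add, Pi.add_apply, Pi.zero_apply,
          sum_const_zero, sub_zero]
        split_ifs <;> simp
      map_smul' := fun c x => by
        ext p
        simp only [kTilde, triExt, Prod.smul_fst, Prod.smul_snd, Pi.smul_apply, Pi.zero_apply,
          sum_const_zero, sub_zero, smul_eq_mul, RingHom.id_apply]
        split_ifs <;> simp }
  map_vadd' x y := by
    ext p
    simp only [kTilde, triExt, vadd_eq_add, Prod.fst_add, Prod.snd_add, Pi.add_apply,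
      Pi.zero_apply, sum_const_zero, sub_zero, LinearMap.coe_mk, AddHom.coe_mk]
    split_ifs <;> ring

/-- The decoding `decodeTarget` as an affine map. -/
noncomputable def decodeTargetAffine (gam : Fin n → ℝ) :
    (ℤ × ℤ → ℝ) →ᵃ[ℝ] (Tri n → ℝ) × (Tri n → ℝ) where
  toFun := decodeTarget gam
  linear :=
    { toFun := decodeTarget 0
      map_add' := fun x y => by
        ext p <;> simp [decodeTarget]
      map_smul' := fun c x => by
        ext p <;> simp [decodeTarget] }
  map_vadd' x y := by
    ext p <;> simp [decodeTarget, add_assoc]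

/-- The construction of a function on the square from one tiling for each interior vertex. -/
noncomputable def tilingChoiceLinear (n : ℕ)
    (c : (v : Interior n) → {Ξ : Finset Tile // IsTiling n v Ξ}) :
    (ℤ × ℤ → ℝ) →ₗ[ℝ] (ℤ × ℤ → ℝ) :=
  LinearMap.pi fun v =>
    if hv : v ∈ Interior n then tilingWeightLinear n v (c ⟨v, hv⟩) else LinearMap.proj v

lemma isPolyhedron_of_affine {V ι : Type*} [AddCommGroup V] [Module ℝ V] [Finite ι]
    (f g : ι → V →ᵃ[ℝ] ℝ) : IsPolyhedron {x | ∀ i, f i x ≤ g i x} := by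
  obtain ⟨m, ⟨e⟩⟩ := Finite.exists_equiv_fin ι
  refine ⟨m, fun r => (f (e.symm r)).linear - (g (e.symm r)).linear,
    fun r => g (e.symm r) 0 - f (e.symm r) 0, ?_⟩
  ext x
  simp only [Set.mem_ofPred_eq, LinearMap.sub_apply]
  rw [e.symm.surjective.forall]
  refine forall_congr' fun r => ?_
  have h1 := congrFun (f (e.symm r)).decomp x
  have h2 := congrFun (g (e.symm r)).decomp x
  simp only [Pi.add_apply] at h1 h2
  rw [h1, h2]
  constructor <;> intro h <;> linarith

/-- There is one polyhedron for each choice of a tiling at every interior vertex: the region where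
all chosen tilings are optimal. There are finitely many choices, and on each region the map is given
by the chosen weights. -/
theorem isPiecewiseLinearOn_oct (gam : Fin n → ℝ) (S : Set ((Tri n → ℝ) × (Tri n → ℝ))) :
    IsPiecewiseLinearOn (oct gam) S := by
  let ι := (v : Interior n) → {Ξ : Finset Tile // IsTiling n v Ξ}
  let φ (v : ℤ × ℤ) (Ξ : Finset Tile) : (Tri n → ℝ) × (Tri n → ℝ) →ᵃ[ℝ] ℝ :=
    (tilingWeightLinear n v Ξ).toAffineMap.comp (kTildeAffine gam)
  have hφ : ∀ v Ξ x, φ v Ξ x = tilingWeight n (kTilde gam x) v Ξ := fun _ _ _ => rfl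
  obtain ⟨m, ⟨e⟩⟩ := Finite.exists_equiv_fin ι
  refine ⟨m, fun r => {x | ∀ q : (v : Interior n) × {Ξ : Finset Tile // IsTiling n v Ξ},
      φ q.1 q.2 x ≤ φ q.1 (e.symm r q.1) x},
    fun r => (decodeTargetAffine gam).comp
      ((tilingChoiceLinear n (e.symm r)).toAffineMap.comp (kTildeAffine gam)),
    fun r => isPolyhedron_of_affine _ _, fun x _ => ?_, fun r x hx => ?_⟩
  · have : ∀ v : Interior n, ∃ Ξ : {Ξ : Finset Tile // IsTiling n v Ξ},
        ∀ Ξ' : {Ξ : Finset Tile // IsTiling n v Ξ}, φ v Ξ' x ≤ φ v Ξ x := fun v => by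
      obtain ⟨⟨Ξ, h1, h2⟩, h3⟩ := isGreatest_octState (κ := kTilde gam x) v.2
      exact ⟨⟨Ξ, h1⟩, fun Ξ' => by
        rw [hφ, hφ, ← h2]
        exact h3 ⟨Ξ', Ξ'.2, rfl⟩⟩
    choose c hc using this
    refine Set.mem_iUnion.2 ⟨e c, fun q => ?_⟩
    rw [Equiv.symm_apply_apply]
    exact hc q.1 q.2
  · rw [oct_eq]
    refine congrArg (decodeTarget gam) (funext fun v => ?_)
    change _ = tilingChoiceLinear n (e.symm r) (kTilde gam x) v
    rw [tilingChoiceLinear, LinearMap.pi_apply]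
    split_ifs with hv
    · rw [lozengeMax_eq_octState]
      refine (isGreatest_octState hv).unique ⟨⟨_, (e.symm r ⟨v, hv⟩).2, rfl⟩, ?_⟩
      rintro _ ⟨Ξ, hΞ, rfl⟩
      exact hx.2 ⟨⟨v, hv⟩, Ξ, hΞ⟩
    · exact if_neg hv

end HiveOct

namespace HiveOct

open Finset MeasureTheory

/-! ### Volume -/

variable {n : ℕ}

lemma Active.mem_interior {t : ℕ} {v : ℤ × ℤ} (h : Active n t v) : v ∈ Interior n := by
  obtain ⟨h1, h2, h3, h4, -⟩ := h
  simp only [Interior, mem_product, mem_Ioo]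
  omega

/-- The function on the square with the given values in the interior and on the boundary. -/
noncomputable def extendInterior (n : ℕ) (b : ℤ × ℤ → ℝ) (c : Interior n → ℝ) (v : ℤ × ℤ) : ℝ :=
  if hv : v ∈ Interior n then c ⟨v, hv⟩ else b v

lemma extendInterior_coe (b : ℤ × ℤ → ℝ) (c : Interior n → ℝ) (v : Interior n) :
    extendInterior n b c v = c v := dif_pos v.2

/-- One time step of the octahedron recurrence, with fixed boundary values. -/
noncomputable def interiorStep (n t : ℕ) (b : ℤ × ℤ → ℝ) (c : Interior n → ℝ)
    (v : Interior n) : ℝ :=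
  octStep n t (extendInterior n b c) v

lemma extendInterior_interiorStep (t : ℕ) (b : ℤ × ℤ → ℝ) (c : Interior n → ℝ) :
    extendInterior n b (interiorStep n t b c) = octStep n t (extendInterior n b c) := by
  ext v
  by_cases hv : v ∈ Interior n
  · exact dif_pos hv
  · rw [octStep, if_neg fun h => hv h.mem_interior]
    simp only [extendInterior, dif_neg hv]

lemma flipValue_add (S : ℤ × ℤ → ℝ) (v : ℤ × ℤ) : flipValue S v + S v =
    max (S (v.1, v.2 - 1) + S (v.1, v.2 + 1)) (S (v.1 + 1, v.2) + S (v.1 - 1, v.2)) :=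
  sub_add_cancel _ _

lemma Active.not_active_neighbor {t : ℕ} {v v' : ℤ × ℤ} (h : Active n t v)
    (h' : (v.1 + v.2 - (v'.1 + v'.2)) % 2 ≠ 0) : ¬ Active n t v' := by
  rintro ⟨-, -, -, -, h2⟩
  have := h.2.2.2.2
  omega

/-- Active vertices share a parity, so the four neighbours of an active one are inactive. The new
value is thus a function of inactive values minus the old one, which also makes `octStep` an
involution. -/
lemma flipValue_add_congr {t : ℕ} {S S' : ℤ × ℤ → ℝ} {v : ℤ × ℤ} (hv : Active n t v)
    (h : ∀ v', ¬ Active n t v' → S v' = S' v') :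
    flipValue S v + S v = flipValue S' v + S' v := by
  rw [flipValue_add, flipValue_add, h (v.1, v.2 - 1) (hv.not_active_neighbor (by omega)),
    h (v.1, v.2 + 1) (hv.not_active_neighbor (by omega)),
    h (v.1 + 1, v.2) (hv.not_active_neighbor (by omega)),
    h (v.1 - 1, v.2) (hv.not_active_neighbor (by omega))]

lemma octStep_octStep (t : ℕ) (S : ℤ × ℤ → ℝ) : octStep n t (octStep n t S) = S := by
  ext v
  by_cases hv : Active n t v
  · have := flipValue_add_congr (S := octStep n t S) (S' := S) hv fun v' h => if_neg h
    rw [octStep, if_pos hv]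
    rw [octStep, if_pos hv] at this
    linarith
  · rw [octStep, if_neg hv, octStep, if_neg hv]

lemma interiorStep_involutive (n t : ℕ) (b : ℤ × ℤ → ℝ) :
    Function.Involutive (interiorStep n t b) := by
  intro c
  ext v
  rw [interiorStep, extendInterior_interiorStep, octStep_octStep, extendInterior_coe]

lemma measurable_extendInterior (b : ℤ × ℤ → ℝ) (v : ℤ × ℤ) :
    Measurable fun c : Interior n → ℝ => extendInterior n b c v := by
  unfold extendInterior
  split_ifs with hv
  · exact measurable_pi_apply _
  · exact measurable_const

/-- Split the coordinates into inactive `a` and active `c`. The step is the skew product `(a, c) ↦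
(a, F a - c)`, a measurable family of point reflections, so no Jacobian is needed. -/
lemma measurePreserving_interiorStep (n t : ℕ) (b : ℤ × ℤ → ℝ) :
    MeasurePreserving (interiorStep n t b) := by
  let p : Interior n → Prop := fun v => ¬ Active n t v
  let e := MeasurableEquiv.piEquivPiSubtypeProd (fun _ : Interior n => ℝ) p
  have he : MeasurePreserving e := volume_preserving_piEquivPiSubtypeProd (fun _ => ℝ) p
  -- The active coordinates are filled with 0; their value is immaterial, since the sum depends only
  -- on inactive ones.
  let F : ({v // p v} → ℝ) → ({v // ¬ p v} → ℝ) := fun a v =>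
    flipValue (extendInterior n b (e.symm (a, 0))) v.1 + extendInterior n b (e.symm (a, 0)) v.1
  have hext : ∀ v, Measurable fun a : {v // p v} → ℝ =>
      extendInterior n b (e.symm (a, 0)) v := fun v =>
    (measurable_extendInterior b v).comp (e.symm.measurable.comp
      (measurable_id.prodMk measurable_const))
  have hF : Measurable F := by
    refine measurable_pi_iff.2 fun v => ?_
    simp only [F, flipValue_add]
    exact ((hext _).add (hext _)).max ((hext _).add (hext _))
  have hskew : MeasurePreserving
      (fun q : ({v // p v} → ℝ) × ({v // ¬ p v} → ℝ) => (q.1, F q.1 - q.2)) := by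
    refine MeasurePreserving.skew_product (g := fun a c => F a - c) (MeasurePreserving.id volume)
      ((hF.comp measurable_fst).sub measurable_snd) (Filter.Eventually.of_forall fun a => ?_)
    exact (Measure.measurePreserving_sub_left volume (F a)).map_eq
  have heq : interiorStep n t b = e.symm ∘
      (fun q : ({v // p v} → ℝ) × ({v // ¬ p v} → ℝ) => (q.1, F q.1 - q.2)) ∘ e := by
    ext c v
    have happ : ∀ (q : ({v // p v} → ℝ) × ({v // ¬ p v} → ℝ)) (w : Interior n),
        e.symm q w = if hw : p w then q.1 ⟨w, hw⟩ else q.2 ⟨w, hw⟩ := fun _ _ => rfl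
    simp only [Function.comp_apply]
    rw [happ, interiorStep, octStep]
    by_cases hv : Active n t v
    · rw [if_pos hv, dif_neg (not_not.2 hv)]
      dsimp only
      rw [Pi.sub_apply]
      have := flipValue_add_congr (S := extendInterior n b c)
        (S' := extendInterior n b (e.symm ((e c).1, 0))) hv fun v' h => by
          unfold extendInterior
          split_ifs with hv'
          · rw [happ, dif_pos h]
            rfl
          · rfl
      rw [extendInterior_coe] at this
      exact eq_sub_of_add_eq this
    · rw [if_neg hv, dif_pos hv, extendInterior_coe]
      rfl
  rw [heq]
  exact he.symm.comp (hskew.comp he)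

lemma volume_image_interiorStep (t : ℕ) (b : ℤ × ℤ → ℝ) (s : Set (Interior n → ℝ)) :
    volume (interiorStep n t b '' s) = volume s := by
  have h := measurePreserving_interiorStep n t b
  let e : (Interior n → ℝ) ≃ᵐ (Interior n → ℝ) :=
    MeasurableEquiv.ofInvolutive _ (interiorStep_involutive n t b) h.measurable
  -- As the step is its own inverse, the image is a preimage under a measurable equivalence, so `s`
  -- may be arbitrary.
  rw [(interiorStep_involutive n t b).image_eq_preimage_symm]
  exact MeasurePreserving.measure_preimage_equiv (f := e) h s

/-- The first `t` time steps of the octahedron recurrence, with fixed boundary values. -/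
noncomputable def interiorState (n : ℕ) (b : ℤ × ℤ → ℝ) : ℕ → (Interior n → ℝ) → Interior n → ℝ
  | 0 => id
  | t + 1 => interiorStep n (t + 1) b ∘ interiorState n b t

lemma extendInterior_interiorState (b : ℤ × ℤ → ℝ) (t : ℕ) (c : Interior n → ℝ) :
    extendInterior n b (interiorState n b t c) = octState n (extendInterior n b c) t := by
  induction t with
  | zero => rfl
  | succ t ih =>
    rw [interiorState, Function.comp_apply, extendInterior_interiorStep, ih, octState]

lemma volume_image_interiorState (b : ℤ × ℤ → ℝ) (t : ℕ) (s : Set (Interior n → ℝ)) :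
    volume (interiorState n b t '' s) = volume s := by
  induction t with
  | zero => rw [interiorState, Set.image_id]
  | succ t ih => rw [interiorState, Set.image_comp, volume_image_interiorStep, ih]

/-- All pairs in the source have the same boundary values, so those of one `x₀` serve for all. In
coordinates the map is then the composition of the `n` measure-preserving time steps. -/
theorem volume_image_oct {lam mu gam pi : Fin n → ℝ} {E : Set ((Tri n → ℝ) × (Tri n → ℝ))}
    (hE : E ⊆ SourcePairs lam mu gam pi) :
    volume (hCoord gam '' (oct gam '' E)) = volume (kCoord gam '' E) := by
  rcases E.eq_empty_or_nonempty with rfl | ⟨x₀, hx₀⟩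
  · simp only [Set.image_empty]
  rw [← volume_image_interiorState (kTilde gam x₀) n (kCoord gam '' E), Set.image_image,
    Set.image_image]
  congr 1
  refine Set.image_congr fun x hx => ?_
  have hx₀' := (mem_sourcePairs_iff.1 (hE hx₀)).2.2
  have hx' := (mem_sourcePairs_iff.1 (hE hx)).2.2
  have hrec := (octRecurrence_oct gam x).congr
    (κ' := extendInterior n (kTilde gam x₀) (kCoord gam x)) (fun v hv => by
      unfold extendInterior
      split_ifs with hvi
      · rfl
      · exact hx'.eq hx₀' hv hvi) (Set.eqOn_refl _ _)
  ext v
  rw [← extendInterior_coe (kTilde gam x₀) (interiorState n _ n (kCoord gam x)),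
    extendInterior_interiorState]
  refine octRecurrence_iff.1 hrec v ?_
  have hv := v.2
  simp only [Interior, mem_product, mem_Ioo] at hv
  exact ⟨hv.1.1.le, hv.1.2.le, hv.2.1.le, hv.2.2.le⟩

end HiveOct

/-! ### The main theorem -/

theorem theorem4 (n : ℕ) (hn : 2 ≤ n) :
    -- the maximum over the tilings is well defined
    (∀ (κ : ℤ × ℤ → ℝ), ∀ v ∈ HiveOct.Interior n,
      IsGreatest (HiveOct.tilingWeights n κ v) (HiveOct.lozengeMax n κ v)) ∧
    -- the construction agrees with the octahedron recurrence
    (∀ κ η : ℤ × ℤ → ℝ, HiveOct.OctRecurrence n κ η ↔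
      ∀ v ∈ HiveOct.Square n, η v = HiveOct.lozengeMax n κ v) ∧
    -- it is a volume-preserving piecewise-linear bijection between pairs of hives
    (∀ lam mu gam pi : Fin n → ℝ,
      StrictAnti lam → StrictAnti mu → StrictAnti gam → StrictAnti pi →
      (∀ x ∈ HiveOct.SourcePairs lam mu gam pi,
        HiveOct.OctRecurrence n (HiveOct.kTilde gam x)
          (HiveOct.hTilde gam (HiveOct.oct gam x))) ∧
      Set.BijOn (HiveOct.oct gam) (HiveOct.SourcePairs lam mu gam pi)
        (HiveOct.TargetPairs lam mu gam pi) ∧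
      HiveOct.IsPiecewiseLinearOn (HiveOct.oct gam) (HiveOct.SourcePairs lam mu gam pi) ∧
      Set.InjOn (HiveOct.kCoord gam) (HiveOct.SourcePairs lam mu gam pi) ∧
      Set.InjOn (HiveOct.hCoord gam) (HiveOct.TargetPairs lam mu gam pi) ∧
      ∀ E ⊆ HiveOct.SourcePairs lam mu gam pi, MeasurableSet E →
        MeasureTheory.volume (HiveOct.hCoord gam '' (HiveOct.oct gam '' E)) =
          MeasureTheory.volume (HiveOct.kCoord gam '' E)) := by
  refine ⟨fun κ v hv => ?_, fun κ η => HiveOct.octRecurrence_iff_lozengeMax,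
    fun lam mu gam pi _ _ _ _ => ⟨fun x _ => HiveOct.octRecurrence_oct gam x,
      HiveOct.bijOn_oct lam mu gam pi, HiveOct.isPiecewiseLinearOn_oct gam _,
      HiveOct.injOn_kCoord lam mu gam pi, HiveOct.injOn_hCoord lam mu gam pi,
      fun E hE _ => HiveOct.volume_image_oct hE⟩⟩
  rw [HiveOct.lozengeMax_eq_octState]
  exact HiveOct.isGreatest_octState hv
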